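/- Let $\mathbb T^2=\mathbb R^2/\mathbb Z^2$. For $k\in\mathbb N$ let $W^{k,2}$ be the Sobolev space of functions on $\mathbb T^2$ whose weak derivatives of order at most $k$ are in $L^2$, with norm $\|v\|_{k,2}=\sum_{|\beta|\le k}\|\partial^\beta v\|_{L^2}$, and put $\|(b,\omega)\|_{\mathcal M}=\|b\|_{3,2}+\|\omega\|_{2,2}$ for $(b,\omega)\in\mathcal M=W^{3,2}\times W^{2,2}$. Let $\mathbf u_h\in W^{3,2}(\mathbb T^2;\mathbb R^2)$ be weakly divergence free, $f\in W^{2,2}$ and $(b_0,\omega_0)\in\mathcal M$. The thermal quasi-geostrophic (TQG) system on $[0,T]$, $T>0$, for $b:[0,T]\to W^{3,2}$ and $\omega:[0,T]\to W^{2,2}$ is $$b(t)=b_0-\int_0^t\mathrm{div}(b\mathbf u)\,d\tau,\qquad \omega(t)=\omega_0-\int_0^t\big[\mathrm{div}((\omega-b)\mathbf u)+\mathrm{div}(b\mathbf u_h)\big]\,d\tau,\qquad t\in[0,T],$$ where at each time $\mathbf u=\nabla^\perp\psi=(-\partial_y\psi,\partial_x\psi)$ with $(\Delta-1)\psi=\omega-f$;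 the identities hold in $L^2(\mathbb T^2)$, with weak divergences and Bochner integrals. A triple $(b,\omega,T)$ is a local strong solution if it satisfies this system, $b\in C([0,T];W^{3,2})$ and $\omega\in C([0,T];W^{2,2})$. **Theorem.** There is a constant $c>0$, depending only on $\|\mathbf u_h\|_{3,2}$ and $\|f\|_{2,2}$, such that for every $(b_0,\omega_0)\in\mathcal M$ and every $T$ with $$0<T<\frac{1}{2c\,(1+\|(b_0,\omega_0)\|_{\mathcal M}^2)}$$ the following hold. 1. There is a solution $(b,\omega)$ of the TQG system on $[0,T]$ with $b\in C_w([0,T];W^{3,2})$, $\omega\in C_w([0,T];W^{2,2})$ (weak continuity) and $$\|(b,\omega)(t)\|_{\mathcal M}^2\le\frac{\|(b_0,\omega_0)\|_{\mathcal M}^2+2c(1+\|(b_0,\omega_0)\|_{\mathcal M}^2)\,t}{1-2c(1+\|(b_0,\omega_0)\|_{\mathcal M}^2)\,t},\qquad t\in(0,T),\tag{$*$}$$ and this $(b,\omega,T)$ is a local strong solution. 2. Every solution $(b,\omega)$ of the TQG system on $[0,T]$ that is weakly continuous as in 1 and satisfies $(*)$ is strongly continuous, that is, $b\in C([0,T];W^{3,2})$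 and $\omega\in C([0,T];W^{2,2})$, so $(b,\omega,T)$ is a local strong solution. -/

import Mathlib

open MeasureTheory Set
open scoped ENNReal

noncomputable section

namespace TQG

/-- The flat two-dimensional torus `ℝ² / ℤ²`. -/
abbrev Torus : Type := Fin 2 → UnitAddCircle

/-- Lebesgue measure on the torus (total mass one). -/
abbrev torusMeasure : Measure Torus :=
  Measure.pi fun _ : Fin 2 => (AddCircle.haarAddCircle : Measure UnitAddCircle)

/-- The plane vectors with the Euclidean norm. -/
abbrev Plane : Type := EuclideanSpace ℝ (Fin 2)

/-- `L²(𝕋²; E)`. -/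
abbrev L2 (E : Type) [NormedAddCommGroup E] : Type := Lp E 2 torusMeasure

/-- The covering map `ℝ² → 𝕋²`. -/
def proj (y : Fin 2 → ℝ) : Torus := fun i => (y i : UnitAddCircle)

/-- Test functions: real functions on the torus whose periodic lift to `ℝ²` is `C^∞`. -/
def IsTest (φ : Torus → ℝ) : Prop := ContDiff ℝ ((⊤ : ℕ∞) : WithTop ℕ∞) fun y : Fin 2 → ℝ => φ (proj y)

/-- The classical partial derivative in the direction of the `j`-th coordinate. -/
def partialDeriv (j : Fin 2) (φ : Torus → ℝ) : Torus → ℝ := fun x =>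
  deriv (fun s : ℝ => φ (x + Pi.single j (s : UnitAddCircle))) 0

/-- The classical derivative `∂^β φ` for the multi-index `β = (m, n)`. -/
def classicalDeriv (m n : ℕ) (φ : Torus → ℝ) : Torus → ℝ :=
  (partialDeriv 0)^[m] ((partialDeriv 1)^[n] φ)

/-- Multi-indices `β = (m, n)` of length `m + n ≤ k`. -/
abbrev MultiIndex (k : ℕ) : Type :=
  {β : Fin (k + 1) × Fin (k + 1) // (β.1 : ℕ) + (β.2 : ℕ) ≤ k}

/-- The multi-index `(m, n)`. -/
def MultiIndex.mk {k : ℕ} (m n : ℕ) (h : m + n ≤ k) : MultiIndex k :=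
  ⟨(⟨m, by omega⟩, ⟨n, by omega⟩), h⟩

/-- `w` is the weak derivative `∂^(m,n) v`. -/
def IsWeakDeriv {E : Type} [NormedAddCommGroup E] [NormedSpace ℝ E] (m n : ℕ) (v w : L2 E) : Prop :=
  ∀ φ : Torus → ℝ, IsTest φ →
    ∫ x, classicalDeriv m n φ x • v x ∂torusMeasure =
      (-1 : ℝ) ^ (m + n) • ∫ x, φ x • w x ∂torusMeasure

section Helpers

theorem isOpenQuotientMap_proj : IsOpenQuotientMap proj :=
  IsOpenQuotientMap.piMap
    (f := fun (_ : Fin 2) (t : ℝ) => (t : UnitAddCircle))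
    fun _ => QuotientAddGroup.isOpenQuotientMap_mk

theorem IsTest.continuous {φ : Torus → ℝ} (hφ : IsTest φ) : Continuous φ :=
  (isOpenQuotientMap_proj.isQuotientMap.continuous_iff).2 (ContDiff.continuous hφ)

theorem proj_add_single (y : Fin 2 → ℝ) (j : Fin 2) (s : ℝ) :
    proj y + Pi.single j (s : UnitAddCircle) = proj (y + s • Pi.single j (1 : ℝ)) := by
  funext i
  by_cases h : i = j
  · subst h; simp [proj]
  · simp [proj, h]

theorem IsTest.partialDeriv {φ : Torus → ℝ} (hφ : IsTest φ) (j : Fin 2) :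
    IsTest (partialDeriv j φ) := by
  have key : (fun y : Fin 2 → ℝ => TQG.partialDeriv j φ (proj y)) =
      fun y => fderiv ℝ (fun y : Fin 2 → ℝ => φ (proj y)) y (Pi.single j 1) := by
    funext y
    have hd : DifferentiableAt ℝ (fun y : Fin 2 → ℝ => φ (proj y)) y :=
      (ContDiff.differentiable hφ (by simp)) y
    simp only [TQG.partialDeriv, proj_add_single]
    exact hd.lineDeriv_eq_fderiv
  unfold IsTest
  rw [key]
  exact (ContDiff.fderiv_right hφ (m := ((⊤ : ℕ∞) : WithTop ℕ∞)) (by simp)).clm_apply contDiff_const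

theorem IsTest.classicalDeriv {φ : Torus → ℝ} (hφ : IsTest φ) (m n : ℕ) :
    IsTest (classicalDeriv m n φ) := by
  have it : ∀ (j : Fin 2) (n : ℕ) (φ : Torus → ℝ), IsTest φ →
      IsTest ((TQG.partialDeriv j)^[n] φ) := by
    intro j n
    induction n with
    | zero => intro φ h; exact h
    | succ n ih => intro φ h; exact ih _ (h.partialDeriv j)
  exact it 0 m _ (it 1 n _ hφ)

variable {E : Type} [NormedAddCommGroup E] [NormedSpace ℝ E]

theorem IsTest.integrable_smul {φ : Torus → ℝ} (hφ : IsTest φ) (v : L2 E) :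
    Integrable (fun x => φ x • v x) torusMeasure := by
  have hv : Integrable (fun x => v x) torusMeasure :=
    (Lp.memLp v).integrable (by norm_num)
  obtain ⟨C, hC⟩ := IsCompact.exists_bound_of_continuousOn isCompact_univ hφ.continuous.continuousOn
  exact hv.bdd_smul C hφ.continuous.aestronglyMeasurable
    (Filter.Eventually.of_forall fun x => hC x (mem_univ x))

theorem IsWeakDeriv.zero (m n : ℕ) : IsWeakDeriv m n (0 : L2 E) 0 := by
  intro φ _
  have h : ∀ φ : Torus → ℝ, ∫ x, φ x • (0 : L2 E) x ∂torusMeasure = 0 := by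
    intro φ
    refine integral_eq_zero_of_ae ?_
    filter_upwards [Lp.coeFn_zero E 2 torusMeasure] with x hx
    rw [hx]
    exact smul_zero (φ x)
  rw [h, h, smul_zero]

theorem integral_smul_coe_add {φ : Torus → ℝ} (hφ : IsTest φ) (v w : L2 E) :
    ∫ x, φ x • (v + w : L2 E) x ∂torusMeasure =
      ∫ x, φ x • v x ∂torusMeasure + ∫ x, φ x • w x ∂torusMeasure := by
  rw [← integral_add (hφ.integrable_smul v) (hφ.integrable_smul w)]
  refine integral_congr_ae ?_
  filter_upwards [Lp.coeFn_add v w] with x hx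
  rw [hx, Pi.add_apply, smul_add]

theorem integral_smul_coe_smul (φ : Torus → ℝ) (a : ℝ) (v : L2 E) :
    ∫ x, φ x • (a • v : L2 E) x ∂torusMeasure = a • ∫ x, φ x • v x ∂torusMeasure := by
  rw [← integral_smul]
  refine integral_congr_ae ?_
  filter_upwards [Lp.coeFn_smul a v] with x hx
  rw [hx, Pi.smul_apply, smul_comm]

theorem IsWeakDeriv.add {m n : ℕ} {v v' w w' : L2 E} (h : IsWeakDeriv m n v w)
    (h' : IsWeakDeriv m n v' w') : IsWeakDeriv m n (v + v') (w + w') := by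
  intro φ hφ
  rw [integral_smul_coe_add (hφ.classicalDeriv m n), integral_smul_coe_add hφ, h φ hφ, h' φ hφ,
    smul_add]

theorem IsWeakDeriv.const_smul {m n : ℕ} {v w : L2 E} (a : ℝ) (h : IsWeakDeriv m n v w) :
    IsWeakDeriv m n (a • v) (a • w) := by
  intro φ hφ
  rw [integral_smul_coe_smul, integral_smul_coe_smul, h φ hφ, smul_comm]

end Helpers

/-- The Sobolev space `W^{k,2}(𝕋²; E)` as a subspace. A function is recorded together with its weak derivatives
`(∂^β v)_{|β| ≤ k}`, all in `L²`, the function itself being the entry at `β = 0`. The norm inherited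
from the `ℓ¹`-sum is `‖v‖ = ∑_{|β| ≤ k} ‖∂^β v‖_{L²}`. -/
def sobolevSubmodule (k : ℕ) (E : Type) [NormedAddCommGroup E] [NormedSpace ℝ E] :
    Submodule ℝ (PiLp 1 fun _ : MultiIndex k => L2 E) where
  carrier := {w | ∀ β : MultiIndex k,
    IsWeakDeriv β.1.1 β.1.2 (w (MultiIndex.mk 0 0 (Nat.zero_le k))) (w β)}
  zero_mem' := fun _ => IsWeakDeriv.zero _ _
  add_mem' := fun hv hw β => (hv β).add (hw β)
  smul_mem' := fun a _ hv β => (hv β).const_smul a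

/-- The Sobolev space `W^{k,2}(𝕋²; E)` as a normed space. -/
abbrev W (k : ℕ) (E : Type) [NormedAddCommGroup E] [NormedSpace ℝ E] : Type :=
  sobolevSubmodule k E

/-- The weak derivative `∂^(m,n) v ∈ L²` of `v ∈ W^{k,2}`, for `m + n ≤ k`. -/
def W.D {k : ℕ} {E : Type} [NormedAddCommGroup E] [NormedSpace ℝ E] (m n : ℕ)
    (v : W k E) (h : m + n ≤ k := by omega) : L2 E :=
  (v : PiLp 1 fun _ : MultiIndex k => L2 E) (MultiIndex.mk m n h)

/-- The underlying `L²` function of an element of `W^{k,2}`. -/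
def W.toL2 {k : ℕ} {E : Type} [NormedAddCommGroup E] [NormedSpace ℝ E]
    (v : W k E) : L2 E :=
  W.D 0 0 v (Nat.zero_le k)

/-- `g = div F` in the weak sense. -/
def IsWeakDiv (F : Torus → Plane) (g : L2 ℝ) : Prop :=
  ∀ φ : Torus → ℝ, IsTest φ →
    ∫ x, g x * φ x ∂torusMeasure =
      -∫ x, (F x 0 * partialDeriv 0 φ x + F x 1 * partialDeriv 1 φ x) ∂torusMeasure

/-- Weakly divergence-free vector fields of class `W^{3,2}`. -/
def IsDivFree (v : W 3 Plane) : Prop := IsWeakDiv v.toL2 0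

/-- `u = ∇^⊥ ψ = (-∂_y ψ, ∂_x ψ)` where `(Δ - 1) ψ = ω - f`. -/
def IsVelocity (f ω : W 2 ℝ) (u : W 3 Plane) : Prop :=
  ∃ ψ : W 4 ℝ,
    ψ.D 2 0 + ψ.D 0 2 - ψ.toL2 = ω.toL2 - f.toL2 ∧
    ∀ᵐ x ∂torusMeasure, u.toL2 x 0 = -((ψ.D 0 1) x) ∧ u.toL2 x 1 = (ψ.D 1 0) x

/-- The norm of `𝓜 = W^{3,2} × W^{2,2}`. -/
def normM (b : W 3 ℝ) (ω : W 2 ℝ) : ℝ := ‖b‖ + ‖ω‖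

/-- The TQG system in integrated form on `[0, T]`, as an identity in `L²(𝕋²)` for every `t`:
`b(t) = b₀ - ∫₀ᵗ div(b u) dτ` and `ω(t) = ω₀ - ∫₀ᵗ [div((ω - b) u) + div(b u_h)] dτ`,
with `u` the velocity determined by `ω` and `f`. -/
def SolvesTQG (uh : W 3 Plane) (f : W 2 ℝ) (b₀ : W 3 ℝ) (ω₀ : W 2 ℝ)
    (b : ℝ → W 3 ℝ) (ω : ℝ → W 2 ℝ) (T : ℝ) : Prop :=
  ∃ (u : ℝ → W 3 Plane) (divBU divWU divBH : ℝ → L2 ℝ),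
    (∀ t ∈ Icc 0 T, IsVelocity f (ω t) (u t)) ∧
    (∀ t ∈ Icc 0 T, IsWeakDiv (fun x => (b t).toL2 x • (u t).toL2 x) (divBU t)) ∧
    (∀ t ∈ Icc 0 T,
      IsWeakDiv (fun x => ((ω t).toL2 x - (b t).toL2 x) • (u t).toL2 x) (divWU t)) ∧
    (∀ t ∈ Icc 0 T, IsWeakDiv (fun x => (b t).toL2 x • uh.toL2 x) (divBH t)) ∧
    IntervalIntegrable divBU volume 0 T ∧
    IntervalIntegrable divWU volume 0 T ∧
    IntervalIntegrable divBH volume 0 T ∧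
    (∀ t ∈ Icc 0 T, (b t).toL2 = b₀.toL2 - ∫ τ in (0 : ℝ)..t, divBU τ) ∧
    (∀ t ∈ Icc 0 T, (ω t).toL2 = ω₀.toL2 - ∫ τ in (0 : ℝ)..t, (divWU τ + divBH τ))

/-- `(b, ω, T)` is a local strong solution of the TQG system. -/
structure IsLocalStrongSolution (uh : W 3 Plane) (f : W 2 ℝ) (b₀ : W 3 ℝ)
    (ω₀ : W 2 ℝ) (b : ℝ → W 3 ℝ) (ω : ℝ → W 2 ℝ) (T : ℝ) : Prop where
  pos : 0 < T
  continuous_b : ContinuousOn b (Icc 0 T)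
  continuous_ω : ContinuousOn ω (Icc 0 T)
  solves : SolvesTQG uh f b₀ ω₀ b ω T

/-- `(b, ω, T)` is a weakly continuous solution: `b ∈ C_w([0,T]; W^{3,2})`,
`ω ∈ C_w([0,T]; W^{2,2})` and the TQG system holds. -/
structure IsWeaklyContinuousSolution (uh : W 3 Plane) (f : W 2 ℝ) (b₀ : W 3 ℝ)
    (ω₀ : W 2 ℝ) (b : ℝ → W 3 ℝ) (ω : ℝ → W 2 ℝ) (T : ℝ) : Prop where
  pos : 0 < T
  weaklyContinuous_b : ContinuousOn (fun t => toWeakSpace ℝ (W 3 ℝ) (b t)) (Icc 0 T)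
  weaklyContinuous_ω : ContinuousOn (fun t => toWeakSpace ℝ (W 2 ℝ) (ω t)) (Icc 0 T)
  solves : SolvesTQG uh f b₀ ω₀ b ω T

/-- The a priori bound on `(0, T)`, with constant `c`. -/
def AprioriBound (c : ℝ) (b₀ : W 3 ℝ) (ω₀ : W 2 ℝ)
    (b : ℝ → W 3 ℝ) (ω : ℝ → W 2 ℝ) (T : ℝ) : Prop :=
  ∀ t ∈ Ioo 0 T, normM (b t) (ω t) ^ 2 ≤
    (normM b₀ ω₀ ^ 2 + 2 * c * (1 + normM b₀ ω₀ ^ 2) * t) /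
      (1 - 2 * c * (1 + normM b₀ ω₀ ^ 2) * t)

end TQG

end

/-! Everything is carried to Fourier coefficients on ℤ². By `isWeakDeriv_iff`, `isVelocity_iff` and
`isWeakDiv_smul_iff` the system becomes a family of scalar ODEs for the modes (`ModeSol`): the
velocity is an explicit multiplier gaining one derivative, and transport is a convolution whose
kernel, for a real divergence-free field, is skew-Hermitian. Sobolev bounds are stated through
finite sums (`SobLe`), so that they survive modewise limits.

A priori bound. For each derivative ∂^β, skew symmetry leaves only a commutator in the energy
identity of a transport term. The symbol estimate `abs_mon_sub_le` and the embedding of H² into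
functions with summable coefficients (dimension two) bound the growth rate of ‖∂^β‖ by K(1 + N²), N
being the 𝓜-norm. The coupling loses no derivative: ω in H² gives u in H³, and u · ∇b, u_h · ∇b are
in H² because b is in H³. Summing over β and using 2N ≤ 1 + N², the quantity 1/(1 + N²) decreases at
most linearly, at rate `riccati`. The bound (*) is this inequality solved for N², with 2c at least
that rate.

Existence and uniqueness. Truncation to |k|_∞ ≤ n keeps the cancellations, so the Galerkin solutions
obey the same bounds. Solutions are compared in a low norm, b in L² and ω in H⁻¹. There, a bounded
solution on more modes (possibly all of them) and the Galerkin solution with the same low modes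
initially differ by O(1/n) (`ModeSol.diff_le`). Hence the Galerkin solutions converge mode by mode,
the limit solves the system, and every bounded solution with these data equals it
(`exists_modeSol`).

Strong continuity. The limit inherits the growth bound ‖∂^β(t)‖ ≤ ‖∂^β(0)‖ + Ct. By uniqueness any
bounded solution may be viewed as restarted at any time, which gives the bound forwards; reversing
time and changing the signs of b, ω, u_h and f preserves the system, which gives it backwards. So
every derivative norm is locally Lipschitz in time, and convergence of norms together with
convergence of modes is strong convergence. This serves both parts: the solution of part 2 is
bounded by (*) and by its two endpoint values. -/

noncomputable section

namespace TQG

/-! ### Frequencies and weights -/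

/-- The frequency lattice `ℤ²`. -/
abbrev Freq : Type := Fin 2 → ℤ

/-- The wave vector `2πk`. -/
def lam (k : Freq) (j : Fin 2) : ℝ := 2 * Real.pi * k j

/-- The weight `⟨k⟩ = (1 + |2πk|²)^{1/2}`. -/
def jb (k : Freq) : ℝ := √(1 + lam k 0 ^ 2 + lam k 1 ^ 2)

theorem lam_neg (k : Freq) (j : Fin 2) : lam (-k) j = -lam k j := by
  simp [lam]

theorem lam_sub (k l : Freq) (j : Fin 2) : lam (k - l) j = lam k j - lam l j := by
  simp [lam, mul_sub]

theorem lam_add (k l : Freq) (j : Fin 2) : lam (k + l) j = lam k j + lam l j := by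
  simp [lam, mul_add]

theorem jb_sq (k : Freq) : jb k ^ 2 = 1 + lam k 0 ^ 2 + lam k 1 ^ 2 :=
  Real.sq_sqrt (by positivity)

theorem one_le_jb (k : Freq) : 1 ≤ jb k := by
  rw [jb, Real.one_le_sqrt]
  nlinarith [sq_nonneg (lam k 0), sq_nonneg (lam k 1)]

theorem jb_pos (k : Freq) : 0 < jb k := zero_lt_one.trans_le (one_le_jb k)

theorem jb_nonneg (k : Freq) : 0 ≤ jb k := (jb_pos k).le

theorem jb_neg (k : Freq) : jb (-k) = jb k := by
  simp [jb, lam_neg]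

theorem abs_lam_le (k : Freq) (j : Fin 2) : |lam k j| ≤ jb k := by
  refine abs_le_of_sq_le_sq ?_ (jb_nonneg k)
  rw [jb_sq]
  fin_cases j
  · simpa using by nlinarith [sq_nonneg (lam k 1)]
  · simpa using by nlinarith [sq_nonneg (lam k 0)]

theorem jb_add_le (k l : Freq) : jb (k + l) ≤ jb k + jb l := by
  refine abs_le_of_sq_le_sq' ?_ (add_nonneg (jb_nonneg k) (jb_nonneg l)) |>.2
  have h : lam k 0 * lam l 0 + lam k 1 * lam l 1 ≤ jb k * jb l := by
    refine abs_le_of_sq_le_sq' ?_ (mul_nonneg (jb_nonneg k) (jb_nonneg l)) |>.2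
    rw [mul_pow, jb_sq, jb_sq]
    nlinarith [sq_nonneg (lam k 0 * lam l 1 - lam k 1 * lam l 0), sq_nonneg (lam k 0),
      sq_nonneg (lam k 1), sq_nonneg (lam l 0), sq_nonneg (lam l 1)]
  rw [add_sq, jb_sq, jb_sq, jb_sq, lam_add, lam_add]
  nlinarith

theorem jb_le_sub_add (k l : Freq) : jb k ≤ jb (k - l) + jb l := by
  simpa using jb_add_le (k - l) l

/-- Both brackets are at least one, so their sum is at most twice their product. This distributes a
weight at the output frequency over the two factors of a convolution. -/
theorem jb_le_two_mul (k l : Freq) : jb k ≤ 2 * (jb (k - l) * jb l) := by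
  nlinarith [jb_le_sub_add k l, one_le_jb (k - l), one_le_jb l]

/-- With X, Y the squared components, (1 + X + Y)² ≥ (1 + X)(1 + Y), so the double series is
dominated by a product of two one-dimensional ones. -/
theorem summable_jb : Summable fun k : Freq => (jb k ^ 4)⁻¹ := by
  have h1 : Summable fun n : ℤ => (1 + (2 * Real.pi * (n : ℝ)) ^ 2)⁻¹ := by
    have h := (Real.summable_one_div_int_pow (p := 2)).2 (by norm_num)
    -- The comparison with 1/n² must omit n = 0, where the inverse is 0 by convention while the term
    -- is 1.
    refine Summable.of_norm_bounded_eventually h ?_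
    refine (Filter.mem_of_superset (Set.Finite.compl_mem_cofinite (Set.finite_singleton (0 : ℤ))) ?_)
    intro n hn
    have hn0 : (n : ℝ) ≠ 0 := by exact_mod_cast hn
    have hn2 : 0 < (n : ℝ) ^ 2 := by positivity
    have : 1 + (2 * Real.pi * (n : ℝ)) ^ 2 ≥ (n : ℝ) ^ 2 := by
      have : 1 ≤ 2 * Real.pi := by nlinarith [Real.pi_gt_three]
      nlinarith [mul_le_mul this this (by norm_num) (by linarith)]
    simp only [Set.mem_ofPred_eq, norm_inv, Real.norm_eq_abs, one_div]
    rw [abs_of_nonneg (by positivity)]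
    exact inv_anti₀ hn2 this
  have h2 : Summable fun p : ℤ × ℤ => (1 + (2 * Real.pi * (p.1 : ℝ)) ^ 2)⁻¹ *
      (1 + (2 * Real.pi * (p.2 : ℝ)) ^ 2)⁻¹ :=
    h1.mul_of_nonneg h1 (fun _ => by positivity) (fun _ => by positivity)
  have h3 := (Equiv.summable_iff (finTwoArrowEquiv ℤ)).2 h2
  refine Summable.of_nonneg_of_le (fun k => by have := jb_pos k; positivity) (fun k => ?_) h3
  change (jb k ^ 4)⁻¹ ≤ (1 + (2 * Real.pi * (k 0 : ℝ)) ^ 2)⁻¹ * (1 + (2 * Real.pi * (k 1 : ℝ)) ^ 2)⁻¹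
  rw [← mul_inv]
  refine inv_anti₀ (by positivity) ?_
  have : jb k ^ 4 = (jb k ^ 2) ^ 2 := by ring
  rw [this, jb_sq]
  simp only [lam]
  nlinarith [sq_nonneg (2 * Real.pi * (k 0 : ℝ)), sq_nonneg (2 * Real.pi * (k 1 : ℝ)),
    mul_nonneg (sq_nonneg (2 * Real.pi * (k 0 : ℝ))) (sq_nonneg (2 * Real.pi * (k 1 : ℝ)))]

/-- The embedding constant of `H² ⊂ ℓ¹`. -/
def embConst : ℝ := √(∑' k : Freq, (jb k ^ 4)⁻¹)

theorem embConst_nonneg : 0 ≤ embConst := Real.sqrt_nonneg _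

theorem sum_jb_le (F : Finset Freq) : ∑ k ∈ F, (jb k ^ 4)⁻¹ ≤ embConst ^ 2 := by
  have hp : ∀ k, 0 ≤ (jb k ^ 4)⁻¹ := fun k => by have := jb_pos k; positivity
  rw [embConst, Real.sq_sqrt (tsum_nonneg hp)]
  exact summable_jb.sum_le_tsum F (fun k _ => hp k)

/-! ### Weighted square-summability bounds -/

section SobLe

variable {E : Type*} [NormedAddCommGroup E]

/-- `(∑ₖ ⟨k⟩^{2s} ‖x k‖²)^{1/2} ≤ R`. -/
def SobLe (s : ℕ) (x : Freq → E) (R : ℝ) : Prop :=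
  0 ≤ R ∧ ∀ F : Finset Freq, ∑ k ∈ F, (jb k ^ s * ‖x k‖) ^ 2 ≤ R ^ 2

theorem SobLe.mono {s : ℕ} {x : Freq → E} {R R' : ℝ} (h : SobLe s x R) (hR : R ≤ R') :
    SobLe s x R' :=
  ⟨h.1.trans hR, fun F => (h.2 F).trans (pow_le_pow_left₀ h.1 hR 2)⟩

theorem SobLe.of_norm_le {E' : Type*} [NormedAddCommGroup E'] {s s' : ℕ} {x : Freq → E}
    {y : Freq → E'} {R : ℝ} (h : SobLe s x R) (hy : ∀ k, jb k ^ s' * ‖y k‖ ≤ jb k ^ s * ‖x k‖) :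
    SobLe s' y R :=
  ⟨h.1, fun F => (Finset.sum_le_sum fun k _ => pow_le_pow_left₀
    (mul_nonneg (pow_nonneg (jb_nonneg k) _) (norm_nonneg _)) (hy k) 2).trans (h.2 F)⟩

theorem SobLe.of_le {s s' : ℕ} {x : Freq → E} {R : ℝ} (h : SobLe s x R) (hs : s' ≤ s) :
    SobLe s' x R :=
  h.of_norm_le fun k => mul_le_mul_of_nonneg_right (pow_le_pow_right₀ (one_le_jb k) hs)
    (norm_nonneg _)

theorem SobLe.neg {s : ℕ} {x : Freq → E} {R : ℝ} (h : SobLe s x R) : SobLe s (-x) R :=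
  h.of_norm_le fun k => by simp

theorem sqrt_sum_add_sq_le {ι : Type*} (F : Finset ι) (x y : ι → ℝ) :
    √(∑ k ∈ F, (x k + y k) ^ 2) ≤ √(∑ k ∈ F, x k ^ 2) + √(∑ k ∈ F, y k ^ 2) := by
  have hx : 0 ≤ ∑ k ∈ F, x k ^ 2 := Finset.sum_nonneg fun _ _ => sq_nonneg _
  have hy : 0 ≤ ∑ k ∈ F, y k ^ 2 := Finset.sum_nonneg fun _ _ => sq_nonneg _
  rw [Real.sqrt_le_left (by positivity), add_sq, Real.sq_sqrt hx, Real.sq_sqrt hy]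
  have h : ∑ k ∈ F, x k * y k ≤ √(∑ k ∈ F, x k ^ 2) * √(∑ k ∈ F, y k ^ 2) :=
    Real.sum_mul_le_sqrt_mul_sqrt F x y
  have : ∑ k ∈ F, (x k + y k) ^ 2 =
      ∑ k ∈ F, x k ^ 2 + 2 * ∑ k ∈ F, x k * y k + ∑ k ∈ F, y k ^ 2 := by
    rw [Finset.mul_sum, ← Finset.sum_add_distrib, ← Finset.sum_add_distrib]
    exact Finset.sum_congr rfl fun k _ => by ring
  rw [this]
  linarith

theorem SobLe.sqrt_le {s : ℕ} {x : Freq → E} {R : ℝ} (h : SobLe s x R) (F : Finset Freq) :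
    √(∑ k ∈ F, (jb k ^ s * ‖x k‖) ^ 2) ≤ R :=
  (Real.sqrt_le_left h.1).2 (h.2 F)

theorem SobLe.add {s : ℕ} {x y : Freq → E} {R R' : ℝ} (hx : SobLe s x R) (hy : SobLe s y R') :
    SobLe s (x + y) (R + R') := by
  refine ⟨add_nonneg hx.1 hy.1, fun F => ?_⟩
  rw [← Real.sqrt_le_left (add_nonneg hx.1 hy.1)]
  refine le_trans (Real.sqrt_le_sqrt (Finset.sum_le_sum fun k _ => ?_))
    ((sqrt_sum_add_sq_le F _ _).trans (add_le_add (hx.sqrt_le F) (hy.sqrt_le F)))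
  refine pow_le_pow_left₀ (mul_nonneg (pow_nonneg (jb_nonneg k) _) (norm_nonneg _)) ?_ 2
  rw [← mul_add]
  exact mul_le_mul_of_nonneg_left (norm_add_le _ _) (pow_nonneg (jb_nonneg k) _)

theorem SobLe.sub {s : ℕ} {x y : Freq → E} {R R' : ℝ} (hx : SobLe s x R) (hy : SobLe s y R') :
    SobLe s (x - y) (R + R') := by
  rw [sub_eq_add_neg]
  exact hx.add hy.neg

theorem SobLe.apply_le {s : ℕ} {x : Freq → E} {R : ℝ} (h : SobLe s x R) (k : Freq) :
    jb k ^ s * ‖x k‖ ≤ R := by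
  have := h.2 {k}
  rw [Finset.sum_singleton] at this
  exact (abs_le_of_sq_le_sq' this h.1).2

theorem SobLe.norm_apply_le {s : ℕ} {x : Freq → E} {R : ℝ} (h : SobLe s x R) (k : Freq) :
    ‖x k‖ ≤ R := by
  simpa using (h.of_le (Nat.zero_le s)).apply_le k

/-- `H^{s+2} ⊂ ℓ¹` with weight `⟨k⟩^s`. -/
theorem SobLe.sum_le {s : ℕ} {x : Freq → E} {R : ℝ} (h : SobLe (s + 2) x R) (F : Finset Freq) :
    ∑ k ∈ F, jb k ^ s * ‖x k‖ ≤ embConst * R := by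
  -- Two powers of the bracket are borrowed so that Cauchy–Schwarz meets the convergent series
  -- behind `embConst`.
  have h1 : ∑ k ∈ F, jb k ^ s * ‖x k‖ = ∑ k ∈ F, (jb k ^ 2)⁻¹ * (jb k ^ (s + 2) * ‖x k‖) := by
    refine Finset.sum_congr rfl fun k _ => ?_
    have := (jb_pos k).ne'
    field_simp
    ring
  rw [h1]
  refine (Real.sum_mul_le_sqrt_mul_sqrt F _ _).trans
    (mul_le_mul ?_ (h.sqrt_le F) (Real.sqrt_nonneg _) embConst_nonneg)
  rw [Real.sqrt_le_left embConst_nonneg]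
  refine le_trans (le_of_eq (Finset.sum_congr rfl fun k _ => ?_)) (sum_jb_le F)
  rw [inv_pow, ← pow_mul]

/-- Pointwise limits preserve the bounds. -/
theorem SobLe.of_tendsto {ι : Type*} {l : Filter ι} [l.NeBot] {s : ℕ} {x : ι → Freq → E}
    {y : Freq → E} {R : ℝ} (hx : ∀ᶠ i in l, SobLe s (x i) R)
    (hy : ∀ k, Filter.Tendsto (fun i => x i k) l (nhds (y k))) : SobLe s y R := by
  refine ⟨hx.exists.choose_spec.1, fun F => ?_⟩
  refine le_of_tendsto (tendsto_finsetSum F fun k _ =>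
    (((hy k).norm).const_mul (jb k ^ s)).pow 2) (hx.mono fun i hi => hi.2 F)

/-! ### Frequency boxes and decay of tails -/

/-- The box of frequencies `|k|_∞ ≤ n`. -/
def box (n : ℕ) : Finset Freq := Fintype.piFinset fun _ => Finset.Icc (-(n : ℤ)) n

theorem mem_box {n : ℕ} {k : Freq} : k ∈ box n ↔ ∀ j, |k j| ≤ n := by
  simp [box, abs_le]

theorem neg_mem_box {n : ℕ} {k : Freq} : -k ∈ box n ↔ k ∈ box n := by
  simp [mem_box]

theorem box_mono {m n : ℕ} (h : m ≤ n) : box m ⊆ box n := fun k hk => by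
  rw [mem_box] at *
  exact fun j => (hk j).trans (by exact_mod_cast h)

theorem eventually_mem_box (k : Freq) : ∀ᶠ n in Filter.atTop, k ∈ box n := by
  filter_upwards [Filter.eventually_ge_atTop (|k 0| + |k 1|).toNat] with n hn
  rw [mem_box]
  have : |k 0| + |k 1| ≤ n := Int.toNat_le.1 hn
  intro j
  fin_cases j
  · simpa using by linarith [abs_nonneg (k 1)]
  · simpa using by linarith [abs_nonneg (k 0)]

theorem le_jb_of_notMem_box {n : ℕ} {k : Freq} (hk : k ∉ box n) : (n : ℝ) ≤ jb k := by
  rw [mem_box] at hk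
  push Not at hk
  obtain ⟨j, hj⟩ := hk
  refine le_trans ?_ (abs_lam_le k j)
  have h1 : (n : ℝ) ≤ |(k j : ℝ)| := by exact_mod_cast hj.le
  rw [lam, abs_mul, abs_of_pos (by positivity)]
  nlinarith [Real.pi_gt_three, abs_nonneg (k j : ℝ)]

/-- High-frequency tails gain a power of the frequency. -/
theorem SobLe.tail {s n : ℕ} {x : Freq → E} {R : ℝ} (h : SobLe (s + 1) x R) (hn : 0 < n)
    (hx : ∀ k ∈ box n, x k = 0) : SobLe s x (R / n) := by
  have hn' : (0 : ℝ) < n := by exact_mod_cast hn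
  refine ⟨div_nonneg h.1 hn'.le, fun F => ?_⟩
  rw [div_pow, le_div_iff₀ (by positivity), Finset.sum_mul]
  refine le_trans (Finset.sum_le_sum fun k _ => ?_) (h.2 F)
  by_cases hk : k ∈ box n
  · simp [hx k hk]
  · rw [← mul_pow]
    have h0 := jb_nonneg k
    refine pow_le_pow_left₀ (by positivity) ?_ 2
    rw [pow_succ]
    nlinarith [mul_le_mul_of_nonneg_left (le_jb_of_notMem_box hk)
      (mul_nonneg (pow_nonneg h0 s) (norm_nonneg (x k)))]

end SobLe

/-! ### Finite convolution inequalities -/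

/-- Young's inequality with an `ℓ¹` kernel. -/
theorem young_left {a c h : Freq → ℝ} {A L : Finset Freq} {α γ H : ℝ} (hα : 0 ≤ α) (hγ : 0 ≤ γ)
    (hh : ∀ k, 0 ≤ h k) (hH : ∀ F : Finset Freq, ∑ k ∈ F, h k ≤ H)
    (ha : ∑ k ∈ A, a k ^ 2 ≤ α ^ 2) (hc : ∑ l ∈ L, c l ^ 2 ≤ γ ^ 2) :
    ∑ k ∈ A, ∑ l ∈ L, a k * (h (k - l) * c l) ≤ α * (H * γ) := by
  have hH0 : 0 ≤ H := by simpa using hH ∅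
  -- Schur test: the kernel is split as √h · √h, one root going with each sequence, and its row and
  -- column sums are both at most H.
  have h1 : ∑ k ∈ A, ∑ l ∈ L, a k * (h (k - l) * c l) =
      ∑ p ∈ A ×ˢ L, (a p.1 * √(h (p.1 - p.2))) * (√(h (p.1 - p.2)) * c p.2) := by
    rw [Finset.sum_product]
    refine Finset.sum_congr rfl fun k _ => Finset.sum_congr rfl fun l _ => ?_
    have := Real.mul_self_sqrt (hh (k - l))
    linear_combination (-(a k * c l)) * this
  rw [h1]
  refine (Real.sum_mul_le_sqrt_mul_sqrt _ _ _).trans ?_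
  have h2 : ∑ p ∈ A ×ˢ L, (a p.1 * √(h (p.1 - p.2))) ^ 2 ≤ α ^ 2 * H := by
    rw [Finset.sum_product]
    calc ∑ k ∈ A, ∑ l ∈ L, (a k * √(h (k - l))) ^ 2
        = ∑ k ∈ A, a k ^ 2 * ∑ l ∈ L, h (k - l) := by
          refine Finset.sum_congr rfl fun k _ => ?_
          rw [Finset.mul_sum]
          exact Finset.sum_congr rfl fun l _ => by rw [mul_pow, Real.sq_sqrt (hh _)]
      _ ≤ ∑ k ∈ A, a k ^ 2 * H := by
          refine Finset.sum_le_sum fun k _ => mul_le_mul_of_nonneg_left ?_ (sq_nonneg _)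
          have := hH (L.map (Equiv.subLeft k).toEmbedding)
          simpa using this
      _ ≤ α ^ 2 * H := by
          rw [← Finset.sum_mul]
          exact mul_le_mul_of_nonneg_right ha hH0
  have h3 : ∑ p ∈ A ×ˢ L, (√(h (p.1 - p.2)) * c p.2) ^ 2 ≤ H * γ ^ 2 := by
    rw [Finset.sum_product_right]
    calc ∑ l ∈ L, ∑ k ∈ A, (√(h (k - l)) * c l) ^ 2
        = ∑ l ∈ L, (∑ k ∈ A, h (k - l)) * c l ^ 2 := by
          refine Finset.sum_congr rfl fun k _ => ?_
          rw [Finset.sum_mul]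
          exact Finset.sum_congr rfl fun l _ => by rw [mul_pow, Real.sq_sqrt (hh _)]
      _ ≤ ∑ l ∈ L, H * c l ^ 2 := by
          refine Finset.sum_le_sum fun l _ => mul_le_mul_of_nonneg_right ?_ (sq_nonneg _)
          have := hH (A.map (Equiv.subRight l).toEmbedding)
          simpa using this
      _ ≤ H * γ ^ 2 := by
          rw [← Finset.mul_sum]
          exact mul_le_mul_of_nonneg_left hc hH0
  refine (mul_le_mul (Real.sqrt_le_sqrt h2) (Real.sqrt_le_sqrt h3) (Real.sqrt_nonneg _)
    (Real.sqrt_nonneg _)).trans (le_of_eq ?_)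
  rw [← Real.sqrt_mul (by positivity)]
  rw [show α ^ 2 * H * (H * γ ^ 2) = (α * (H * γ)) ^ 2 by ring]
  exact Real.sqrt_sq (by positivity)

/-- Young's inequality with an `ℓ²` kernel. -/
theorem young_right {a c h : Freq → ℝ} {A L : Finset Freq} {α η C : ℝ} (hα : 0 ≤ α) (hη : 0 ≤ η)
    (hc : ∀ k, 0 ≤ c k) (hC : ∑ l ∈ L, c l ≤ C)
    (ha : ∑ k ∈ A, a k ^ 2 ≤ α ^ 2) (hh : ∀ F : Finset Freq, ∑ k ∈ F, h k ^ 2 ≤ η ^ 2) :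
    ∑ k ∈ A, ∑ l ∈ L, a k * (h (k - l) * c l) ≤ α * (η * C) := by
  rw [Finset.sum_comm]
  -- For fixed l this is Cauchy–Schwarz against a translate of h, uniformly in l; the ℓ¹ factor c is
  -- then summed.
  have h1 : ∀ l, ∑ k ∈ A, a k * h (k - l) ≤ α * η := by
    intro l
    refine (Real.sum_mul_le_sqrt_mul_sqrt _ _ _).trans
      (mul_le_mul ((Real.sqrt_le_left hα).2 ha) ((Real.sqrt_le_left hη).2 ?_)
        (Real.sqrt_nonneg _) hα)
    have := hh (A.map (Equiv.subRight l).toEmbedding)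
    simpa using this
  calc ∑ l ∈ L, ∑ k ∈ A, a k * (h (k - l) * c l)
      = ∑ l ∈ L, (∑ k ∈ A, a k * h (k - l)) * c l := by
        refine Finset.sum_congr rfl fun l _ => ?_
        rw [Finset.sum_mul]
        exact Finset.sum_congr rfl fun k _ => by ring
    _ ≤ ∑ l ∈ L, (α * η) * c l :=
        Finset.sum_le_sum fun l _ => mul_le_mul_of_nonneg_right (h1 l) (hc l)
    _ ≤ α * (η * C) := by
        rw [← Finset.mul_sum, ← mul_assoc]
        exact mul_le_mul_of_nonneg_left hC (by positivity)

/-! ### The advection operator on Fourier coefficients -/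

/-- The bilinear pairing of a complex vector with a real vector. -/
def dot (w : Fin 2 → ℂ) (ξ : Fin 2 → ℝ) : ℂ := w 0 * ξ 0 + w 1 * ξ 1

/-- The kernel `i v̂(k - l) · 2πl` of the operator `v · ∇`. -/
def ker (v : Freq → Fin 2 → ℂ) (k l : Freq) : ℂ := Complex.I * dot (v (k - l)) (lam l)

/-- The Fourier coefficients of `v · ∇g`. -/
def adv (v : Freq → Fin 2 → ℂ) (g : Freq → ℂ) (k : Freq) : ℂ := ∑' l, ker v k l * g l

/-- The contribution to `v · ∇g` of the modes of `g` in `L`. -/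
def advF (L : Finset Freq) (v : Freq → Fin 2 → ℂ) (g : Freq → ℂ) (k : Freq) : ℂ :=
  ∑ l ∈ L, ker v k l * g l

/-- The coefficients of a divergence-free field. -/
def DivFree (v : Freq → Fin 2 → ℂ) : Prop := ∀ k, dot (v k) (lam k) = 0

/-- The coefficients of a real function. -/
def Herm (g : Freq → ℂ) : Prop := ∀ k, g (-k) = (starRingEnd ℂ) (g k)

/-- The coefficients of a real vector field. -/
def HermV (v : Freq → Fin 2 → ℂ) : Prop := ∀ k j, v (-k) j = (starRingEnd ℂ) (v k j)

/-- The restriction of a family of coefficients to a finite set of modes. -/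
def trunc (S : Finset Freq) (g : Freq → ℂ) (k : Freq) : ℂ := if k ∈ S then g k else 0

theorem norm_dot_le (w : Fin 2 → ℂ) (l : Freq) : ‖dot w (lam l)‖ ≤ 2 * (‖w‖ * jb l) := by
  have h : ∀ j, ‖w j * (lam l j : ℂ)‖ ≤ ‖w‖ * jb l := fun j => by
    rw [norm_mul, Complex.norm_real, Real.norm_eq_abs]
    exact mul_le_mul (norm_le_pi_norm w j) (abs_lam_le l j) (abs_nonneg _) (norm_nonneg _)
  exact (norm_add_le _ _).trans (by linarith [h 0, h 1])

theorem norm_ker_le (v : Freq → Fin 2 → ℂ) (k l : Freq) :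
    ‖ker v k l‖ ≤ 2 * (‖v (k - l)‖ * jb l) := by
  rw [ker, norm_mul, Complex.norm_I, one_mul]
  exact norm_dot_le _ _

/-- Since v̂(k - l) · (k - l) = 0, the derivative may sit at the input or at the output frequency: v
· ∇g = div(v g). -/
theorem DivFree.ker_eq {v : Freq → Fin 2 → ℂ} (hv : DivFree v) (k l : Freq) :
    ker v k l = Complex.I * dot (v (k - l)) (lam k) := by
  have h := hv (k - l)
  simp only [dot, lam_sub, Complex.ofReal_sub] at h
  simp only [ker, dot]
  linear_combination (-Complex.I) * h

theorem DivFree.norm_ker_le {v : Freq → Fin 2 → ℂ} (hv : DivFree v) (k l : Freq) :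
    ‖ker v k l‖ ≤ 2 * (‖v (k - l)‖ * jb k) := by
  rw [hv.ker_eq, norm_mul, Complex.norm_I, one_mul]
  exact norm_dot_le _ _

/-- Transport by a real divergence-free field is skew-adjoint in L². All energy cancellations come
from this. -/
theorem conj_ker {v : Freq → Fin 2 → ℂ} (hv : DivFree v) (hr : HermV v) (k l : Freq) :
    (starRingEnd ℂ) (ker v l k) = -ker v k l := by
  rw [hv.ker_eq k l, ker, dot, dot, show l - k = -(k - l) by abel]
  simp only [map_mul, map_add, Complex.conj_I, Complex.conj_ofReal, hr (k - l), Complex.conj_conj]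
  ring

theorem ker_neg_neg {v : Freq → Fin 2 → ℂ} (hr : HermV v) (k l : Freq) :
    ker v (-k) (-l) = (starRingEnd ℂ) (ker v k l) := by
  rw [ker, ker, dot, dot, show -k - -l = -(k - l) by abel]
  simp only [map_mul, map_add, Complex.conj_I, Complex.conj_ofReal, hr (k - l), lam_neg,
    Complex.ofReal_neg]
  ring

theorem ker_neg_left (v : Freq → Fin 2 → ℂ) (k l : Freq) : ker (-v) k l = -ker v k l := by
  simp only [ker, dot, Pi.neg_apply]; ring

theorem ker_sub_left (v w : Freq → Fin 2 → ℂ) (k l : Freq) :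
    ker (v - w) k l = ker v k l - ker w k l := by
  simp only [ker, dot, Pi.sub_apply]; ring

/-- Cauchy–Schwarz in l. Thus the series defining `adv` converges absolutely as soon as v is in L²
and g in H¹, and the algebra of `adv` becomes legitimate. -/
theorem sum_norm_ker_mul_le {v : Freq → Fin 2 → ℂ} {g : Freq → ℂ} {V G : ℝ} (hv : SobLe 0 v V)
    (hg : SobLe 1 g G) (k : Freq) (F : Finset Freq) :
    ∑ l ∈ F, ‖ker v k l * g l‖ ≤ 2 * (V * G) := by
  calc ∑ l ∈ F, ‖ker v k l * g l‖ ≤ ∑ l ∈ F, 2 * (‖v (k - l)‖ * (jb l ^ 1 * ‖g l‖)) := by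
        refine Finset.sum_le_sum fun l _ => ?_
        rw [norm_mul, pow_one]
        exact (mul_le_mul_of_nonneg_right (norm_ker_le v k l) (norm_nonneg _)).trans
          (le_of_eq (by ring))
    _ ≤ 2 * (V * G) := by
        rw [← Finset.mul_sum]
        refine mul_le_mul_of_nonneg_left ?_ (by norm_num)
        refine (Real.sum_mul_le_sqrt_mul_sqrt _ _ _).trans
          (mul_le_mul ?_ (hg.sqrt_le F) (Real.sqrt_nonneg _) hv.1)
        have := hv.sqrt_le (F.map (Equiv.subLeft k).toEmbedding)
        simpa using this

theorem summable_ker_mul {v : Freq → Fin 2 → ℂ} {g : Freq → ℂ} {V G : ℝ} (hv : SobLe 0 v V)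
    (hg : SobLe 1 g G) (k : Freq) : Summable fun l => ker v k l * g l :=
  Summable.of_norm (summable_of_sum_le (fun _ => norm_nonneg _) (sum_norm_ker_mul_le hv hg k))

theorem norm_adv_le {v : Freq → Fin 2 → ℂ} {g : Freq → ℂ} {V G : ℝ} (hv : SobLe 0 v V)
    (hg : SobLe 1 g G) (k : Freq) : ‖adv v g k‖ ≤ 2 * (V * G) := by
  have h : Summable fun l => ‖ker v k l * g l‖ :=
    summable_of_sum_le (fun _ => norm_nonneg _) (sum_norm_ker_mul_le hv hg k)
  exact (norm_tsum_le_tsum_norm h).trans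
    (h.tsum_le_of_sum_le (sum_norm_ker_mul_le hv hg k))

theorem adv_sub_left {v w : Freq → Fin 2 → ℂ} {g : Freq → ℂ} {V V' G : ℝ} (hv : SobLe 0 v V)
    (hw : SobLe 0 w V') (hg : SobLe 1 g G) (k : Freq) :
    adv (v - w) g k = adv v g k - adv w g k := by
  rw [adv, adv, adv, ← (summable_ker_mul hv hg k).tsum_sub (summable_ker_mul hw hg k)]
  exact tsum_congr fun l => by rw [ker_sub_left, sub_mul]

theorem adv_sub_right {v : Freq → Fin 2 → ℂ} {g h : Freq → ℂ} {V G G' : ℝ} (hv : SobLe 0 v V)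
    (hg : SobLe 1 g G) (hh : SobLe 1 h G') (k : Freq) :
    adv v (g - h) k = adv v g k - adv v h k := by
  rw [adv, adv, adv, ← (summable_ker_mul hv hg k).tsum_sub (summable_ker_mul hv hh k)]
  exact tsum_congr fun l => by rw [Pi.sub_apply, mul_sub]

theorem adv_neg_neg (v : Freq → Fin 2 → ℂ) (g : Freq → ℂ) (k : Freq) :
    adv (-v) (-g) k = adv v g k :=
  tsum_congr fun l => by rw [ker_neg_left, Pi.neg_apply, neg_mul_neg]

theorem adv_eq_advF {S : Finset Freq} {v : Freq → Fin 2 → ℂ} {g : Freq → ℂ}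
    (hg : ∀ k ∉ S, g k = 0) (k : Freq) : adv v g k = advF S v g k :=
  tsum_eq_sum fun l hl => by rw [hg l hl, mul_zero]

theorem advF_sub_left (S : Finset Freq) (v w : Freq → Fin 2 → ℂ) (g : Freq → ℂ) (k : Freq) :
    advF S (v - w) g k = advF S v g k - advF S w g k := by
  simp only [advF, ker_sub_left, sub_mul, Finset.sum_sub_distrib]

theorem advF_sub_right (S : Finset Freq) (v : Freq → Fin 2 → ℂ) (g h : Freq → ℂ) (k : Freq) :
    advF S v (g - h) k = advF S v g k - advF S v h k := by
  simp only [advF, Pi.sub_apply, mul_sub, Finset.sum_sub_distrib]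

theorem trunc_of_notMem {S : Finset Freq} (g : Freq → ℂ) {k : Freq} (hk : k ∉ S) :
    trunc S g k = 0 := if_neg hk

theorem trunc_of_mem {S : Finset Freq} (g : Freq → ℂ) {k : Freq} (hk : k ∈ S) :
    trunc S g k = g k := if_pos hk

theorem norm_trunc_le (S : Finset Freq) (g : Freq → ℂ) (k : Freq) : ‖trunc S g k‖ ≤ ‖g k‖ := by
  rw [trunc]; split_ifs <;> simp

theorem norm_sub_trunc_le (S : Finset Freq) (g : Freq → ℂ) (k : Freq) :
    ‖(g - trunc S g) k‖ ≤ ‖g k‖ := by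
  rw [Pi.sub_apply, trunc]; split_ifs <;> simp

theorem SobLe.trunc {s : ℕ} {g : Freq → ℂ} {R : ℝ} (h : SobLe s g R) (S : Finset Freq) :
    SobLe s (trunc S g) R :=
  h.of_norm_le fun k => mul_le_mul_of_nonneg_left (norm_trunc_le S g k)
    (pow_nonneg (jb_nonneg k) _)

theorem SobLe.sub_trunc {s n : ℕ} {g : Freq → ℂ} {R : ℝ} (h : SobLe (s + 1) g R) (hn : 0 < n) :
    SobLe s (g - TQG.trunc (box n) g) (R / n) :=
  SobLe.tail (h.of_norm_le fun k => mul_le_mul_of_nonneg_left (norm_sub_trunc_le (box n) g k)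
    (pow_nonneg (jb_nonneg k) _)) hn fun k hk => by simp [trunc_of_mem g hk]

/-- One spare derivative of g makes the discarded modes of order 1/n, uniformly over bounded sets of
v and g. -/
theorem norm_adv_sub_advF_le {v : Freq → Fin 2 → ℂ} {g : Freq → ℂ} {V G : ℝ} (hv : SobLe 0 v V)
    (hg : SobLe 2 g G) (k : Freq) {n : ℕ} (hn : 0 < n) :
    ‖adv v g k - advF (box n) v g k‖ ≤ 2 * (V * (G / n)) := by
  have h1 : advF (box n) v g k = adv v (trunc (box n) g) k := by
    rw [adv_eq_advF (fun k hk => trunc_of_notMem g hk)]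
    exact Finset.sum_congr rfl fun l hl => by simp only [trunc_of_mem g hl]
  have hg1 := hg.of_le (show 1 ≤ 2 by norm_num)
  rw [h1, ← adv_sub_right hv hg1 (hg1.trunc _)]
  exact norm_adv_le hv (hg.sub_trunc hn) k

/-- Bounded pointwise convergence passes to the nonlinearity. -/
theorem tendsto_adv {ι : Type*} {l : Filter ι} [l.NeBot] {v : ι → Freq → Fin 2 → ℂ}
    {w : Freq → Fin 2 → ℂ} {g : ι → Freq → ℂ} {h : Freq → ℂ} {V G : ℝ}
    (hv : ∀ᶠ i in l, SobLe 0 (v i) V) (hg : ∀ᶠ i in l, SobLe 2 (g i) G)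
    (hvw : ∀ k, Filter.Tendsto (fun i => v i k) l (nhds (w k)))
    (hgh : ∀ k, Filter.Tendsto (fun i => g i k) l (nhds (h k))) (k : Freq) :
    Filter.Tendsto (fun i => adv (v i) (g i) k) l (nhds (adv w h k)) := by
  have hw : SobLe 0 w V := SobLe.of_tendsto hv hvw
  have hh : SobLe 2 h G := SobLe.of_tendsto hg hgh
  rw [Metric.tendsto_nhds]
  intro ε hε
  have hlim : Filter.Tendsto (fun n : ℕ => 2 * (V * (G / n))) Filter.atTop (nhds 0) := by
    simpa using ((tendsto_const_div_atTop_nhds_zero_nat G).const_mul V).const_mul 2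
  -- The cut-off n is chosen before the index i: both tails are below ε/3 uniformly, and what
  -- remains is a finite sum of convergent terms.
  obtain ⟨n, hn, hn0⟩ := ((hlim.eventually (gt_mem_nhds (show 0 < ε / 3 by linarith))).and
    (Filter.eventually_gt_atTop 0)).exists
  have hfin : Filter.Tendsto (fun i => advF (box n) (v i) (g i) k) l
      (nhds (advF (box n) w h k)) := by
    refine tendsto_finsetSum _ fun m _ => Filter.Tendsto.mul ?_ (hgh m)
    have hj : ∀ j, Filter.Tendsto (fun i => v i (k - m) j) l (nhds (w (k - m) j)) :=
      fun j => (tendsto_pi_nhds.1 (hvw (k - m))) j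
    exact (((hj 0).mul_const _).add ((hj 1).mul_const _)).const_mul _
  filter_upwards [hv, hg, Metric.tendsto_nhds.1 hfin (ε / 3) (by linarith)] with i h1 h2 h3
  rw [dist_eq_norm] at h3 ⊢
  have e1 := norm_adv_sub_advF_le h1 h2 k hn0
  have e2 := norm_adv_sub_advF_le hw hh k hn0
  calc ‖adv (v i) (g i) k - adv w h k‖
      = ‖(adv (v i) (g i) k - advF (box n) (v i) (g i) k) +
          (advF (box n) (v i) (g i) k - advF (box n) w h k) -
          (adv w h k - advF (box n) w h k)‖ := by congr 1; ring
    _ ≤ _ := norm_sub_le _ _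
    _ ≤ _ := add_le_add_left (norm_add_le _ _) _
    _ < ε := by linarith

theorem norm_advF_le (L : Finset Freq) (v : Freq → Fin 2 → ℂ) (g : Freq → ℂ) (k : Freq) :
    ‖advF L v g k‖ ≤ ∑ l ∈ L, ‖ker v k l‖ * ‖g l‖ :=
  (norm_sum_le _ _).trans (Finset.sum_le_sum fun _ _ => (norm_mul _ _).le)

/-- A bound of all pairings with square-summable sequences bounds the `ℓ²` norm. -/
theorem sum_sq_le_of_pairing {ι : Type*} {A : Finset ι} {x : ι → ℝ} {M : ℝ} (hM : 0 ≤ M)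
    (h : ∀ α : ℝ, 0 ≤ α → ∑ k ∈ A, x k ^ 2 ≤ α ^ 2 → ∑ k ∈ A, x k * x k ≤ α * M) :
    ∑ k ∈ A, x k ^ 2 ≤ M ^ 2 := by
  have h0 : 0 ≤ ∑ k ∈ A, x k ^ 2 := Finset.sum_nonneg fun _ _ => sq_nonneg _
  have h1 := h (√(∑ k ∈ A, x k ^ 2)) (Real.sqrt_nonneg _) (Real.sq_sqrt h0).ge
  have h2 : ∑ k ∈ A, x k * x k = √(∑ k ∈ A, x k ^ 2) ^ 2 := by
    rw [Real.sq_sqrt h0]; exact Finset.sum_congr rfl fun k _ => by ring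
  rw [h2] at h1
  have h3 : √(∑ k ∈ A, x k ^ 2) ≤ M := by
    rcases (Real.sqrt_nonneg (∑ k ∈ A, x k ^ 2)).eq_or_lt with h | h
    · rw [← h]; exact hM
    · nlinarith
  rwa [Real.sqrt_le_left hM] at h3

/-- The weight ⟨k⟩^s is spread over both factors, after which v is an ℓ¹ kernel by the embedding and
Young's inequality applies; the gradient costs g one more power. -/
theorem SobLe.adv {s : ℕ} {v : Freq → Fin 2 → ℂ} {g : Freq → ℂ} {V G : ℝ}
    (hv : SobLe (s + 2) v V) (hg : SobLe (s + 1) g G) :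
    SobLe s (adv v g) (2 ^ (s + 1) * (embConst * V * G)) := by
  have hM : 0 ≤ 2 ^ (s + 1) * (embConst * V * G) := by
    have := embConst_nonneg; have := hv.1; have := hg.1; positivity
  have hfin : ∀ L A : Finset Freq,
      ∑ k ∈ A, (jb k ^ s * ‖advF L v g k‖) ^ 2 ≤ (2 ^ (s + 1) * (embConst * V * G)) ^ 2 := by
    intro L A
    -- Duality: the sequence to be bounded is paired with itself, one copy being treated as an
    -- arbitrary element of norm α.
    refine sum_sq_le_of_pairing hM fun α hα hA => ?_
    have hx : ∀ k, 0 ≤ jb k ^ s * ‖advF L v g k‖ := fun k =>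
      mul_nonneg (pow_nonneg (jb_nonneg k) _) (norm_nonneg _)
    calc ∑ k ∈ A, jb k ^ s * ‖advF L v g k‖ * (jb k ^ s * ‖advF L v g k‖)
        ≤ ∑ k ∈ A, ∑ l ∈ L, 2 ^ (s + 1) * (jb k ^ s * ‖advF L v g k‖ *
            ((jb (k - l) ^ s * ‖v (k - l)‖) * (jb l ^ (s + 1) * ‖g l‖))) := by
          refine Finset.sum_le_sum fun k _ => ?_
          rw [mul_assoc, ← mul_assoc]
          refine (mul_le_mul_of_nonneg_left (mul_le_mul_of_nonneg_left (norm_advF_le L v g k)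
            (pow_nonneg (jb_nonneg k) s)) (hx k)).trans ?_
          rw [Finset.mul_sum, Finset.mul_sum]
          refine Finset.sum_le_sum fun l _ => ?_
          have h1 : jb k ^ s ≤ 2 ^ s * (jb (k - l) ^ s * jb l ^ s) := by
            rw [← mul_pow, ← mul_pow]
            exact pow_le_pow_left₀ (jb_nonneg k) (jb_le_two_mul k l) s
          have h2 : jb k ^ s * (‖ker v k l‖ * ‖g l‖) ≤
              2 ^ s * (jb (k - l) ^ s * jb l ^ s) * (2 * (‖v (k - l)‖ * jb l) * ‖g l‖) := by
            have := jb_nonneg (k - l); have := jb_nonneg l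
            exact mul_le_mul h1 (mul_le_mul_of_nonneg_right (norm_ker_le v k l) (norm_nonneg _))
              (by positivity) (by positivity)
          refine (mul_le_mul_of_nonneg_left h2 (hx k)).trans (le_of_eq ?_)
          ring
      _ ≤ 2 ^ (s + 1) * (α * (embConst * V * G)) := by
          simp_rw [← Finset.mul_sum]
          refine mul_le_mul_of_nonneg_left ?_ (by positivity)
          simp_rw [Finset.mul_sum]
          exact young_left hα hg.1 (fun k => mul_nonneg (pow_nonneg (jb_nonneg k) _)
            (norm_nonneg _)) hv.sum_le hA (hg.2 L)
      _ = _ := by ring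
  refine ⟨hM, fun A => ?_⟩
  have hlim : ∀ k, Filter.Tendsto (fun L => advF L v g k) Filter.atTop (nhds (TQG.adv v g k)) :=
    fun k => (summable_ker_mul (hv.of_le (Nat.zero_le _)) (hg.of_le (by omega)) k).hasSum
  exact le_of_tendsto (tendsto_finsetSum A fun k _ => (((hlim k).norm).const_mul (jb k ^ s)).pow 2)
    (Filter.Eventually.of_forall fun L => hfin L A)

/-! ### Cancellations and commutators -/

/-- The transport kernel is skew-Hermitian, so only differences of weights contribute. -/
theorem two_mul_re_sum_weight {S : Finset Freq} {v : Freq → Fin 2 → ℂ} (hv : DivFree v)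
    (hr : HermV v) (g : Freq → ℂ) (w : Freq → ℝ) :
    2 * ∑ k ∈ S, w k * ((starRingEnd ℂ) (g k) * advF S v g k).re =
      ∑ k ∈ S, ∑ l ∈ S, (w k - w l) * ((starRingEnd ℂ) (g k) * (ker v k l * g l)).re := by
  have h1 : ∑ k ∈ S, w k * ((starRingEnd ℂ) (g k) * advF S v g k).re =
      ∑ k ∈ S, ∑ l ∈ S, w k * ((starRingEnd ℂ) (g k) * (ker v k l * g l)).re := by
    refine Finset.sum_congr rfl fun k _ => ?_
    rw [advF, Finset.mul_sum, Complex.re_sum, Finset.mul_sum]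
  -- Exchanging k and l and using skew symmetry turns w k into -w l; averaging both expressions
  -- leaves w k - w l.
  have h2 : ∑ k ∈ S, ∑ l ∈ S, w k * ((starRingEnd ℂ) (g k) * (ker v k l * g l)).re =
      ∑ k ∈ S, ∑ l ∈ S, -(w l * ((starRingEnd ℂ) (g k) * (ker v k l * g l)).re) := by
    rw [Finset.sum_comm]
    refine Finset.sum_congr rfl fun k _ => Finset.sum_congr rfl fun l _ => ?_
    have h3 : (starRingEnd ℂ) (g l) * (ker v l k * g k) =
        (starRingEnd ℂ) (-((starRingEnd ℂ) (g k) * (ker v k l * g l))) := by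
      simp only [map_mul, map_neg, Complex.conj_conj]
      rw [← neg_eq_iff_eq_neg.2 (conj_ker hv hr k l), map_neg, Complex.conj_conj]
      ring
    rw [h3, Complex.conj_re, Complex.neg_re]
    ring
  rw [two_mul, h1]
  nth_rewrite 2 [h2]
  rw [← Finset.sum_add_distrib]
  refine Finset.sum_congr rfl fun k _ => ?_
  rw [← Finset.sum_add_distrib]
  exact Finset.sum_congr rfl fun l _ => by ring

theorem re_sum_eq_zero {S : Finset Freq} {v : Freq → Fin 2 → ℂ} (hv : DivFree v)
    (hr : HermV v) (g : Freq → ℂ) :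
    ∑ k ∈ S, ((starRingEnd ℂ) (g k) * advF S v g k).re = 0 := by
  have := two_mul_re_sum_weight (S := S) hv hr g (fun _ => 1)
  simpa using this

theorem abs_jb_sub_le (k l : Freq) : |jb k - jb l| ≤ jb (k - l) := by
  have h1 := jb_le_sub_add k l
  have h2 := jb_le_sub_add l k
  rw [show l - k = -(k - l) by abel, jb_neg] at h2
  exact abs_sub_le_iff.2 ⟨by linarith, by linarith⟩

/-- Transport in negative regularity. -/
theorem abs_re_sum_neg_weight_le {S : Finset Freq} {v : Freq → Fin 2 → ℂ} (hv : DivFree v)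
    (hr : HermV v) {V : ℝ} (hV : SobLe 3 v V) (g : Freq → ℂ) {α : ℝ} (hα : 0 ≤ α)
    (hg : ∑ k ∈ S, ((jb k)⁻¹ * ‖g k‖) ^ 2 ≤ α ^ 2) :
    |∑ k ∈ S, (jb k ^ 2)⁻¹ * ((starRingEnd ℂ) (g k) * advF S v g k).re| ≤
      2 * (embConst * V) * α ^ 2 := by
  have hsym := two_mul_re_sum_weight (S := S) hv hr g (fun k => (jb k ^ 2)⁻¹)
  have hb : |∑ k ∈ S, ∑ l ∈ S, ((jb k ^ 2)⁻¹ - (jb l ^ 2)⁻¹) *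
      ((starRingEnd ℂ) (g k) * (ker v k l * g l)).re| ≤
      ∑ k ∈ S, ∑ l ∈ S, 4 * (((jb k)⁻¹ * ‖g k‖) *
        ((jb (k - l) ^ 1 * ‖v (k - l)‖) * ((jb l)⁻¹ * ‖g l‖))) := by
    refine (Finset.abs_sum_le_sum_abs _ _).trans (Finset.sum_le_sum fun k _ =>
      (Finset.abs_sum_le_sum_abs _ _).trans (Finset.sum_le_sum fun l _ => ?_))
    have hk := jb_pos k
    have hl := jb_pos l
    have hkl := jb_pos (k - l)
    have e1 : |((starRingEnd ℂ) (g k) * (ker v k l * g l)).re| ≤ ‖g k‖ * (‖ker v k l‖ * ‖g l‖) := by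
      refine (Complex.abs_re_le_norm _).trans (le_of_eq ?_)
      rw [norm_mul, norm_mul, RCLike.norm_conj]
    have e2 : |(jb k ^ 2)⁻¹ - (jb l ^ 2)⁻¹| * ‖ker v k l‖ ≤
        4 * ((jb k)⁻¹ * (jb (k - l) * ‖v (k - l)‖) * (jb l)⁻¹) := by
      have e3 : (jb k ^ 2)⁻¹ - (jb l ^ 2)⁻¹ =
          (jb l - jb k) * (jb k + jb l) * ((jb k ^ 2)⁻¹ * (jb l ^ 2)⁻¹) := by
        field_simp; ring
      -- The derivative is placed at l in the term with ⟨k⟩ and at k in the term with ⟨l⟩, so both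
      -- give ⟨k⟩⟨l⟩ without loss.
      have e4 : ‖ker v k l‖ * (jb k + jb l) ≤ 4 * (‖v (k - l)‖ * (jb k * jb l)) := by
        have a1 := mul_le_mul_of_nonneg_right (norm_ker_le v k l) hk.le
        have a2 := mul_le_mul_of_nonneg_right (hv.norm_ker_le k l) hl.le
        nlinarith
      have e5 : |jb l - jb k| ≤ jb (k - l) := by rw [abs_sub_comm]; exact abs_jb_sub_le k l
      rw [e3, abs_mul, abs_mul, abs_of_pos (add_pos hk hl),
        abs_of_pos (show 0 < (jb k ^ 2)⁻¹ * (jb l ^ 2)⁻¹ by positivity)]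
      calc |jb l - jb k| * (jb k + jb l) * ((jb k ^ 2)⁻¹ * (jb l ^ 2)⁻¹) * ‖ker v k l‖
          = |jb l - jb k| * (‖ker v k l‖ * (jb k + jb l)) * ((jb k ^ 2)⁻¹ * (jb l ^ 2)⁻¹) := by
            ring
        _ ≤ jb (k - l) * (4 * (‖v (k - l)‖ * (jb k * jb l))) * ((jb k ^ 2)⁻¹ * (jb l ^ 2)⁻¹) := by
            gcongr
        _ = _ := by field_simp
    rw [abs_mul]
    calc _ ≤ |(jb k ^ 2)⁻¹ - (jb l ^ 2)⁻¹| * (‖g k‖ * (‖ker v k l‖ * ‖g l‖)) := by gcongr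
      _ = (|(jb k ^ 2)⁻¹ - (jb l ^ 2)⁻¹| * ‖ker v k l‖) * (‖g k‖ * ‖g l‖) := by ring
      _ ≤ 4 * ((jb k)⁻¹ * (jb (k - l) * ‖v (k - l)‖) * (jb l)⁻¹) * (‖g k‖ * ‖g l‖) := by gcongr
      _ = _ := by ring
  have hy := young_left (A := S) (L := S) hα hα
    (fun k => mul_nonneg (pow_nonneg (jb_nonneg k) 1) (norm_nonneg (v k)))
    (hV.sum_le (s := 1)) hg hg
  rw [← hsym] at hb
  simp_rw [← Finset.mul_sum] at hb
  simp_rw [← Finset.mul_sum] at hy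
  rw [abs_mul, abs_two] at hb
  nlinarith

/-- The tame convolution estimate: one factor carries all derivatives, the other is in `ℓ¹`. -/
theorem tame_sum_le {A L : Finset Freq} {v : Freq → Fin 2 → ℂ} {g : Freq → ℂ} {a : Freq → ℝ}
    {X : Freq → Freq → ℝ} {s : ℕ} {α V G C : ℝ} (hα : 0 ≤ α) (ha0 : ∀ k, 0 ≤ a k)
    (ha : ∑ k ∈ A, a k ^ 2 ≤ α ^ 2) (hv : SobLe 3 v V) (hg : SobLe (s + 2) g G) (hC : 0 ≤ C)
    (hX : ∀ k l, X k l ≤ C * ((jb (k - l) ^ 3 * ‖v (k - l)‖) * (jb l ^ s * ‖g l‖) +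
      (jb (k - l) ^ 1 * ‖v (k - l)‖) * (jb l ^ (s + 2) * ‖g l‖))) :
    ∑ k ∈ A, ∑ l ∈ L, a k * X k l ≤ α * (2 * C * embConst * V * G) := by
  have y1 := young_left (A := A) (L := L) hα hg.1
    (fun k => mul_nonneg (pow_nonneg (jb_nonneg k) 1) (norm_nonneg (v k)))
    (hv.sum_le (s := 1)) ha (hg.2 L)
  have y2 := young_right (A := A) (L := L) hα hv.1
    (fun k => mul_nonneg (pow_nonneg (jb_nonneg k) s) (norm_nonneg (g k)))
    (hg.sum_le L) ha hv.2
  calc ∑ k ∈ A, ∑ l ∈ L, a k * X k l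
      ≤ ∑ k ∈ A, ∑ l ∈ L, C * (a k * ((jb (k - l) ^ 3 * ‖v (k - l)‖) * (jb l ^ s * ‖g l‖)) +
        a k * ((jb (k - l) ^ 1 * ‖v (k - l)‖) * (jb l ^ (s + 2) * ‖g l‖))) := by
        refine Finset.sum_le_sum fun k _ => Finset.sum_le_sum fun l _ => ?_
        exact (mul_le_mul_of_nonneg_left (hX k l) (ha0 k)).trans (le_of_eq (by ring))
    _ = C * (∑ k ∈ A, ∑ l ∈ L, a k * ((jb (k - l) ^ 3 * ‖v (k - l)‖) * (jb l ^ s * ‖g l‖)) +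
        ∑ k ∈ A, ∑ l ∈ L,
          a k * ((jb (k - l) ^ 1 * ‖v (k - l)‖) * (jb l ^ (s + 2) * ‖g l‖))) := by
        simp_rw [← Finset.sum_add_distrib, Finset.mul_sum]
    _ ≤ C * (α * (V * (embConst * G)) + α * (embConst * V * G)) := by gcongr
    _ = _ := by ring

/-- Energy estimate for `v · ∇g` with a real Fourier multiplier `m`. -/
theorem abs_re_sum_sq_weight_le {S : Finset Freq} {v : Freq → Fin 2 → ℂ} (hv : DivFree v)
    (hr : HermV v) {g : Freq → ℂ} {m : Freq → ℝ} {s : ℕ} {α V G C : ℝ} (hα : 0 ≤ α)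
    (hV : SobLe 3 v V) (hg : SobLe (s + 2) g G) (hC : 0 ≤ C)
    (ha : ∑ k ∈ S, (m k * ‖g k‖) ^ 2 ≤ α ^ 2)
    (hm : ∀ k l, |m k - m l| * jb l ≤
      C * (jb (k - l) ^ 3 * jb l ^ s + jb (k - l) * jb l ^ (s + 2))) :
    |∑ k ∈ S, m k ^ 2 * ((starRingEnd ℂ) (g k) * advF S v g k).re| ≤
      α * (4 * C * embConst * V * G) := by
  -- The cancellation is applied to the differentiated function m g. Subtracting it replaces m k ²
  -- by m k (m k - m l), the commutator of the multiplier with transport.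
  have h0 := re_sum_eq_zero (S := S) hv hr (fun k => (m k : ℂ) * g k)
  have h1 : ∑ k ∈ S, m k ^ 2 * ((starRingEnd ℂ) (g k) * advF S v g k).re =
      ∑ k ∈ S, ∑ l ∈ S, m k * (m k - m l) * ((starRingEnd ℂ) (g k) * (ker v k l * g l)).re := by
    rw [← sub_zero (∑ k ∈ S, m k ^ 2 * ((starRingEnd ℂ) (g k) * advF S v g k).re), ← h0,
      ← Finset.sum_sub_distrib]
    refine Finset.sum_congr rfl fun k _ => ?_
    simp only [advF, Finset.mul_sum, Complex.re_sum, ← Finset.sum_sub_distrib]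
    refine Finset.sum_congr rfl fun l _ => ?_
    have : (starRingEnd ℂ) ((m k : ℂ) * g k) * (ker v k l * ((m l : ℂ) * g l)) =
        ((m k * m l : ℝ) : ℂ) * ((starRingEnd ℂ) (g k) * (ker v k l * g l)) := by
      simp only [map_mul, Complex.conj_ofReal]; push_cast; ring
    rw [this, Complex.re_ofReal_mul]
    ring
  rw [h1]
  refine le_trans ((Finset.abs_sum_le_sum_abs _ _).trans (Finset.sum_le_sum fun k _ =>
    Finset.abs_sum_le_sum_abs _ _)) ?_
  have h2 := tame_sum_le (A := S) (L := S) (a := fun k => |m k| * ‖g k‖)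
    (X := fun k l => |m k - m l| * (‖ker v k l‖ * ‖g l‖)) (C := 2 * C) hα
    (fun k => by positivity) (by simpa [mul_pow] using ha) hV hg (by positivity) (fun k l => ?_)
  · refine le_trans (Finset.sum_le_sum fun k _ => Finset.sum_le_sum fun l _ => ?_)
      (h2.trans (le_of_eq (by ring)))
    rw [abs_mul, abs_mul]
    have e1 : |((starRingEnd ℂ) (g k) * (ker v k l * g l)).re| ≤
        ‖g k‖ * (‖ker v k l‖ * ‖g l‖) := by
      refine (Complex.abs_re_le_norm _).trans (le_of_eq ?_)
      rw [norm_mul, norm_mul, RCLike.norm_conj]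
    refine (mul_le_mul_of_nonneg_left e1 (by positivity)).trans (le_of_eq (by ring))
  · have hl := jb_nonneg l
    have hkl := jb_nonneg (k - l)
    calc |m k - m l| * (‖ker v k l‖ * ‖g l‖)
        ≤ |m k - m l| * (2 * (‖v (k - l)‖ * jb l) * ‖g l‖) := by
          gcongr; exact norm_ker_le v k l
      _ = 2 * (|m k - m l| * jb l) * (‖v (k - l)‖ * ‖g l‖) := by ring
      _ ≤ 2 * (C * (jb (k - l) ^ 3 * jb l ^ s + jb (k - l) * jb l ^ (s + 2))) *
          (‖v (k - l)‖ * ‖g l‖) :=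
          mul_le_mul_of_nonneg_right (mul_le_mul_of_nonneg_left (hm k l) two_pos.le)
            (by positivity)
      _ = _ := by ring

/-- `v · ∇g` is bounded in `H²` when `v` and `g` are in `H³`. -/
theorem sum_forcing_le {A L : Finset Freq} {v : Freq → Fin 2 → ℂ} {g : Freq → ℂ} {a : Freq → ℝ}
    {α V G : ℝ} (hα : 0 ≤ α) (ha0 : ∀ k, 0 ≤ a k) (ha : ∑ k ∈ A, a k ^ 2 ≤ α ^ 2)
    (hv : SobLe 3 v V) (hg : SobLe 3 g G) :
    ∑ k ∈ A, a k * (jb k ^ 2 * ‖advF L v g k‖) ≤ α * (8 * embConst * V * G) := by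
  -- No cancellation is needed: g has the third derivative that the gradient consumes in H².
  have h2 := tame_sum_le (A := A) (L := L) (a := a) (s := 1)
    (X := fun k l => jb k ^ 2 * (‖ker v k l‖ * ‖g l‖)) (C := 4) hα ha0 ha hv hg
    (by norm_num) (fun k l => ?_)
  · refine le_trans (Finset.sum_le_sum fun k _ => ?_) (h2.trans (le_of_eq (by ring)))
    rw [← Finset.mul_sum, ← Finset.mul_sum]
    exact mul_le_mul_of_nonneg_left (mul_le_mul_of_nonneg_left (norm_advF_le L v g k)
      (by positivity)) (ha0 k)
  · have hkl := one_le_jb (k - l)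
    have hl := one_le_jb l
    have h1 : jb k ^ 2 * jb l ≤ 2 * (jb (k - l) ^ 3 * jb l ^ 1 + jb (k - l) * jb l ^ (1 + 2)) := by
      have : jb k ^ 2 ≤ (jb (k - l) + jb l) ^ 2 :=
        pow_le_pow_left₀ (jb_nonneg k) (jb_le_sub_add k l) 2
      have h3 : jb k ^ 2 ≤ 2 * (jb (k - l) * (jb (k - l) ^ 2 + jb l ^ 2)) := by
        nlinarith [sq_nonneg (jb (k - l) - jb l), sq_nonneg (jb (k - l)), sq_nonneg (jb l)]
      calc jb k ^ 2 * jb l ≤ 2 * (jb (k - l) * (jb (k - l) ^ 2 + jb l ^ 2)) * jb l := by gcongr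
        _ = _ := by ring
    calc jb k ^ 2 * (‖ker v k l‖ * ‖g l‖)
        ≤ jb k ^ 2 * (2 * (‖v (k - l)‖ * jb l) * ‖g l‖) := by
          gcongr; exact norm_ker_le v k l
      _ = 2 * (jb k ^ 2 * jb l) * (‖v (k - l)‖ * ‖g l‖) := by ring
      _ ≤ 2 * (2 * (jb (k - l) ^ 3 * jb l ^ 1 + jb (k - l) * jb l ^ (1 + 2))) *
          (‖v (k - l)‖ * ‖g l‖) := by gcongr
      _ = _ := by ring

/-- Low-norm estimate of `v · ∇g` for `v` in `L²`. -/
theorem sum_adv_low_le {A L : Finset Freq} {v : Freq → Fin 2 → ℂ} {g : Freq → ℂ} {a : Freq → ℝ}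
    {α V G : ℝ} (hα : 0 ≤ α) (ha0 : ∀ k, 0 ≤ a k) (ha : ∑ k ∈ A, a k ^ 2 ≤ α ^ 2)
    (hv : SobLe 0 v V) (hg : SobLe 3 g G) :
    ∑ k ∈ A, a k * ‖advF L v g k‖ ≤ α * (2 * (V * (embConst * G))) := by
  have y := young_right (A := A) (L := L) (h := fun k => jb k ^ 0 * ‖v k‖) hα hv.1
    (fun k => mul_nonneg (pow_nonneg (jb_nonneg k) 1) (norm_nonneg (g k)))
    (hg.sum_le L) ha hv.2
  calc ∑ k ∈ A, a k * ‖advF L v g k‖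
      ≤ ∑ k ∈ A, ∑ l ∈ L, 2 * (a k * ((jb (k - l) ^ 0 * ‖v (k - l)‖) * (jb l ^ 1 * ‖g l‖))) := by
        refine Finset.sum_le_sum fun k _ => ?_
        refine (mul_le_mul_of_nonneg_left (norm_advF_le L v g k) (ha0 k)).trans ?_
        rw [Finset.mul_sum]
        refine Finset.sum_le_sum fun l _ => ?_
        have := mul_le_mul_of_nonneg_right (norm_ker_le v k l) (norm_nonneg (g l))
        exact (mul_le_mul_of_nonneg_left this (ha0 k)).trans (le_of_eq (by ring))
    _ ≤ _ := by
        simp_rw [← Finset.mul_sum] at y ⊢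
        linarith

/-- In divergence form the derivative falls on the output frequency, where the H⁻¹ weight absorbs
it; neither factor has to be differentiated. -/
theorem norm_advF_div_le {v : Freq → Fin 2 → ℂ} (hv : DivFree v) (L : Finset Freq)
    (g : Freq → ℂ) (k : Freq) :
    (jb k)⁻¹ * ‖advF L v g k‖ ≤ ∑ l ∈ L, 2 * (‖v (k - l)‖ * ‖g l‖) := by
  rw [inv_mul_le_iff₀ (jb_pos k), Finset.mul_sum]
  refine (norm_advF_le L v g k).trans (Finset.sum_le_sum fun l _ => ?_)
  exact (mul_le_mul_of_nonneg_right (hv.norm_ker_le k l) (norm_nonneg _)).trans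
    (le_of_eq (by ring))

/-- `div(v g)` in `H⁻¹` for `v` bounded. -/
theorem sum_adv_neg_le_left {A L : Finset Freq} {v : Freq → Fin 2 → ℂ} (hdiv : DivFree v)
    {g : Freq → ℂ} {a : Freq → ℝ} {α V γ : ℝ} (hα : 0 ≤ α) (hγ : 0 ≤ γ) (ha0 : ∀ k, 0 ≤ a k)
    (ha : ∑ k ∈ A, a k ^ 2 ≤ α ^ 2) (hv : SobLe 2 v V) (hg : ∑ l ∈ L, ‖g l‖ ^ 2 ≤ γ ^ 2) :
    ∑ k ∈ A, a k * ((jb k)⁻¹ * ‖advF L v g k‖) ≤ α * (2 * (embConst * V * γ)) := by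
  have y := young_left (A := A) (L := L) (c := fun l => ‖g l‖) hα hγ
    (fun k => mul_nonneg (pow_nonneg (jb_nonneg k) 0) (norm_nonneg (v k)))
    (hv.sum_le (s := 0)) ha hg
  calc ∑ k ∈ A, a k * ((jb k)⁻¹ * ‖advF L v g k‖)
      ≤ ∑ k ∈ A, ∑ l ∈ L, 2 * (a k * ((jb (k - l) ^ 0 * ‖v (k - l)‖) * ‖g l‖)) := by
        refine Finset.sum_le_sum fun k _ => ?_
        refine (mul_le_mul_of_nonneg_left (norm_advF_div_le hdiv L g k) (ha0 k)).trans ?_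
        rw [Finset.mul_sum]
        exact Finset.sum_le_sum fun l _ => le_of_eq (by ring)
    _ ≤ _ := by
        simp_rw [← Finset.mul_sum] at y ⊢
        linarith

/-- `div(v g)` in `H⁻¹` for `g` bounded. -/
theorem sum_adv_neg_le_right {A L : Finset Freq} {v : Freq → Fin 2 → ℂ} (hdiv : DivFree v)
    {g : Freq → ℂ} {a : Freq → ℝ} {α V G : ℝ} (hα : 0 ≤ α) (ha0 : ∀ k, 0 ≤ a k)
    (ha : ∑ k ∈ A, a k ^ 2 ≤ α ^ 2) (hv : SobLe 0 v V) (hg : SobLe 2 g G) :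
    ∑ k ∈ A, a k * ((jb k)⁻¹ * ‖advF L v g k‖) ≤ α * (2 * (V * (embConst * G))) := by
  have y := young_right (A := A) (L := L) (h := fun k => jb k ^ 0 * ‖v k‖) hα hv.1
    (fun k => mul_nonneg (pow_nonneg (jb_nonneg k) 0) (norm_nonneg (g k)))
    (hg.sum_le L) ha hv.2
  calc ∑ k ∈ A, a k * ((jb k)⁻¹ * ‖advF L v g k‖)
      ≤ ∑ k ∈ A, ∑ l ∈ L, 2 * (a k * ((jb (k - l) ^ 0 * ‖v (k - l)‖) * (jb l ^ 0 * ‖g l‖))) := by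
        refine Finset.sum_le_sum fun k _ => ?_
        refine (mul_le_mul_of_nonneg_left (norm_advF_div_le hdiv L g k) (ha0 k)).trans ?_
        rw [Finset.mul_sum]
        exact Finset.sum_le_sum fun l _ => le_of_eq (by ring)
    _ ≤ _ := by
        simp_rw [← Finset.mul_sum] at y ⊢
        linarith

/-! ### Monomial multipliers -/

/-- The symbol of `∂^(p,q)` up to a unimodular constant. -/
def mon (p q : ℕ) (k : Freq) : ℝ := lam k 0 ^ p * lam k 1 ^ q

theorem abs_mon_le (p q : ℕ) (k : Freq) : |mon p q k| ≤ jb k ^ (p + q) := by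
  rw [mon, abs_mul, abs_pow, abs_pow, pow_add]
  exact mul_le_mul (pow_le_pow_left₀ (abs_nonneg _) (abs_lam_le k 0) p)
    (pow_le_pow_left₀ (abs_nonneg _) (abs_lam_le k 1) q) (by positivity)
    (pow_nonneg (jb_nonneg k) _)

theorem abs_mul_sub_mul_le {x y x' y' X Y A B : ℝ} (hx : |x| ≤ X) (hy' : |y'| ≤ Y)
    (h1 : |x - x'| ≤ A) (h2 : |y - y'| ≤ B) : |x * y - x' * y'| ≤ X * B + A * Y := by
  have : x * y - x' * y' = x * (y - y') + (x - x') * y' := by ring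
  rw [this]
  refine (abs_add_le _ _).trans ?_
  rw [abs_mul, abs_mul]
  exact add_le_add (mul_le_mul hx h2 (abs_nonneg _) ((abs_nonneg _).trans hx))
    (mul_le_mul h1 hy' (abs_nonneg _) ((abs_nonneg _).trans h1))

theorem abs_pow_sub_pow_le {x y A M : ℝ} (hx : |x| ≤ M) (hy : |y| ≤ M) (h : |x - y| ≤ A) (n : ℕ) :
    |x ^ (n + 1) - y ^ (n + 1)| ≤ (n + 1) * (A * M ^ n) := by
  induction n with
  | zero => simpa using h
  | succ n ih =>
    rw [pow_succ x, pow_succ y]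
    have hxn : |x ^ (n + 1)| ≤ M ^ (n + 1) := by
      rw [abs_pow]; exact pow_le_pow_left₀ (abs_nonneg _) hx _
    refine (abs_mul_sub_mul_le hxn hy ih h).trans (le_of_eq ?_)
    push_cast
    ring

/-- The extra factor M avoids the exponent n - 1, so that n = 0 needs no separate treatment in
monomials. -/
theorem abs_pow_sub_pow_le' {x y A M : ℝ} (hM : 1 ≤ M) (hx : |x| ≤ M) (hy : |y| ≤ M)
    (h : |x - y| ≤ A) (n : ℕ) : |x ^ n - y ^ n| * M ≤ n * (A * M ^ n) := by
  rcases n with _ | n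
  · simp
  · have := mul_le_mul_of_nonneg_right (abs_pow_sub_pow_le hx hy h n) (zero_le_one.trans hM)
    refine this.trans (le_of_eq ?_)
    push_cast
    ring

/-- A discrete mean value theorem: the components of both frequencies are at most M = ⟨k - l⟩ + ⟨l⟩,
those of their difference at most ⟨k - l⟩, and the difference of products is expanded by the Leibniz
rule. -/
theorem abs_mon_sub_mul_le (p q : ℕ) (k l : Freq) :
    |mon p q k - mon p q l| * (jb (k - l) + jb l) ≤
      (p + q) * (jb (k - l) * (jb (k - l) + jb l) ^ (p + q)) := by
  set M := jb (k - l) + jb l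
  have hM : 1 ≤ M := by have := one_le_jb (k - l); have := jb_nonneg l; simp only [M]; linarith
  have hk : ∀ j, |lam k j| ≤ M := fun j => (abs_lam_le k j).trans (jb_le_sub_add k l)
  have hl : ∀ j, |lam l j| ≤ M := fun j => (abs_lam_le l j).trans (by
    have := jb_nonneg (k - l); simp only [M]; linarith)
  have hd : ∀ j, |lam k j - lam l j| ≤ jb (k - l) := fun j => by
    rw [← lam_sub]; exact abs_lam_le _ j
  have h0 := abs_pow_sub_pow_le' hM (hk 0) (hl 0) (hd 0) p
  have h1 := abs_pow_sub_pow_le' hM (hk 1) (hl 1) (hd 1) q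
  have hM0 : 0 < M := by linarith
  have e1 : |lam k 0 ^ p| ≤ M ^ p := by
    rw [abs_pow]; exact pow_le_pow_left₀ (abs_nonneg _) (hk 0) _
  have e2 : |lam l 1 ^ q| ≤ M ^ q := by
    rw [abs_pow]; exact pow_le_pow_left₀ (abs_nonneg _) (hl 1) _
  have := abs_mul_sub_mul_le e1 e2 (le_refl |lam k 0 ^ p - lam l 0 ^ p|)
    (le_refl |lam k 1 ^ q - lam l 1 ^ q|)
  calc |mon p q k - mon p q l| * M
      ≤ (M ^ p * |lam k 1 ^ q - lam l 1 ^ q| + |lam k 0 ^ p - lam l 0 ^ p| * M ^ q) * M := by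
        gcongr; exact this
    _ = M ^ p * (|lam k 1 ^ q - lam l 1 ^ q| * M) + |lam k 0 ^ p - lam l 0 ^ p| * M * M ^ q := by
        ring
    _ ≤ M ^ p * (q * (jb (k - l) * M ^ q)) + p * (jb (k - l) * M ^ p) * M ^ q := by gcongr
    _ = _ := by ring

/-- The commutator symbol estimate. -/
theorem abs_mon_sub_le {p q s : ℕ} (hs : s ≤ 1) (h : p + q ≤ s + 2) (k l : Freq) :
    |mon p q k - mon p q l| * jb l ≤
      6 * (jb (k - l) ^ 3 * jb l ^ s + jb (k - l) * jb l ^ (s + 2)) := by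
  have hA := one_le_jb (k - l)
  have hL := one_le_jb l
  have h1 := abs_mon_sub_mul_le p q k l
  set A := jb (k - l)
  set B := jb l
  have hM : 1 ≤ A + B := by linarith
  have hpow : (A + B) ^ (p + q) ≤ (A + B) ^ (s + 2) := pow_le_pow_right₀ hM h
  have hpq : ((p : ℝ) + q) ≤ 3 := by exact_mod_cast (by omega : p + q ≤ 3)
  have h2 : |mon p q k - mon p q l| * (A + B) ≤ 3 * (A * (A + B) ^ (s + 2)) :=
    h1.trans (by gcongr)
  have h3 : |mon p q k - mon p q l| ≤ 3 * (A * (A + B) ^ (s + 1)) := by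
    refine le_of_mul_le_mul_right (h2.trans (le_of_eq ?_)) (show 0 < A + B by linarith)
    ring
  refine (mul_le_mul_of_nonneg_right h3 (by linarith)).trans ?_
  have hA3 : 0 ≤ A ^ 3 := by positivity
  -- The mixed powers of A and B are absorbed into the two extreme ones by AM–GM. The constant 6 is
  -- 3, the maximal order p + q, times 2 from this step.
  interval_cases s
  · change 3 * (A * (A + B) ^ 1) * B ≤ 6 * (A ^ 3 * B ^ 0 + A * B ^ 2)
    have : A * (A * B) ≤ A * (A ^ 2 + B ^ 2) := by
      gcongr; nlinarith [sq_nonneg (A - B), sq_nonneg (A + B)]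
    linarith
  · change 3 * (A * (A + B) ^ 2) * B ≤ 6 * (A ^ 3 * B ^ 1 + A * B ^ 3)
    have : A * B * (A + B) ^ 2 ≤ A * B * (2 * (A ^ 2 + B ^ 2)) := by
      gcongr; nlinarith [sq_nonneg (A - B)]
    linarith

/-! ### The velocity operator -/

/-- The coefficients of `∇^⊥ (Δ - 1)⁻¹ θ`. -/
def bs (θ : Freq → ℂ) (k : Freq) : Fin 2 → ℂ :=
  ![Complex.I * lam k 1 * θ k / (jb k : ℂ) ^ 2, -(Complex.I * lam k 0 * θ k / (jb k : ℂ) ^ 2)]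

theorem divFree_bs (θ : Freq → ℂ) : DivFree (bs θ) := fun k => by
  simp only [dot, bs, Matrix.cons_val_zero, Matrix.cons_val_one]
  ring

theorem Herm.bs {θ : Freq → ℂ} (h : Herm θ) : HermV (bs θ) := fun k j => by
  fin_cases j <;>
  simp [TQG.bs, jb_neg, lam_neg, h k]

theorem bs_sub (θ η : Freq → ℂ) : bs (θ - η) = bs θ - bs η := by
  funext k j
  fin_cases j <;> simp [bs] <;> ring

theorem bs_neg (θ : Freq → ℂ) : bs (-θ) = -bs θ := by
  funext k j
  fin_cases j <;> simp [bs] <;> ring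

theorem norm_bs_le (θ : Freq → ℂ) (k : Freq) : ‖bs θ k‖ ≤ (jb k)⁻¹ * ‖θ k‖ := by
  have hk := jb_pos k
  have h : ∀ j, ‖Complex.I * lam k j * θ k / (jb k : ℂ) ^ 2‖ ≤ (jb k)⁻¹ * ‖θ k‖ := fun j => by
    rw [norm_div, norm_mul, norm_mul, Complex.norm_I, one_mul, norm_pow, Complex.norm_real,
      Complex.norm_real, Real.norm_eq_abs, Real.norm_eq_abs, abs_of_pos hk,
      div_le_iff₀ (by positivity)]
    calc |lam k j| * ‖θ k‖ ≤ jb k * ‖θ k‖ := by gcongr; exact abs_lam_le k j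
      _ = (jb k)⁻¹ * ‖θ k‖ * jb k ^ 2 := by field_simp
  rw [pi_norm_le_iff_of_nonneg (by positivity)]
  intro j
  fin_cases j
  · simpa [bs] using h 1
  · simpa [bs] using h 0

theorem SobLe.bs {s : ℕ} {θ : Freq → ℂ} {R : ℝ} (h : SobLe s θ R) : SobLe (s + 1) (bs θ) R :=
  h.of_norm_le fun k => by
    have hk := jb_pos k
    calc jb k ^ (s + 1) * ‖TQG.bs θ k‖ ≤ jb k ^ (s + 1) * ((jb k)⁻¹ * ‖θ k‖) := by
          gcongr; exact norm_bs_le θ k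
      _ = jb k ^ s * ‖θ k‖ := by field_simp; ring

/-- The gain of one derivative at the lowest level: a vorticity difference controlled in H⁻¹ has a
velocity controlled in L², which is what the comparison estimate uses. -/
theorem sobLe_bs_of_support {S : Finset Freq} {θ : Freq → ℂ} {η : ℝ} (hη : 0 ≤ η)
    (hS : ∀ k ∉ S, θ k = 0) (h : ∑ k ∈ S, ((jb k)⁻¹ * ‖θ k‖) ^ 2 ≤ η ^ 2) :
    SobLe 0 (bs θ) η := by
  classical
  refine ⟨hη, fun F => le_trans ?_ h⟩
  have h1 : ∑ k ∈ F, ((jb k)⁻¹ * ‖θ k‖) ^ 2 ≤ ∑ k ∈ S, ((jb k)⁻¹ * ‖θ k‖) ^ 2 := by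
    rw [← Finset.sum_inter_add_sum_sdiff F S]
    have : ∑ k ∈ F \ S, ((jb k)⁻¹ * ‖θ k‖) ^ 2 = 0 :=
      Finset.sum_eq_zero fun k hk => by rw [hS k (Finset.mem_sdiff.1 hk).2]; simp
    rw [this, add_zero]
    exact Finset.sum_le_sum_of_subset_of_nonneg Finset.inter_subset_right
      fun _ _ _ => sq_nonneg _
  refine le_trans (Finset.sum_le_sum fun k _ => ?_) h1
  rw [pow_zero, one_mul]
  exact pow_le_pow_left₀ (norm_nonneg _) (norm_bs_le θ k) 2

theorem tendsto_bs {ι : Type*} {l : Filter ι} {θ : ι → Freq → ℂ} {η : Freq → ℂ}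
    (h : ∀ k, Filter.Tendsto (fun i => θ i k) l (nhds (η k))) (k : Freq) :
    Filter.Tendsto (fun i => bs (θ i) k) l (nhds (bs η k)) := by
  rw [tendsto_pi_nhds]
  intro j
  fin_cases j
  · exact ((h k).const_mul _).div_const _
  · exact (((h k).const_mul _).div_const _).neg

/-! ### Derivative norms on the Fourier side -/

/-- The multiplier of the multi-index `β`. -/
def monM {s : ℕ} (β : MultiIndex s) : Freq → ℝ := mon β.1.1 β.1.2

theorem abs_monM_le {s : ℕ} (β : MultiIndex s) (k : Freq) : |monM β k| ≤ jb k ^ s :=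
  (abs_mon_le _ _ k).trans (pow_le_pow_right₀ (one_le_jb k) β.2)

/-- Bounds of all derivatives up to order `s ≤ 3` bound the weighted norm. -/
theorem sobLe_of_monM {E : Type*} [NormedAddCommGroup E] {s : ℕ} (hs : s ≤ 3) {x : Freq → E}
    {M : ℝ} (hM : 0 ≤ M)
    (h : ∀ (β : MultiIndex s) (F : Finset Freq), ∑ k ∈ F, (monM β k * ‖x k‖) ^ 2 ≤ M ^ 2) :
    SobLe s x (9 * M) := by
  refine ⟨by positivity, fun F => ?_⟩
  -- The function and its two pure derivatives of order s suffice: (1 + X + Y)^s ≤ 3^s max(1, X,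
  -- Y)^s with 3^s ≤ 27, and three sums bounded by M² give 81 M² = (9M)².
  have h0 := h (MultiIndex.mk 0 0 (Nat.zero_le s)) F
  have h1 := h (MultiIndex.mk s 0 (by omega)) F
  have h2 := h (MultiIndex.mk 0 s (by omega)) F
  simp only [monM, MultiIndex.mk, mon, pow_zero, one_mul, mul_one] at h0 h1 h2
  have hsum : ∑ k ∈ F, (jb k ^ s * ‖x k‖) ^ 2 ≤ 27 * (∑ k ∈ F, ‖x k‖ ^ 2 +
      ∑ k ∈ F, (lam k 0 ^ s * ‖x k‖) ^ 2 + ∑ k ∈ F, (lam k 1 ^ s * ‖x k‖) ^ 2) := by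
    rw [← Finset.sum_add_distrib, ← Finset.sum_add_distrib, Finset.mul_sum]
    refine Finset.sum_le_sum fun k _ => ?_
    have hj : (jb k ^ s) ^ 2 ≤ 27 * (1 + (lam k 0 ^ s) ^ 2 + (lam k 1 ^ s) ^ 2) := by
      rw [pow_right_comm, jb_sq, pow_right_comm, pow_right_comm (lam k 1)]
      have hX := sq_nonneg (lam k 0)
      have hY := sq_nonneg (lam k 1)
      generalize lam k 0 ^ 2 = X at *
      generalize lam k 1 ^ 2 = Y at *
      have h3 : (3 : ℝ) ^ s ≤ 27 := by
        calc (3 : ℝ) ^ s ≤ 3 ^ 3 := pow_le_pow_right₀ (by norm_num) hs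
          _ = 27 := by norm_num
      have hmax : 1 + X + Y ≤ 3 * max 1 (max X Y) := by
        linarith [le_max_left 1 (max X Y), (le_max_left X Y).trans (le_max_right 1 (max X Y)),
          (le_max_right X Y).trans (le_max_right 1 (max X Y))]
      have hXs := pow_nonneg hX s
      have hYs := pow_nonneg hY s
      have hpow : (max 1 (max X Y)) ^ s ≤ 1 + X ^ s + Y ^ s := by
        rcases max_choice 1 (max X Y) with h | h
        · rw [h, one_pow]; linarith
        · rw [h]
          rcases max_choice X Y with h | h <;> rw [h] <;> linarith
      calc (1 + X + Y) ^ s ≤ (3 * max 1 (max X Y)) ^ s :=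
            pow_le_pow_left₀ (by linarith) hmax s
        _ = 3 ^ s * (max 1 (max X Y)) ^ s := mul_pow _ _ _
        _ ≤ 27 * (1 + X ^ s + Y ^ s) := by gcongr
    calc (jb k ^ s * ‖x k‖) ^ 2 = (jb k ^ s) ^ 2 * ‖x k‖ ^ 2 := mul_pow _ _ _
      _ ≤ 27 * (1 + (lam k 0 ^ s) ^ 2 + (lam k 1 ^ s) ^ 2) * ‖x k‖ ^ 2 := by gcongr
      _ = _ := by ring
  calc _ ≤ 27 * (M ^ 2 + M ^ 2 + M ^ 2) := hsum.trans (by gcongr)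
    _ = (9 * M) ^ 2 := by ring

/-! ### Differential inequalities -/

/-- Norms are square roots of energies and need not be differentiable where the energy vanishes; the
shift by ε repairs this, and ε tends to 0 after integration. -/
theorem hasDerivWithinAt_sqrt_add {E : ℝ → ℝ} {E' ε t : ℝ} {s : Set ℝ}
    (h : HasDerivWithinAt E E' s t) (hε : 0 < ε) (h0 : 0 ≤ E t) :
    HasDerivWithinAt (fun t => √(ε + E t)) (E' / (2 * √(ε + E t))) s t :=
  (h.const_add ε).sqrt (by positivity)

theorem div_sqrt_le {E E' ε K : ℝ} (hε : 0 < ε) (h0 : 0 ≤ E) (hK : 0 ≤ K)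
    (h : E' ≤ 2 * √E * K) : E' / (2 * √(ε + E)) ≤ K := by
  have hp : 0 < √(ε + E) := Real.sqrt_pos.2 (by positivity)
  rw [div_le_iff₀ (by positivity)]
  have : √E ≤ √(ε + E) := Real.sqrt_le_sqrt (by linarith)
  nlinarith [mul_le_mul_of_nonneg_right this hK]

/-- If `E' ≤ 2 √E K` then `√E` grows at most at rate `K`. -/
theorem sqrt_le_of_deriv_le {E E' : ℝ → ℝ} {T K : ℝ} (hK : 0 ≤ K)
    (hE : ∀ t ∈ Icc 0 T, HasDerivWithinAt E (E' t) (Icc 0 T) t) (h0 : ∀ t ∈ Icc 0 T, 0 ≤ E t)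
    (hb : ∀ t ∈ Icc 0 T, E' t ≤ 2 * √(E t) * K) {t : ℝ} (ht : t ∈ Icc 0 T) :
    √(E t) ≤ √(E 0) + K * t := by
  have h0T : (0 : ℝ) ∈ Icc 0 T := ⟨le_rfl, ht.1.trans ht.2⟩
  have key : ∀ ε > 0, √(ε + E t) ≤ √(ε + E 0) + K * t := by
    intro ε hε
    have hd : ∀ s ∈ Icc 0 T, HasDerivWithinAt (fun s => K * s - √(ε + E s))
        (K * 1 - E' s / (2 * √(ε + E s))) (Icc 0 T) s := fun s hs =>
      ((hasDerivWithinAt_id s _).const_mul K).sub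
        (hasDerivWithinAt_sqrt_add (hE s hs) hε (h0 s hs))
    have hmono : MonotoneOn (fun s => K * s - √(ε + E s)) (Icc 0 T) :=
      monotoneOn_of_hasDerivWithinAt_nonneg (convex_Icc 0 T)
        (fun s hs => (hd s hs).continuousWithinAt)
        (fun s hs => (hd s (interior_subset hs)).mono interior_subset)
        (fun s hs => by
          have hs' := interior_subset hs
          linarith [div_sqrt_le hε (h0 s hs') hK (hb s hs')])
    have := hmono h0T ht ht.1
    simp only [mul_zero, zero_sub] at this
    linarith
  have hlim : ∀ a : ℝ, Filter.Tendsto (fun ε => √(ε + a)) (nhdsWithin 0 (Ioi 0)) (nhds √a) :=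
    fun a => by
      have : Continuous fun ε : ℝ => √(ε + a) := by fun_prop
      simpa using (this.tendsto 0).mono_left nhdsWithin_le_nhds
  exact le_of_tendsto_of_tendsto (hlim _) ((hlim _).add_const _)
    (Filter.eventually_of_mem self_mem_nhdsWithin key)

/-- The Riccati inequality for a sum of norms. -/
theorem inv_one_add_sq_sum_sqrt_ge {ι : Type*} [Fintype ι] {E E' : ι → ℝ → ℝ} {T K : ℝ}
    (hK : 0 ≤ K)
    (hE : ∀ i, ∀ t ∈ Icc 0 T, HasDerivWithinAt (E i) (E' i t) (Icc 0 T) t)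
    (h0 : ∀ i, ∀ t ∈ Icc 0 T, 0 ≤ E i t)
    (hb : ∀ i, ∀ t ∈ Icc 0 T, E' i t ≤ 2 * √(E i t) * (K * (1 + (∑ j, √(E j t)) ^ 2)))
    {t : ℝ} (ht : t ∈ Icc 0 T) :
    (1 + (∑ j, √(E j 0)) ^ 2)⁻¹ - Fintype.card ι * K * t ≤ (1 + (∑ j, √(E j t)) ^ 2)⁻¹ := by
  have h0T : (0 : ℝ) ∈ Icc 0 T := ⟨le_rfl, ht.1.trans ht.2⟩
  have key : ∀ ε > 0, (1 + (∑ j, √(ε + E j 0)) ^ 2)⁻¹ - Fintype.card ι * K * t ≤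
      (1 + (∑ j, √(ε + E j t)) ^ 2)⁻¹ := by
    intro ε hε
    set q : ℝ → ℝ := fun s => ∑ j, √(ε + E j s) with hq
    set q' : ℝ → ℝ := fun s => ∑ j, E' j s / (2 * √(ε + E j s)) with hq'
    have hq0 : ∀ s, 0 ≤ q s := fun s => Finset.sum_nonneg fun _ _ => Real.sqrt_nonneg _
    have hqd : ∀ s ∈ Icc 0 T, HasDerivWithinAt q (q' s) (Icc 0 T) s := fun s hs =>
      HasDerivWithinAt.fun_sum fun i _ => hasDerivWithinAt_sqrt_add (hE i s hs) hε (h0 i s hs)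
    have hqb : ∀ s ∈ Icc 0 T, q' s ≤ Fintype.card ι * K * (1 + q s ^ 2) := by
      intro s hs
      have hNq : ∑ j, √(E j s) ≤ q s :=
        Finset.sum_le_sum fun j _ => Real.sqrt_le_sqrt (by linarith)
      have hN0 : 0 ≤ ∑ j, √(E j s) := Finset.sum_nonneg fun _ _ => Real.sqrt_nonneg _
      have hle : K * (1 + (∑ j, √(E j s)) ^ 2) ≤ K * (1 + q s ^ 2) := by gcongr
      have : ∀ i ∈ Finset.univ, E' i s / (2 * √(ε + E i s)) ≤ K * (1 + q s ^ 2) := fun i _ =>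
        (div_sqrt_le hε (h0 i s hs) (by positivity) (hb i s hs)).trans hle
      refine (Finset.sum_le_card_nsmul _ _ _ this).trans (le_of_eq ?_)
      simp [mul_assoc]
    have hd : ∀ s ∈ Icc 0 T, HasDerivWithinAt
        (fun s => (1 + q s ^ 2)⁻¹ + Fintype.card ι * K * s)
        (-(((2 : ℕ) : ℝ) * q s ^ (2 - 1) * q' s) / (1 + q s ^ 2) ^ 2 + Fintype.card ι * K * 1)
        (Icc 0 T) s := fun s hs =>
      ((((hqd s hs).fun_pow 2).const_add 1).fun_inv (by positivity)).add
        ((hasDerivWithinAt_id s _).const_mul _)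
    have hmono : MonotoneOn (fun s => (1 + q s ^ 2)⁻¹ + Fintype.card ι * K * s) (Icc 0 T) := by
      refine monotoneOn_of_hasDerivWithinAt_nonneg (convex_Icc 0 T)
        (fun s hs => (hd s hs).continuousWithinAt)
        (fun s hs => (hd s (interior_subset hs)).mono interior_subset) (fun s hs => ?_)
      have hs' := interior_subset hs
      have hY : 0 < 1 + q s ^ 2 := by positivity
      have h1 : 2 * q s * q' s ≤ Fintype.card ι * K * (1 + q s ^ 2) ^ 2 := by
        -- This turns q' ≤ C (1 + q²) into a bound of the derivative of 1/(1 + q²) below by the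
        -- constant -C.
        have h2 : 2 * q s ≤ 1 + q s ^ 2 := by nlinarith [sq_nonneg (q s - 1)]
        calc 2 * q s * q' s ≤ 2 * q s * (Fintype.card ι * K * (1 + q s ^ 2)) := by
              have := hq0 s
              gcongr
              exact hqb s hs'
          _ ≤ (1 + q s ^ 2) * (Fintype.card ι * K * (1 + q s ^ 2)) := by gcongr
          _ = _ := by ring
      have h3 : 2 * q s * q' s / (1 + q s ^ 2) ^ 2 ≤ Fintype.card ι * K := by
        rw [div_le_iff₀ (by positivity)]; exact h1
      simp only [Nat.cast_ofNat, show 2 - 1 = 1 from rfl, pow_one, neg_div]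
      linarith
    have := hmono h0T ht ht.1
    simp only [mul_zero, add_zero] at this
    linarith
  have hlim : ∀ a : ι → ℝ, Filter.Tendsto (fun ε => (1 + (∑ j, √(ε + a j)) ^ 2)⁻¹)
      (nhdsWithin 0 (Ioi 0)) (nhds (1 + (∑ j, √(a j)) ^ 2)⁻¹) := fun a => by
    have : Continuous fun ε : ℝ => (1 + (∑ j, √(ε + a j)) ^ 2)⁻¹ := by
      refine Continuous.inv₀ (by fun_prop) fun x => by positivity
    simpa using (this.tendsto 0).mono_left nhdsWithin_le_nhds
  exact le_of_tendsto_of_tendsto ((hlim _).sub_const _) (hlim _)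
    (Filter.eventually_of_mem self_mem_nhdsWithin key)

/-- The derivative of a weighted energy. -/
theorem hasDerivWithinAt_energy {S : Finset Freq} {x : ℝ → Freq → ℂ} {x' : Freq → ℂ} {t : ℝ}
    {I : Set ℝ} (w : Freq → ℝ)
    (h : ∀ k ∈ S, HasDerivWithinAt (fun t => x t k) (x' k) I t) :
    HasDerivWithinAt (fun t => ∑ k ∈ S, w k * ‖x t k‖ ^ 2)
      (2 * ∑ k ∈ S, w k * ((starRingEnd ℂ) (x t k) * x' k).re) I t := by
  rw [Finset.mul_sum]
  refine HasDerivWithinAt.fun_sum fun k hk => ?_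
  have := ((h k hk).norm_sq).const_mul (w k)
  rw [Complex.inner] at this
  rwa [mul_comm (starRingEnd ℂ (x t k)), mul_left_comm]

/-! ### The nonlinearity and its energy estimates -/

/-- The coefficients `uh`, `f` belong to a real divergence-free field bounded by `U` in `H³` and to
a real function bounded by `Φ` in `H²`. -/
structure IsData (uh : Freq → Fin 2 → ℂ) (f : Freq → ℂ) (U Φ : ℝ) : Prop where
  divFree : DivFree uh
  hermV : HermV uh
  sobLe_uh : SobLe 3 uh U
  herm : Herm f
  sobLe_f : SobLe 2 f Φ

/-- The coefficients of `u · ∇b`. -/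
def nlB (f b ω : Freq → ℂ) : Freq → ℂ := adv (bs (ω - f)) b

/-- The coefficients of `u · ∇(ω - b) + u_h · ∇b`. -/
def nlW (uh : Freq → Fin 2 → ℂ) (f b ω : Freq → ℂ) : Freq → ℂ :=
  adv (bs (ω - f)) (ω - b) + adv uh b

theorem Herm.sub {g h : Freq → ℂ} (hg : Herm g) (hh : Herm h) : Herm (g - h) := fun k => by
  simp [hg k, hh k]

theorem Herm.add {g h : Freq → ℂ} (hg : Herm g) (hh : Herm h) : Herm (g + h) := fun k => by
  simp [hg k, hh k]

theorem Herm.neg {g : Freq → ℂ} (hg : Herm g) : Herm (-g) := fun k => by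
  simp [hg k]

theorem Herm.adv {v : Freq → Fin 2 → ℂ} {g : Freq → ℂ} (hv : HermV v) (hg : Herm g) :
    Herm (adv v g) := fun k => by
  rw [TQG.adv, TQG.adv, Complex.conj_tsum, ← (Equiv.neg Freq).tsum_eq]
  refine tsum_congr fun l => ?_
  rw [Equiv.neg_apply, ker_neg_neg hv, hg l, map_mul]

theorem Herm.nlB {f b ω : Freq → ℂ} (hf : Herm f) (hb : Herm b) (hω : Herm ω) :
    Herm (nlB f b ω) :=
  Herm.adv (hω.sub hf).bs hb

theorem Herm.nlW {uh : Freq → Fin 2 → ℂ} {f b ω : Freq → ℂ} (hu : HermV uh) (hf : Herm f)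
    (hb : Herm b) (hω : Herm ω) : Herm (nlW uh f b ω) :=
  (Herm.adv (hω.sub hf).bs (hω.sub hb)).add (Herm.adv hu hb)

/-- The squared norms of the derivatives of `b` of order at most three and of the derivatives of
`ω` of order at most two, computed on the modes in `S`. -/
def energyF (S : Finset Freq) (b ω : Freq → ℂ) : MultiIndex 3 ⊕ MultiIndex 2 → ℝ
  | Sum.inl β => ∑ k ∈ S, monM β k ^ 2 * ‖b k‖ ^ 2
  | Sum.inr β => ∑ k ∈ S, monM β k ^ 2 * ‖ω k‖ ^ 2

/-- The norm of `𝓜` computed on the modes in `S`. -/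
def normF (S : Finset Freq) (b ω : Freq → ℂ) : ℝ := ∑ i, √(energyF S b ω i)

theorem energyF_nonneg (S : Finset Freq) (b ω : Freq → ℂ) (i : MultiIndex 3 ⊕ MultiIndex 2) :
    0 ≤ energyF S b ω i := by
  rcases i with β | β <;> exact Finset.sum_nonneg fun _ _ => by positivity

theorem normF_nonneg (S : Finset Freq) (b ω : Freq → ℂ) : 0 ≤ normF S b ω :=
  Finset.sum_nonneg fun _ _ => Real.sqrt_nonneg _

theorem sqrt_energyF_le (S : Finset Freq) (b ω : Freq → ℂ) (i : MultiIndex 3 ⊕ MultiIndex 2) :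
    √(energyF S b ω i) ≤ normF S b ω :=
  Finset.single_le_sum (f := fun i => √(energyF S b ω i)) (fun _ _ => Real.sqrt_nonneg _)
    (Finset.mem_univ i)

theorem energyF_le (S : Finset Freq) (b ω : Freq → ℂ) (i : MultiIndex 3 ⊕ MultiIndex 2) :
    energyF S b ω i ≤ normF S b ω ^ 2 :=
  (Real.sqrt_le_left (normF_nonneg S b ω)).1 (sqrt_energyF_le S b ω i)

theorem sum_le_sum_of_support {S : Finset Freq} {x : Freq → ℝ} (hx0 : ∀ k, 0 ≤ x k)
    (hx : ∀ k ∉ S, x k = 0) (F : Finset Freq) : ∑ k ∈ F, x k ≤ ∑ k ∈ S, x k := by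
  classical
  rw [← Finset.sum_inter_add_sum_sdiff F S]
  have : ∑ k ∈ F \ S, x k = 0 := Finset.sum_eq_zero fun k hk => hx k (Finset.mem_sdiff.1 hk).2
  rw [this, add_zero]
  exact Finset.sum_le_sum_of_subset_of_nonneg Finset.inter_subset_right fun k _ _ => hx0 k

theorem sobLe_fst_of_normF {S : Finset Freq} {b ω : Freq → ℂ} (hb : ∀ k ∉ S, b k = 0) :
    SobLe 3 b (9 * normF S b ω) := by
  refine sobLe_of_monM le_rfl (normF_nonneg S b ω) fun β F => ?_
  refine (sum_le_sum_of_support (S := S) (fun _ => sq_nonneg _) (fun k hk => by simp [hb k hk]) F).trans ?_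
  refine le_trans (le_of_eq ?_) (energyF_le S b ω (Sum.inl β))
  exact Finset.sum_congr rfl fun k _ => mul_pow _ _ _

theorem sobLe_snd_of_normF {S : Finset Freq} {b ω : Freq → ℂ} (hω : ∀ k ∉ S, ω k = 0) :
    SobLe 2 ω (9 * normF S b ω) := by
  refine sobLe_of_monM (by norm_num) (normF_nonneg S b ω) fun β F => ?_
  refine (sum_le_sum_of_support (S := S) (fun _ => sq_nonneg _) (fun k hk => by simp [hω k hk]) F).trans ?_
  refine le_trans (le_of_eq ?_) (energyF_le S b ω (Sum.inr β))
  exact Finset.sum_congr rfl fun k _ => mul_pow _ _ _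

/-- The growth rate constant of the derivative norms. -/
def rate (U Φ : ℝ) : ℝ := 4000 * embConst * (1 + U + Φ)

theorem rate_nonneg {U Φ : ℝ} (hU : 0 ≤ U) (hΦ : 0 ≤ Φ) : 0 ≤ rate U Φ := by
  have := embConst_nonneg
  unfold rate
  positivity

theorem sum_sq_mul_sq {S : Finset Freq} (m : Freq → ℝ) (g : Freq → ℂ) :
    ∑ k ∈ S, (m k * ‖g k‖) ^ 2 = √(∑ k ∈ S, m k ^ 2 * ‖g k‖ ^ 2) ^ 2 := by
  rw [Real.sq_sqrt (Finset.sum_nonneg fun _ _ => by positivity)]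
  exact Finset.sum_congr rfl fun k _ => mul_pow _ _ _

/-- The commutator estimate with s = 1: the velocity of ω - f is in H³, exactly what differentiating
u · ∇b three times requires. -/
theorem abs_energy_nlB_le {uh : Freq → Fin 2 → ℂ} {f : Freq → ℂ} {U Φ : ℝ}
    (hd : IsData uh f U Φ) {S : Finset Freq} {b ω : Freq → ℂ} (hω : Herm ω)
    (hbS : ∀ k ∉ S, b k = 0) (hωS : ∀ k ∉ S, ω k = 0) (β : MultiIndex 3) :
    |∑ k ∈ S, monM β k ^ 2 * ((starRingEnd ℂ) (b k) * nlB f b ω k).re| ≤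
      √(energyF S b ω (Sum.inl β)) * (rate U Φ * (1 + normF S b ω ^ 2)) := by
  have hb := sobLe_fst_of_normF (ω := ω) hbS
  have hv := ((sobLe_snd_of_normF (b := b) hωS).sub hd.sobLe_f).bs
  have h := abs_re_sum_sq_weight_le (S := S) (s := 1) (m := monM β) (divFree_bs (ω - f))
    (hω.sub hd.herm).bs (Real.sqrt_nonneg (energyF S b ω (Sum.inl β))) hv hb
    (show (0 : ℝ) ≤ 6 by norm_num) (sum_sq_mul_sq _ _).le
    (fun k l => abs_mon_sub_le le_rfl β.2 k l)
  simp only [nlB, adv_eq_advF hbS]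
  refine h.trans (mul_le_mul_of_nonneg_left ?_ (Real.sqrt_nonneg _))
  have hN := normF_nonneg S b ω
  have hK := embConst_nonneg
  have hU := hd.sobLe_uh.1
  have hΦ := hd.sobLe_f.1
  generalize normF S b ω = N at *
  have e1 : N ≤ (1 + N ^ 2) / 2 := by nlinarith [sq_nonneg (N - 1)]
  have e2 : embConst * Φ * N ≤ embConst * Φ * ((1 + N ^ 2) / 2) := by gcongr
  rw [rate]
  have e3 : 0 ≤ embConst * U * (1 + N ^ 2) := by positivity
  have e4 : 0 ≤ embConst * Φ * (1 + N ^ 2) := by positivity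
  have e5 : 0 ≤ embConst * N ^ 2 := by positivity
  nlinarith

/-- Plain duality with the H² bound of v · ∇g. It serves the terms of the vorticity equation in
which the gradient falls on b. -/
theorem abs_energy_forcing_le {S : Finset Freq} {v : Freq → Fin 2 → ℂ} {g ω : Freq → ℂ} {V G : ℝ}
    (hv : SobLe 3 v V) (hg : SobLe 3 g G) (β : MultiIndex 2) :
    |∑ k ∈ S, monM β k ^ 2 * ((starRingEnd ℂ) (ω k) * advF S v g k).re| ≤
      √(∑ k ∈ S, monM β k ^ 2 * ‖ω k‖ ^ 2) * (8 * embConst * V * G) := by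
  have h := sum_forcing_le (A := S) (L := S) (a := fun k => |monM β k| * ‖ω k‖)
    (Real.sqrt_nonneg (∑ k ∈ S, monM β k ^ 2 * ‖ω k‖ ^ 2)) (fun k => by positivity)
    (by
      rw [← sum_sq_mul_sq]
      exact le_of_eq (Finset.sum_congr rfl fun k _ => by rw [mul_pow, mul_pow, sq_abs])) hv hg
  refine (Finset.abs_sum_le_sum_abs _ _).trans
    (le_trans (Finset.sum_le_sum fun k _ => ?_) h)
  have e1 : |((starRingEnd ℂ) (ω k) * advF S v g k).re| ≤ ‖ω k‖ * ‖advF S v g k‖ := by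
    refine (Complex.abs_re_le_norm _).trans (le_of_eq ?_)
    rw [norm_mul, RCLike.norm_conj]
  rw [abs_mul, abs_pow]
  calc |monM β k| ^ 2 * |((starRingEnd ℂ) (ω k) * advF S v g k).re|
      ≤ (|monM β k| * jb k ^ 2) * (‖ω k‖ * ‖advF S v g k‖) := by
        rw [sq]
        have := abs_monM_le β k
        gcongr
    _ = _ := by ring

/-- Only u · ∇ω could lose a derivative, and it is treated as a commutator with s = 0; u · ∇b and
u_h · ∇b are forcing terms bounded in H² by the H³ norm of b. -/
theorem abs_energy_nlW_le {uh : Freq → Fin 2 → ℂ} {f : Freq → ℂ} {U Φ : ℝ}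
    (hd : IsData uh f U Φ) {S : Finset Freq} {b ω : Freq → ℂ} (hω : Herm ω)
    (hbS : ∀ k ∉ S, b k = 0) (hωS : ∀ k ∉ S, ω k = 0) (β : MultiIndex 2) :
    |∑ k ∈ S, monM β k ^ 2 * ((starRingEnd ℂ) (ω k) * nlW uh f b ω k).re| ≤
      √(energyF S b ω (Sum.inr β)) * (rate U Φ * (1 + normF S b ω ^ 2)) := by
  have hb := sobLe_fst_of_normF (ω := ω) hbS
  have hw := sobLe_snd_of_normF (b := b) hωS
  have hv := (hw.sub hd.sobLe_f).bs
  have h1 := abs_re_sum_sq_weight_le (S := S) (s := 0) (m := monM β) (divFree_bs (ω - f))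
    (hω.sub hd.herm).bs (Real.sqrt_nonneg (energyF S b ω (Sum.inr β))) hv hw
    (show (0 : ℝ) ≤ 6 by norm_num) (sum_sq_mul_sq _ _).le
    (fun k l => abs_mon_sub_le zero_le_one β.2 k l)
  have h2 := abs_energy_forcing_le (S := S) (ω := ω) hv hb β
  have h3 := abs_energy_forcing_le (S := S) (ω := ω) hd.sobLe_uh hb β
  have hsplit : ∑ k ∈ S, monM β k ^ 2 * ((starRingEnd ℂ) (ω k) * nlW uh f b ω k).re =
      ∑ k ∈ S, monM β k ^ 2 * ((starRingEnd ℂ) (ω k) * advF S (bs (ω - f)) ω k).re -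
      ∑ k ∈ S, monM β k ^ 2 * ((starRingEnd ℂ) (ω k) * advF S (bs (ω - f)) b k).re +
      ∑ k ∈ S, monM β k ^ 2 * ((starRingEnd ℂ) (ω k) * advF S uh b k).re := by
    rw [← Finset.sum_sub_distrib, ← Finset.sum_add_distrib]
    refine Finset.sum_congr rfl fun k _ => ?_
    rw [nlW, Pi.add_apply, adv_eq_advF hbS, adv_eq_advF (S := S) (fun k hk => by
      rw [Pi.sub_apply, hbS k hk, hωS k hk, sub_zero]), advF_sub_right, ← mul_sub, ← mul_add,
      ← Complex.sub_re, ← Complex.add_re]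
    ring_nf
  rw [hsplit]
  change |_| ≤ √(∑ k ∈ S, monM β k ^ 2 * ‖ω k‖ ^ 2) * _
  change |_| ≤ √(∑ k ∈ S, monM β k ^ 2 * ‖ω k‖ ^ 2) * _ at h1
  refine (abs_add_le _ _).trans ((add_le_add ((abs_sub _ _).trans (add_le_add h1 h2)) h3).trans ?_)
  rw [← mul_add, ← mul_add]
  refine mul_le_mul_of_nonneg_left ?_ (Real.sqrt_nonneg _)
  have hN := normF_nonneg S b ω
  have hK := embConst_nonneg
  have hU := hd.sobLe_uh.1
  have hΦ := hd.sobLe_f.1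
  generalize normF S b ω = N at *
  -- With V = 9N + Φ and G = 9N the three bounds add up to `embConst` times 2592 N² + 288 Φ N + 72 U
  -- N. Linear terms are traded for 1 + N², and the 4000 in `rate` covers everything.
  have e1 : N ≤ (1 + N ^ 2) / 2 := by nlinarith [sq_nonneg (N - 1)]
  have e2 : embConst * Φ * N ≤ embConst * Φ * ((1 + N ^ 2) / 2) := by gcongr
  have e6 : embConst * U * N ≤ embConst * U * ((1 + N ^ 2) / 2) := by gcongr
  rw [rate]
  have e3 : 0 ≤ embConst * U * (1 + N ^ 2) := by positivity
  have e4 : 0 ≤ embConst * Φ * (1 + N ^ 2) := by positivity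
  have e5 : 0 ≤ embConst * N ^ 2 := by positivity
  nlinarith

/-- The constant of the Riccati inequality for the `𝓜`-norm. -/
def riccati (U Φ : ℝ) : ℝ := Fintype.card (MultiIndex 3 ⊕ MultiIndex 2) * rate U Φ

/-- The derivative of the energies along a Galerkin system damped by a scalar `θ`. -/
theorem exists_deriv_energyF_le {uh : Freq → Fin 2 → ℂ} {f : Freq → ℂ} {U Φ : ℝ}
    (hd : IsData uh f U Φ) {S : Finset Freq} {b ω : ℝ → Freq → ℂ} {θ t : ℝ} {J : Set ℝ}
    (hθ : θ ∈ Icc (0 : ℝ) 1) (hω : Herm (ω t)) (hbS : ∀ k ∉ S, b t k = 0)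
    (hωS : ∀ k ∉ S, ω t k = 0)
    (hb' : ∀ k ∈ S, HasDerivWithinAt (fun t => b t k) (-(θ * nlB f (b t) (ω t) k)) J t)
    (hω' : ∀ k ∈ S, HasDerivWithinAt (fun t => ω t k) (-(θ * nlW uh f (b t) (ω t) k)) J t)
    (i : MultiIndex 3 ⊕ MultiIndex 2) :
    ∃ E', HasDerivWithinAt (fun t => energyF S (b t) (ω t) i) E' J t ∧
      E' ≤ 2 * √(energyF S (b t) (ω t) i) * (rate U Φ * (1 + normF S (b t) (ω t) ^ 2)) := by
  have hpull : ∀ (m : Freq → ℝ) (x q : Freq → ℂ),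
      2 * ∑ k ∈ S, m k * ((starRingEnd ℂ) (x k) * -(θ * q k)).re =
      2 * (θ * -∑ k ∈ S, m k * ((starRingEnd ℂ) (x k) * q k).re) := by
    intro m x q
    congr 1
    rw [← Finset.sum_neg_distrib, Finset.mul_sum]
    refine Finset.sum_congr rfl fun k _ => ?_
    rw [show (starRingEnd ℂ) (x k) * -(θ * q k) = -((θ : ℂ) * ((starRingEnd ℂ) (x k) * q k)) by
      ring, Complex.neg_re, Complex.re_ofReal_mul]
    ring
  -- A damping factor in [0, 1] cannot worsen a bound on the absolute value. Hence the cut-off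
  -- Galerkin system obeys the same a priori estimate as the true one.
  have hfin : ∀ X Y : ℝ, 0 ≤ Y → |X| ≤ Y → 2 * (θ * -X) ≤ 2 * Y := by
    intro X Y hY h
    have h1 : θ * -X ≤ θ * Y := mul_le_mul_of_nonneg_left ((neg_le_abs X).trans h) hθ.1
    have h2 : θ * Y ≤ 1 * Y := mul_le_mul_of_nonneg_right hθ.2 hY
    linarith
  have hr := rate_nonneg hd.sobLe_uh.1 hd.sobLe_f.1
  rcases i with β | β
  · refine ⟨_, hasDerivWithinAt_energy (fun k => monM β k ^ 2) hb', ?_⟩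
    rw [hpull, mul_assoc]
    exact hfin _ _ (by positivity) (abs_energy_nlB_le hd hω hbS hωS β)
  · refine ⟨_, hasDerivWithinAt_energy (fun k => monM β k ^ 2) hω', ?_⟩
    rw [hpull, mul_assoc]
    exact hfin _ _ (by positivity) (abs_energy_nlW_le hd hω hbS hωS β)

/-- A priori bounds for Galerkin systems damped by `θ`. -/
theorem galerkin_apriori {uh : Freq → Fin 2 → ℂ} {f : Freq → ℂ} {U Φ : ℝ}
    (hd : IsData uh f U Φ) {S : Finset Freq} {b ω : ℝ → Freq → ℂ} {θ : ℝ → ℝ} {T : ℝ}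
    (hθ : ∀ t, θ t ∈ Icc (0 : ℝ) 1) (hω : ∀ t ∈ Icc 0 T, Herm (ω t))
    (hbS : ∀ t ∈ Icc 0 T, ∀ k ∉ S, b t k = 0) (hωS : ∀ t ∈ Icc 0 T, ∀ k ∉ S, ω t k = 0)
    (hb' : ∀ t ∈ Icc 0 T, ∀ k ∈ S,
      HasDerivWithinAt (fun t => b t k) (-(θ t * nlB f (b t) (ω t) k)) (Icc 0 T) t)
    (hω' : ∀ t ∈ Icc 0 T, ∀ k ∈ S,
      HasDerivWithinAt (fun t => ω t k) (-(θ t * nlW uh f (b t) (ω t) k)) (Icc 0 T) t) :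
    (∀ t ∈ Icc 0 T, (1 + normF S (b 0) (ω 0) ^ 2)⁻¹ - riccati U Φ * t ≤
      (1 + normF S (b t) (ω t) ^ 2)⁻¹) ∧
    ∀ R, (∀ t ∈ Icc 0 T, normF S (b t) (ω t) ≤ R) → ∀ i, ∀ t ∈ Icc 0 T,
      √(energyF S (b t) (ω t) i) ≤ √(energyF S (b 0) (ω 0) i) + rate U Φ * (1 + R ^ 2) * t := by
  have hr := rate_nonneg hd.sobLe_uh.1 hd.sobLe_f.1
  have hE : ∀ i, ∀ t ∈ Icc 0 T, ∃ E', HasDerivWithinAt (fun t => energyF S (b t) (ω t) i) E'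
      (Icc 0 T) t ∧ E' ≤ 2 * √(energyF S (b t) (ω t) i) *
        (rate U Φ * (1 + normF S (b t) (ω t) ^ 2)) := fun i t ht =>
    exists_deriv_energyF_le hd (hθ t) (hω t ht) (hbS t ht) (hωS t ht) (hb' t ht) (hω' t ht) i
  choose! E' hE1 hE2 using hE
  refine ⟨fun t ht => ?_, fun R hR i t ht => ?_⟩
  · exact inv_one_add_sq_sum_sqrt_ge (E := fun i t => energyF S (b t) (ω t) i) hr
      hE1 (fun i t _ => energyF_nonneg _ _ _ i) hE2 ht
  · refine sqrt_le_of_deriv_le (E := fun t => energyF S (b t) (ω t) i) (by positivity)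
      (hE1 i) (fun t _ => energyF_nonneg _ _ _ i) (fun t ht => (hE2 i t ht).trans ?_) ht
    have := normF_nonneg S (b t) (ω t)
    have := hR t ht
    gcongr

/-! ### Existence for the Galerkin systems -/

/-- A C¹ field of compact support is globally bounded and Lipschitz. Picard–Lindelöf on the ball of
radius M T, which no curve of speed at most M can leave, then covers the whole interval at once. -/
theorem exists_global_of_hasCompactSupport {X : Type*} [NormedAddCommGroup X] [NormedSpace ℝ X]
    [CompleteSpace X] {G : X → X} (hG : ContDiff ℝ 1 G) (hc : HasCompactSupport G) (x₀ : X)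
    {T : ℝ} (hT : 0 ≤ T) :
    ∃ α : ℝ → X, α 0 = x₀ ∧ ∀ t ∈ Icc 0 T, HasDerivWithinAt α (G (α t)) (Icc 0 T) t := by
  obtain ⟨K, hK⟩ := hG.lipschitzWith_of_hasCompactSupport hc one_ne_zero
  obtain ⟨M, hM⟩ := hc.exists_bound_of_continuous hG.continuous
  have hM0 : 0 ≤ M := (norm_nonneg _).trans (hM x₀)
  have hP : IsPicardLindelof (fun _ => G) (tmin := 0) (tmax := T) ⟨0, le_rfl, hT⟩ x₀
      (⟨M, hM0⟩ * ⟨T, hT⟩) 0 ⟨M, hM0⟩ K := by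
    refine IsPicardLindelof.of_time_independent (fun x _ => hM x) hK.lipschitzOnWith ?_
    have : max (T - 0) (0 - 0) = T := by simp [hT]
    change M * max (T - 0) (0 - 0) ≤ M * T - 0
    rw [this, sub_zero]
  exact hP.exists_eq_forall_mem_Icc_hasDerivWithinAt₀

section Galerkin

variable {S : Finset Freq}

/-- Extension by zero of finitely many coefficients. -/
def extZ (x : S → ℂ) (k : Freq) : ℂ := if h : k ∈ S then x ⟨k, h⟩ else 0

/-- The Hermitian part of the extension by zero. -/
def extH (x : S → ℂ) (k : Freq) : ℂ := (extZ x k + (starRingEnd ℂ) (extZ x (-k))) / 2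

theorem extZ_of_notMem (x : S → ℂ) {k : Freq} (hk : k ∉ S) : extZ x k = 0 := dif_neg hk

theorem extZ_coe (x : S → ℂ) (k : S) : extZ x k = x k := by simp [extZ]

theorem extH_of_notMem (hS : ∀ k ∈ S, -k ∈ S) (x : S → ℂ) {k : Freq} (hk : k ∉ S) :
    extH x k = 0 := by
  have : -k ∉ S := fun h => hk (by simpa using hS _ h)
  simp [extH, extZ_of_notMem, hk, this]

theorem herm_extH (x : S → ℂ) : Herm (extH x) := fun k => by
  rw [extH, extH, neg_neg, map_div₀, map_add, Complex.conj_conj, map_ofNat, add_comm]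

theorem extH_eq_extZ {x : S → ℂ} (h : Herm (extZ x)) : extH x = extZ x := by
  funext k
  rw [extH, h k, Complex.conj_conj]
  ring

theorem contDiff_extZ (k : Freq) : ContDiff ℝ 1 fun x : S → ℂ => extZ x k := by
  by_cases h : k ∈ S
  · simp only [extZ, h, dif_pos]
    exact contDiff_apply ℝ ℂ (⟨k, h⟩ : S)
  · simp only [extZ, h, dif_neg, not_false_eq_true]
    exact contDiff_const

theorem contDiff_extH (k : Freq) : ContDiff ℝ 1 fun x : S → ℂ => extH x k := by
  have h : ContDiff ℝ 1 fun x : S → ℂ => (starRingEnd ℂ) (extZ x (-k)) :=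
    Complex.conjCLE.contDiff.comp (contDiff_extZ (-k))
  exact ((contDiff_extZ k).add h).div_const 2

theorem contDiff_advF {X : Type*} [NormedAddCommGroup X] [NormedSpace ℝ X]
    {v : X → Freq → Fin 2 → ℂ} {g : X → Freq → ℂ} (hv : ∀ k j, ContDiff ℝ 1 fun x => v x k j)
    (hg : ∀ k, ContDiff ℝ 1 fun x => g x k) (k : Freq) :
    ContDiff ℝ 1 fun x => advF S (v x) (g x) k := by
  refine ContDiff.sum fun l _ => ContDiff.mul ?_ (hg l)
  exact contDiff_const.mul (((hv _ 0).mul contDiff_const).add ((hv _ 1).mul contDiff_const))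

theorem contDiff_bs {X : Type*} [NormedAddCommGroup X] [NormedSpace ℝ X]
    {θ : X → Freq → ℂ} (hθ : ∀ k, ContDiff ℝ 1 fun x => θ x k) (k : Freq) (j : Fin 2) :
    ContDiff ℝ 1 fun x => bs (θ x) k j := by
  fin_cases j
  · exact (contDiff_const.mul (hθ k)).div_const _
  · exact ((contDiff_const.mul (hθ k)).div_const _).neg

/-- The Galerkin vector field on the modes in `S`. -/
def galerkinField (uh : Freq → Fin 2 → ℂ) (f : Freq → ℂ) (x : (S → ℂ) × (S → ℂ)) :
    (S → ℂ) × (S → ℂ) :=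
  (fun k => -nlB f (extH x.1) (extH x.2) k, fun k => -nlW uh f (extH x.1) (extH x.2) k)

theorem contDiff_galerkinField (hS : ∀ k ∈ S, -k ∈ S) (uh : Freq → Fin 2 → ℂ) (f : Freq → ℂ) :
    ContDiff ℝ 1 (galerkinField (S := S) uh f) := by
  have h1 : ∀ k, ContDiff ℝ 1 fun x : (S → ℂ) × (S → ℂ) => extH x.1 k := fun k =>
    (contDiff_extH k).comp contDiff_fst
  have h2 : ∀ k, ContDiff ℝ 1 fun x : (S → ℂ) × (S → ℂ) => extH x.2 k := fun k =>
    (contDiff_extH k).comp contDiff_snd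
  have hv : ∀ k j, ContDiff ℝ 1 fun x : (S → ℂ) × (S → ℂ) => bs (extH x.2 - f) k j :=
    contDiff_bs fun k => (h2 k).sub contDiff_const
  have s1 : ∀ x : (S → ℂ) × (S → ℂ), ∀ k ∉ S, extH x.1 k = 0 := fun x k => extH_of_notMem hS x.1
  have s2 : ∀ x : (S → ℂ) × (S → ℂ), ∀ k ∉ S, (extH x.2 - extH x.1) k = 0 := fun x k hk => by
    rw [Pi.sub_apply, extH_of_notMem hS _ hk, extH_of_notMem hS _ hk, sub_zero]
  refine ContDiff.prodMk (contDiff_pi.2 fun k => ?_) (contDiff_pi.2 fun k => ?_)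
  · simp only [nlB, fun x => adv_eq_advF (v := bs (extH x.2 - f)) (s1 x) (k : Freq)]
    exact (contDiff_advF hv h1 k).neg
  · simp only [nlW, Pi.add_apply, fun x => adv_eq_advF (v := bs (extH x.2 - f)) (s2 x) (k : Freq),
      fun x => adv_eq_advF (v := uh) (s1 x) (k : Freq)]
    have e1 := contDiff_advF (S := S) (g := fun x => extH x.2 - extH x.1) hv
      (fun k => (h2 k).sub (h1 k)) k
    have e2 := contDiff_advF (S := S) (v := fun _ => uh) (fun _ _ => contDiff_const) h1 k
    exact (e1.add e2).neg

/-- A curve of coefficients whose derivative is Hermitian stays Hermitian. -/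
theorem herm_of_deriv (hS : ∀ k ∈ S, -k ∈ S) {x : ℝ → Freq → ℂ} {q : ℝ → Freq → ℂ} {T : ℝ}
    (h0 : Herm (x 0)) (hx : ∀ t, ∀ k ∉ S, x t k = 0) (hq : ∀ t, Herm (q t))
    (hd : ∀ t ∈ Icc 0 T, ∀ k ∈ S, HasDerivWithinAt (fun t => x t k) (q t k) (Icc 0 T) t)
    {t : ℝ} (ht : t ∈ Icc 0 T) : Herm (x t) := by
  intro k
  by_cases hk : k ∈ S
  · have hderiv : ∀ s ∈ Icc 0 T, HasDerivWithinAt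
        (fun s => x s (-k) - (starRingEnd ℂ) (x s k)) 0 (Icc 0 T) s := by
      intro s hs
      have h1 := hd s hs (-k) (hS k hk)
      have h2 : HasDerivWithinAt (fun s => (starRingEnd ℂ) (x s k)) ((starRingEnd ℂ) (q s k))
          (Icc 0 T) s := (hd s hs k hk).star
      have := h1.sub h2
      rwa [hq s k, sub_self] at this
    have hconst := constant_of_has_deriv_right_zero
      (fun s hs => (hderiv s hs).continuousWithinAt)
      (fun s hs => (hderiv s ⟨hs.1, hs.2.le⟩).mono_of_mem_nhdsWithin
        (Icc_mem_nhdsGE_of_mem hs)) t ht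
    rw [h0 k, sub_self] at hconst
    exact sub_eq_zero.1 hconst
  · have : -k ∉ S := fun h => hk (by simpa using hS _ h)
    rw [hx t _ hk, hx t _ this, map_zero]

/-- The Galerkin system on a symmetric finite set of modes, on the whole interval allowed by the a
priori bound. -/
theorem exists_galerkin {uh : Freq → Fin 2 → ℂ} {f : Freq → ℂ} {U Φ : ℝ} (hd : IsData uh f U Φ)
    (hS : ∀ k ∈ S, -k ∈ S) {b₀ ω₀ : Freq → ℂ} (hb₀ : Herm b₀) (hω₀ : Herm ω₀)
    (hbS : ∀ k ∉ S, b₀ k = 0) (hωS : ∀ k ∉ S, ω₀ k = 0) {T : ℝ} (hT : 0 ≤ T)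
    (hsmall : riccati U Φ * T < (1 + normF S b₀ ω₀ ^ 2)⁻¹) :
    ∃ b ω : ℝ → Freq → ℂ, b 0 = b₀ ∧ ω 0 = ω₀ ∧ (∀ t ∈ Icc 0 T, Herm (b t) ∧ Herm (ω t)) ∧
      (∀ t, ∀ k ∉ S, b t k = 0 ∧ ω t k = 0) ∧
      (∀ t ∈ Icc 0 T, ∀ k ∈ S,
        HasDerivWithinAt (fun t => b t k) (-nlB f (b t) (ω t) k) (Icc 0 T) t) ∧
      ∀ t ∈ Icc 0 T, ∀ k ∈ S,
        HasDerivWithinAt (fun t => ω t k) (-nlW uh f (b t) (ω t) k) (Icc 0 T) t := by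
  have hricc : 0 ≤ riccati U Φ :=
    mul_nonneg (Nat.cast_nonneg _) (rate_nonneg hd.sobLe_uh.1 hd.sobLe_f.1)
  -- The a priori estimate will keep 1/(1 + N²) above δ, hence N below δ⁻¹. The bump function is 1
  -- on the ball of radius δ⁻¹ + 1, so the cut-off is never felt.
  set δ := (1 + normF S b₀ ω₀ ^ 2)⁻¹ - riccati U Φ * T with hδ
  have hδ0 : 0 < δ := by linarith
  set χ : ContDiffBump (0 : (S → ℂ) × (S → ℂ)) :=
    ⟨δ⁻¹ + 1, δ⁻¹ + 2, by positivity, by linarith⟩ with hχ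
  obtain ⟨α, hα0, hα⟩ := exists_global_of_hasCompactSupport
    (G := fun x => χ x • galerkinField uh f x)
    (χ.contDiff.smul (contDiff_galerkinField hS uh f)) χ.hasCompactSupport.smul_right
    ((fun k => b₀ k, fun k => ω₀ k) : (S → ℂ) × (S → ℂ)) hT
  set b : ℝ → Freq → ℂ := fun t => extZ (α t).1 with hb
  set ω : ℝ → Freq → ℂ := fun t => extZ (α t).2 with hω
  have hb0 : b 0 = b₀ := by
    funext k
    by_cases hk : k ∈ S
    · simp [hb, hα0, extZ, hk]
    · simp [hb, extZ, hk, hbS k hk]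
  have hω0 : ω 0 = ω₀ := by
    funext k
    by_cases hk : k ∈ S
    · simp [hω, hα0, extZ, hk]
    · simp [hω, extZ, hk, hωS k hk]
  have hsuppb : ∀ t, ∀ k ∉ S, b t k = 0 := fun t k hk => extZ_of_notMem _ hk
  have hsuppω : ∀ t, ∀ k ∉ S, ω t k = 0 := fun t k hk => extZ_of_notMem _ hk
  have hdb : ∀ t ∈ Icc 0 T, ∀ k ∈ S, HasDerivWithinAt (fun t => b t k)
      (-(χ (α t) * nlB f (extH (α t).1) (extH (α t).2) k)) (Icc 0 T) t := by
    intro t ht k hk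
    have h1 := (hasDerivWithinAt_pi.1 ((ContinuousLinearMap.fst ℝ (S → ℂ) (S → ℂ)).hasFDerivAt
      |>.comp_hasDerivWithinAt t (hα t ht))) ⟨k, hk⟩
    simp only [hb, extZ, hk, dif_pos]
    simpa [galerkinField] using h1
  have hdω : ∀ t ∈ Icc 0 T, ∀ k ∈ S, HasDerivWithinAt (fun t => ω t k)
      (-(χ (α t) * nlW uh f (extH (α t).1) (extH (α t).2) k)) (Icc 0 T) t := by
    intro t ht k hk
    have h1 := (hasDerivWithinAt_pi.1 ((ContinuousLinearMap.snd ℝ (S → ℂ) (S → ℂ)).hasFDerivAt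
      |>.comp_hasDerivWithinAt t (hα t ht))) ⟨k, hk⟩
    simp only [hω, extZ, hk, dif_pos]
    simpa [galerkinField] using h1
  have hermq : ∀ (r : ℝ) {q : Freq → ℂ}, Herm q → Herm fun k => -(r * q k) := fun r q hq k => by
    simp [hq k]
  -- The field is evaluated on Hermitian parts, so its values are Hermitian along any curve. The
  -- solution therefore stays Hermitian, and taking Hermitian parts turns out to be harmless.
  have hHb : ∀ t ∈ Icc 0 T, Herm (b t) := fun t ht =>
    herm_of_deriv hS (hb0 ▸ hb₀) hsuppb
      (fun t => hermq _ (Herm.nlB hd.herm (herm_extH _) (herm_extH _))) hdb ht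
  have hHω : ∀ t ∈ Icc 0 T, Herm (ω t) := fun t ht =>
    herm_of_deriv hS (hω0 ▸ hω₀) hsuppω
      (fun t => hermq _ (Herm.nlW hd.hermV hd.herm (herm_extH _) (herm_extH _))) hdω ht
  have hdb' : ∀ t ∈ Icc 0 T, ∀ k ∈ S, HasDerivWithinAt (fun t => b t k)
      (-(χ (α t) * nlB f (b t) (ω t) k)) (Icc 0 T) t := fun t ht k hk => by
    have := hdb t ht k hk
    rwa [extH_eq_extZ (hHb t ht), extH_eq_extZ (hHω t ht)] at this
  have hdω' : ∀ t ∈ Icc 0 T, ∀ k ∈ S, HasDerivWithinAt (fun t => ω t k)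
      (-(χ (α t) * nlW uh f (b t) (ω t) k)) (Icc 0 T) t := fun t ht k hk => by
    have := hdω t ht k hk
    rwa [extH_eq_extZ (hHb t ht), extH_eq_extZ (hHω t ht)] at this
  -- The bound is available before it is known that the cut-off equals 1, because its value along
  -- the solution is a scalar damping.
  have hap := (galerkin_apriori hd (θ := fun t => χ (α t)) (fun t => ⟨χ.nonneg, χ.le_one⟩) hHω
    (fun t _ => hsuppb t) (fun t _ => hsuppω t) hdb' hdω').1
  have hone : ∀ t ∈ Icc 0 T, χ (α t) = 1 := by
    intro t ht
    have h1 := hap t ht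
    rw [hb0, hω0] at h1
    have h2 : δ ≤ (1 + normF S (b t) (ω t) ^ 2)⁻¹ := by
      have : riccati U Φ * t ≤ riccati U Φ * T := mul_le_mul_of_nonneg_left ht.2 hricc
      linarith
    have h3 : 1 + normF S (b t) (ω t) ^ 2 ≤ δ⁻¹ := by
      rw [le_inv_comm₀ (by positivity) hδ0]; exact h2
    have h4 : normF S (b t) (ω t) ≤ δ⁻¹ := by
      nlinarith [sq_nonneg (normF S (b t) (ω t) - 1), normF_nonneg S (b t) (ω t)]
    refine χ.one_of_mem_closedBall ?_
    rw [mem_closedBall_zero_iff]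
    have hmode : ∀ (x : Freq → ℂ) (k : Freq), k ∈ S →
        ‖x k‖ ^ 2 ≤ ∑ k ∈ S, mon 0 0 k ^ 2 * ‖x k‖ ^ 2 := by
      intro x k hk
      refine le_trans (le_of_eq ?_) (Finset.single_le_sum (f := fun k => mon 0 0 k ^ 2 * ‖x k‖ ^ 2)
        (fun _ _ => by positivity) hk)
      simp [mon]
    have hN := normF_nonneg S (b t) (ω t)
    refine (Prod.norm_def (α t)).le.trans (max_le ?_ ?_)
    · refine (pi_norm_le_iff_of_nonneg (by positivity)).2 fun k => ?_
      have e := (hmode (b t) k k.2).trans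
        (energyF_le S (b t) (ω t) (Sum.inl (MultiIndex.mk 0 0 (Nat.zero_le 3))))
      have e' := (abs_le_of_sq_le_sq' e hN).2
      simp only [hb, extZ_coe] at e'
      change ‖(α t).1 k‖ ≤ δ⁻¹ + 1
      linarith
    · refine (pi_norm_le_iff_of_nonneg (by positivity)).2 fun k => ?_
      have e := (hmode (ω t) k k.2).trans
        (energyF_le S (b t) (ω t) (Sum.inr (MultiIndex.mk 0 0 (Nat.zero_le 2))))
      have e' := (abs_le_of_sq_le_sq' e hN).2
      simp only [hω, extZ_coe] at e'
      change ‖(α t).2 k‖ ≤ δ⁻¹ + 1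
      linarith
  refine ⟨b, ω, hb0, hω0, fun t ht => ⟨hHb t ht, hHω t ht⟩,
    fun t k hk => ⟨hsuppb t k hk, hsuppω t k hk⟩, fun t ht k hk => ?_, fun t ht k hk => ?_⟩
  · have := hdb' t ht k hk
    rwa [hone t ht, Complex.ofReal_one, one_mul] at this
  · have := hdω' t ht k hk
    rwa [hone t ht, Complex.ofReal_one, one_mul] at this

end Galerkin

/-! ### Comparison in low norms -/

theorem abs_sum_re_mul_le {S : Finset Freq} (x r : Freq → ℂ) (w : Freq → ℝ) (hw : ∀ k, 0 ≤ w k) :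
    |∑ k ∈ S, w k * ((starRingEnd ℂ) (x k) * r k).re| ≤ ∑ k ∈ S, w k * (‖x k‖ * ‖r k‖) := by
  refine (Finset.abs_sum_le_sum_abs _ _).trans (Finset.sum_le_sum fun k _ => ?_)
  rw [abs_mul, abs_of_nonneg (hw k)]
  refine mul_le_mul_of_nonneg_left ((Complex.abs_re_le_norm _).trans (le_of_eq ?_)) (hw k)
  rw [norm_mul, RCLike.norm_conj]

theorem sum_mul_norm_le_of_sobLe {S : Finset Freq} {a : Freq → ℝ} {r : Freq → ℂ} {α ε : ℝ}
    (hα : 0 ≤ α) (ha : ∑ k ∈ S, a k ^ 2 ≤ α ^ 2) (hr : SobLe 0 r ε) :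
    ∑ k ∈ S, a k * ‖r k‖ ≤ α * ε := by
  refine (Real.sum_mul_le_sqrt_mul_sqrt _ _ _).trans
    (mul_le_mul ((Real.sqrt_le_left hα).2 ha) ?_ (Real.sqrt_nonneg _) hα)
  simpa using hr.sqrt_le S

/-- The error made by restricting `v · ∇g` to low modes of `v` and `g`. -/
def advErr (n : ℕ) (f ω g : Freq → ℂ) : Freq → ℂ :=
  adv (bs (ω - trunc (box n) ω)) g + adv (bs (trunc (box n) ω - f)) (g - trunc (box n) g)

theorem sobLe_advErr {n : ℕ} (hn : 0 < n) {f ω g : Freq → ℂ} {Φ R G : ℝ} (hf : SobLe 2 f Φ)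
    (hω : SobLe 2 ω R) (hg : SobLe 2 g G) :
    SobLe 0 (advErr n f ω g) (2 * (embConst * (R + (R + Φ)) * G) / n) := by
  have h1 := SobLe.adv (s := 0) (hω.sub_trunc hn).bs (hg.of_le (by norm_num))
  have h2 := SobLe.adv (s := 0) ((((hω.trunc (box n)).sub hf).bs).of_le (by norm_num))
    (hg.sub_trunc hn)
  refine (h1.add h2).mono (le_of_eq ?_)
  ring

/-- Bilinear bookkeeping: a truncation error, the velocity difference acting on the known g, and
transport of the difference of g by the other velocity. The last two involve only modes in the box,
where the cancellations hold exactly. -/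
theorem adv_sub_adv_eq {n : ℕ} {f ω ω' g g' : Freq → ℂ} {Φ R G : ℝ} (hf : SobLe 2 f Φ)
    (hω : SobLe 2 ω R) (hg : SobLe 2 g G) (hg' : ∀ k ∉ box n, g' k = 0) (k : Freq) :
    adv (bs (ω - f)) g k - adv (bs (ω' - f)) g' k =
      advErr n f ω g k + advF (box n) (bs (trunc (box n) ω - ω')) (trunc (box n) g) k +
        advF (box n) (bs (ω' - f)) (trunc (box n) g - g') k := by
  have hg1 : SobLe 1 g G := hg.of_le (by norm_num)
  have hu : SobLe 0 (bs (ω - f)) (R + Φ) := ((hω.sub hf).bs).of_le (Nat.zero_le _)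
  have hū : SobLe 0 (bs (trunc (box n) ω - f)) (R + Φ) :=
    (((hω.trunc (box n)).sub hf).bs).of_le (Nat.zero_le _)
  have e1 : bs (ω - trunc (box n) ω) = bs (ω - f) - bs (trunc (box n) ω - f) := by
    rw [← bs_sub, sub_sub_sub_cancel_right]
  have e2 : bs (trunc (box n) ω - ω') = bs (trunc (box n) ω - f) - bs (ω' - f) := by
    rw [← bs_sub, sub_sub_sub_cancel_right]
  rw [advErr, Pi.add_apply, e1, adv_sub_left hu hū hg1, adv_sub_right hū hg1 (hg1.trunc _),
    adv_eq_advF (fun k hk => trunc_of_notMem g hk), adv_eq_advF hg', e2, advF_sub_left,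
    advF_sub_right]
  change _ = (_ - _ + (_ - advF (box n) _ (trunc (box n) g) k)) + _ + _
  ring

section Difference

variable {uh : Freq → Fin 2 → ℂ} {f : Freq → ℂ} {U Φ R : ℝ} {n : ℕ} {b ω b' ω' : Freq → ℂ}

/-- The energy inequality for the difference of the buoyancies in `L²`. -/
theorem diff_nlB_le (hd : IsData uh f U Φ) (hn : 0 < n) (hb : SobLe 3 b R) (hω : SobLe 2 ω R)
    (hω'H : Herm ω') (hbS : ∀ k ∉ box n, b' k = 0) (hωS : ∀ k ∉ box n, ω' k = 0) {p η : ℝ}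
    (hp0 : 0 ≤ p) (hη0 : 0 ≤ η) (hp : ∑ k ∈ box n, ‖b k - b' k‖ ^ 2 ≤ p ^ 2)
    (hη : ∑ k ∈ box n, ((jb k)⁻¹ * ‖ω k - ω' k‖) ^ 2 ≤ η ^ 2) :
    |∑ k ∈ box n, ((starRingEnd ℂ) (b k - b' k) * (nlB f b ω k - nlB f b' ω' k)).re| ≤
      p * (2 * (embConst * (R + (R + Φ)) * R) / n) + p * (2 * (η * (embConst * R))) := by
  set B := trunc (box n) b - b' with hB
  set W := trunc (box n) ω - ω' with hW
  have hBk : ∀ k ∈ box n, B k = b k - b' k := fun k hk => by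
    rw [hB, Pi.sub_apply, trunc_of_mem b hk]
  have hWk : ∀ k ∈ box n, W k = ω k - ω' k := fun k hk => by
    rw [hW, Pi.sub_apply, trunc_of_mem ω hk]
  have hWS : ∀ k ∉ box n, W k = 0 := fun k hk => by
    rw [hW, Pi.sub_apply, trunc_of_notMem ω hk, hωS k hk, sub_zero]
  have hb2 : SobLe 2 b R := hb.of_le (by norm_num)
  have hp' : ∑ k ∈ box n, ‖B k‖ ^ 2 ≤ p ^ 2 :=
    (Finset.sum_congr rfl fun k hk => by rw [hBk k hk]).trans_le hp
  have hη' : ∑ k ∈ box n, ((jb k)⁻¹ * ‖W k‖) ^ 2 ≤ η ^ 2 :=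
    (Finset.sum_congr rfl fun k hk => by rw [hWk k hk]).trans_le hη
  have hsplit : ∑ k ∈ box n, ((starRingEnd ℂ) (b k - b' k) * (nlB f b ω k - nlB f b' ω' k)).re =
      ∑ k ∈ box n, 1 * ((starRingEnd ℂ) (B k) * advErr n f ω b k).re +
      ∑ k ∈ box n, 1 * ((starRingEnd ℂ) (B k) * advF (box n) (bs W) (trunc (box n) b) k).re +
      ∑ k ∈ box n, ((starRingEnd ℂ) (B k) * advF (box n) (bs (ω' - f)) B k).re := by
    rw [← Finset.sum_add_distrib, ← Finset.sum_add_distrib]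
    refine Finset.sum_congr rfl fun k hk => ?_
    rw [nlB, nlB, adv_sub_adv_eq hd.sobLe_f hω hb2 hbS, ← hBk k hk, mul_add, mul_add,
      Complex.add_re, Complex.add_re, one_mul, one_mul]
  -- Transport of the difference by the second velocity drops out of its L² energy.
  rw [hsplit, re_sum_eq_zero (divFree_bs _) (hω'H.sub hd.herm).bs, add_zero]
  refine (abs_add_le _ _).trans (add_le_add ?_ ?_)
  · refine (abs_sum_re_mul_le _ _ (fun _ => 1) fun _ => zero_le_one).trans ?_
    simp only [one_mul]
    exact sum_mul_norm_le_of_sobLe hp0 hp' (sobLe_advErr hn hd.sobLe_f hω hb2)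
  · refine (abs_sum_re_mul_le _ _ (fun _ => 1) fun _ => zero_le_one).trans ?_
    simp only [one_mul]
    exact sum_adv_low_le hp0 (fun _ => norm_nonneg _) hp' (sobLe_bs_of_support hη0 hWS hη')
      (hb.trunc _)

/-- The energy inequality for the difference of the vorticities in `H⁻¹`. -/
theorem diff_nlW_le (hd : IsData uh f U Φ) (hn : 0 < n) (hb : SobLe 3 b R) (hω : SobLe 2 ω R)
    (hω' : SobLe 2 ω' R) (hω'H : Herm ω') (hbS : ∀ k ∉ box n, b' k = 0)
    (hωS : ∀ k ∉ box n, ω' k = 0) {p η : ℝ}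
    (hp0 : 0 ≤ p) (hη0 : 0 ≤ η) (hp : ∑ k ∈ box n, ‖b k - b' k‖ ^ 2 ≤ p ^ 2)
    (hη : ∑ k ∈ box n, ((jb k)⁻¹ * ‖ω k - ω' k‖) ^ 2 ≤ η ^ 2) :
    |∑ k ∈ box n, (jb k ^ 2)⁻¹ *
        ((starRingEnd ℂ) (ω k - ω' k) * (nlW uh f b ω k - nlW uh f b' ω' k)).re| ≤
      η * (2 * (embConst * (R + (R + Φ)) * (R + R)) / n + 2 * (embConst * U * R) / n) +
        η * (2 * (η * (embConst * (R + R)))) + 2 * (embConst * (R + Φ)) * η ^ 2 +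
        η * (2 * (embConst * (R + Φ) * p)) + η * (2 * (embConst * U * p)) := by
  set B := trunc (box n) b - b' with hB
  set W := trunc (box n) ω - ω' with hW
  have hBk : ∀ k ∈ box n, B k = b k - b' k := fun k hk => by
    rw [hB, Pi.sub_apply, trunc_of_mem b hk]
  have hWk : ∀ k ∈ box n, W k = ω k - ω' k := fun k hk => by
    rw [hW, Pi.sub_apply, trunc_of_mem ω hk]
  have hWS : ∀ k ∉ box n, W k = 0 := fun k hk => by
    rw [hW, Pi.sub_apply, trunc_of_notMem ω hk, hωS k hk, sub_zero]
  have hb2 : SobLe 2 b R := hb.of_le (by norm_num)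
  have hg : SobLe 2 (ω - b) (R + R) := hω.sub hb2
  have hgS : ∀ k ∉ box n, (ω' - b') k = 0 := fun k hk => by
    rw [Pi.sub_apply, hbS k hk, hωS k hk, sub_zero]
  have hp' : ∑ k ∈ box n, ‖B k‖ ^ 2 ≤ p ^ 2 :=
    (Finset.sum_congr rfl fun k hk => by rw [hBk k hk]).trans_le hp
  have hη' : ∑ k ∈ box n, ((jb k)⁻¹ * ‖W k‖) ^ 2 ≤ η ^ 2 :=
    (Finset.sum_congr rfl fun k hk => by rw [hWk k hk]).trans_le hη
  have hu' : SobLe 3 (bs (ω' - f)) (R + Φ) := (hω'.sub hd.sobLe_f).bs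
  -- The transported difference splits: W - B is advected, W by the H⁻¹ commutator and B as a
  -- forcing term.
  have hWB : trunc (box n) (ω - b) - (ω' - b') = W - B := by
    funext k
    by_cases hk : k ∈ box n
    · simp [hW, hB, trunc, hk]; ring
    · simp [hW, hB, trunc, hk]; ring
  set r : Freq → ℂ := advErr n f ω (ω - b) + adv uh (b - trunc (box n) b) with hr
  have hrS : SobLe 0 r (2 * (embConst * (R + (R + Φ)) * (R + R)) / n +
      2 * (embConst * U * R) / n) := by
    refine (sobLe_advErr hn hd.sobLe_f hω hg).add ((SobLe.adv (s := 0)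
      (hd.sobLe_uh.of_le (by norm_num)) (hb2.sub_trunc hn)).mono (le_of_eq ?_))
    ring
  have huh : ∀ k, adv uh b k - adv uh b' k =
      adv uh (b - trunc (box n) b) k + advF (box n) uh B k := by
    intro k
    have h0 := hd.sobLe_uh.of_le (Nat.zero_le 3)
    have h1 : SobLe 1 b R := hb.of_le (by norm_num)
    rw [adv_sub_right h0 h1 (h1.trunc _), adv_eq_advF hbS, hB, advF_sub_right,
      adv_eq_advF (fun k hk => trunc_of_notMem b hk)]
    change _ = (_ - advF (box n) uh (trunc (box n) b) k) + _
    ring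
  have hsplit : ∑ k ∈ box n, (jb k ^ 2)⁻¹ *
        ((starRingEnd ℂ) (ω k - ω' k) * (nlW uh f b ω k - nlW uh f b' ω' k)).re =
      ∑ k ∈ box n, (jb k ^ 2)⁻¹ * ((starRingEnd ℂ) (W k) * r k).re +
      ∑ k ∈ box n, (jb k ^ 2)⁻¹ *
        ((starRingEnd ℂ) (W k) * advF (box n) (bs W) (trunc (box n) (ω - b)) k).re +
      ∑ k ∈ box n, (jb k ^ 2)⁻¹ *
        ((starRingEnd ℂ) (W k) * advF (box n) (bs (ω' - f)) W k).re -
      ∑ k ∈ box n, (jb k ^ 2)⁻¹ *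
        ((starRingEnd ℂ) (W k) * advF (box n) (bs (ω' - f)) B k).re +
      ∑ k ∈ box n, (jb k ^ 2)⁻¹ * ((starRingEnd ℂ) (W k) * advF (box n) uh B k).re := by
    rw [← Finset.sum_add_distrib, ← Finset.sum_add_distrib, ← Finset.sum_sub_distrib,
      ← Finset.sum_add_distrib]
    refine Finset.sum_congr rfl fun k hk => ?_
    have e : nlW uh f b ω k - nlW uh f b' ω' k =
        r k + advF (box n) (bs W) (trunc (box n) (ω - b)) k + advF (box n) (bs (ω' - f)) W k -
          advF (box n) (bs (ω' - f)) B k + advF (box n) uh B k := by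
      have e1 := adv_sub_adv_eq (ω' := ω') hd.sobLe_f hω hg hgS k
      rw [hWB, advF_sub_right] at e1
      rw [nlW, nlW, Pi.add_apply, Pi.add_apply, hr, Pi.add_apply]
      linear_combination e1 + huh k
    rw [e, ← hWk k hk]
    simp only [mul_add, mul_sub, Complex.add_re, Complex.sub_re]
  have hw : ∀ k, 0 ≤ (jb k ^ 2)⁻¹ := fun k => inv_nonneg.2 (sq_nonneg _)
  have ha0 : ∀ k, 0 ≤ (jb k)⁻¹ * ‖W k‖ := fun k =>
    mul_nonneg (inv_nonneg.2 (jb_nonneg k)) (norm_nonneg _)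
  have hpair : ∀ (q : Freq → ℂ) {M : ℝ},
      ∑ k ∈ box n, (jb k)⁻¹ * ‖W k‖ * ((jb k)⁻¹ * ‖q k‖) ≤ M →
      |∑ k ∈ box n, (jb k ^ 2)⁻¹ * ((starRingEnd ℂ) (W k) * q k).re| ≤ M := by
    intro q M hq
    refine (abs_sum_re_mul_le _ _ _ hw).trans (le_trans (le_of_eq ?_) hq)
    refine Finset.sum_congr rfl fun k _ => ?_
    rw [← inv_pow]
    ring
  have t1 := hpair r (M := η * (2 * (embConst * (R + (R + Φ)) * (R + R)) / n +
      2 * (embConst * U * R) / n)) (by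
    refine le_trans (Finset.sum_le_sum fun k _ => ?_) (sum_mul_norm_le_of_sobLe hη0 hη' hrS)
    refine mul_le_mul_of_nonneg_left ?_ (ha0 k)
    exact mul_le_of_le_one_left (norm_nonneg _) (inv_le_one_of_one_le₀ (one_le_jb k)))
  -- The gradient of ω need not be bounded for ω in H², so the velocity difference cannot be handled
  -- in L² here. The divergence form in H⁻¹ needs only ω - b bounded, and this dictates the choice
  -- of norm for W.
  have t2 := hpair _ (sum_adv_neg_le_right (divFree_bs W) (A := box n) (L := box n) hη0 ha0 hη'
    (sobLe_bs_of_support hη0 hWS hη') (hg.trunc (box n)))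
  have t3 := abs_re_sum_neg_weight_le (divFree_bs (ω' - f)) (hω'H.sub hd.herm).bs hu' W hη0 hη'
  have t4 := hpair _ (sum_adv_neg_le_left (divFree_bs (ω' - f)) (A := box n) (L := box n) hη0 hp0
    ha0 hη' (hu'.of_le (by norm_num)) hp')
  have t5 := hpair _ (sum_adv_neg_le_left hd.divFree (A := box n) (L := box n) hη0 hp0
    ha0 hη' (hd.sobLe_uh.of_le (by norm_num)) hp')
  rw [hsplit]
  refine (abs_add_le _ _).trans (add_le_add ((abs_sub _ _).trans (add_le_add
    ((abs_add_le _ _).trans (add_le_add ((abs_add_le _ _).trans (add_le_add t1 t2)) t3)) t4)) t5)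

end Difference

/-! ### Gronwall's inequality and closeness to Galerkin solutions -/

/-- Linear Gronwall inequality from zero data. -/
theorem le_of_deriv_le_linear {E E' : ℝ → ℝ} {T C δ : ℝ} (hC : 0 ≤ C) (hδ : 0 ≤ δ)
    (hE : ∀ t ∈ Icc 0 T, HasDerivWithinAt E (E' t) (Icc 0 T) t) (h0 : E 0 = 0)
    (hb : ∀ t ∈ Icc 0 T, E' t ≤ C * E t + δ) {t : ℝ} (ht : t ∈ Icc 0 T) :
    E t ≤ δ * (T * Real.exp (C * T)) := by
  have h0T : (0 : ℝ) ∈ Icc 0 T := ⟨le_rfl, ht.1.trans ht.2⟩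
  have hd : ∀ s ∈ Icc 0 T, HasDerivWithinAt (fun s => δ * s - Real.exp (-(C * s)) * E s)
      (δ * 1 - (Real.exp (-(C * s)) * -(C * 1) * E s + Real.exp (-(C * s)) * E' s))
      (Icc 0 T) s := fun s hs =>
    ((hasDerivWithinAt_id s _).const_mul δ).sub
      ((((hasDerivWithinAt_id s _).const_mul C).fun_neg.exp).mul (hE s hs))
  have hmono : MonotoneOn (fun s => δ * s - Real.exp (-(C * s)) * E s) (Icc 0 T) := by
    refine monotoneOn_of_hasDerivWithinAt_nonneg (convex_Icc 0 T)
      (fun s hs => (hd s hs).continuousWithinAt)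
      (fun s hs => (hd s (interior_subset hs)).mono interior_subset) (fun s hs => ?_)
    have hs' := interior_subset hs
    have h1 := hb s hs'
    have hexp : Real.exp (-(C * s)) ≤ 1 :=
      Real.exp_le_one_iff.2 (neg_nonpos.2 (mul_nonneg hC hs'.1))
    have hp := Real.exp_pos (-(C * s))
    nlinarith [mul_le_mul_of_nonneg_left h1 hp.le, mul_le_mul_of_nonneg_right hexp hδ]
  have h1 := hmono h0T ht ht.1
  simp only [h0, mul_zero, sub_zero] at h1
  have h2 : Real.exp (-(C * t)) * E t ≤ δ * t := by linarith
  have h3 : E t = Real.exp (C * t) * (Real.exp (-(C * t)) * E t) := by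
    rw [← mul_assoc, ← Real.exp_add]; simp
  rw [h3]
  have hT : 0 ≤ T := h0T.2
  calc Real.exp (C * t) * (Real.exp (-(C * t)) * E t) ≤ Real.exp (C * t) * (δ * t) := by gcongr
    _ ≤ Real.exp (C * T) * (δ * T) := by
        have := ht.1
        have := ht.2
        gcongr
    _ = _ := by ring

/-- A solution of the modewise system on the set of modes `S`, bounded by `R` in `H³ × H²`. -/
structure ModeSol (S : Set Freq) (uh : Freq → Fin 2 → ℂ) (f : Freq → ℂ) (b ω : ℝ → Freq → ℂ)
    (T R : ℝ) : Prop where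
  herm_b : ∀ t ∈ Icc 0 T, Herm (b t)
  herm_ω : ∀ t ∈ Icc 0 T, Herm (ω t)
  supp_b : ∀ t ∈ Icc 0 T, ∀ k ∉ S, b t k = 0
  supp_ω : ∀ t ∈ Icc 0 T, ∀ k ∉ S, ω t k = 0
  sobLe_b : ∀ t ∈ Icc 0 T, SobLe 3 (b t) R
  sobLe_ω : ∀ t ∈ Icc 0 T, SobLe 2 (ω t) R
  deriv_b : ∀ t ∈ Icc 0 T, ∀ k ∈ S,
    HasDerivWithinAt (fun t => b t k) (-nlB f (b t) (ω t) k) (Icc 0 T) t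
  deriv_ω : ∀ t ∈ Icc 0 T, ∀ k ∈ S,
    HasDerivWithinAt (fun t => ω t k) (-nlW uh f (b t) (ω t) k) (Icc 0 T) t

theorem ModeSol.mono {S : Set Freq} {uh : Freq → Fin 2 → ℂ} {f : Freq → ℂ} {b ω : ℝ → Freq → ℂ}
    {T R R' : ℝ} (h : ModeSol S uh f b ω T R) (hR : R ≤ R') : ModeSol S uh f b ω T R' :=
  { h with
    sobLe_b := fun t ht => (h.sobLe_b t ht).mono hR
    sobLe_ω := fun t ht => (h.sobLe_ω t ht).mono hR }

/-- The exponential rate in the comparison estimate. -/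
def diffRate (U Φ R : ℝ) : ℝ := 2 + 20 * embConst * (R + (R + Φ) + U)

/-- The constant in the comparison estimate. -/
def diffConst (U Φ R T : ℝ) : ℝ :=
  100 * (embConst * (R + (R + Φ) + U) ^ 2) ^ 2 * (T * Real.exp (diffRate U Φ R * T))

/-- The arithmetic of the comparison estimate. -/
theorem diff_arith {n K R Φ U p η X Y : ℝ} (hn' : 0 < n) (hK : 0 ≤ K) (hU : 0 ≤ U) (hΦ : 0 ≤ Φ)
    (hR : 0 ≤ R) (hp0 : 0 ≤ p) (hη0 : 0 ≤ η)
    (dB : X ≤ p * (2 * (K * (R + (R + Φ)) * R) / n) + p * (2 * (η * (K * R))))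
    (dW : Y ≤ η * (2 * (K * (R + (R + Φ)) * (R + R)) / n + 2 * (K * U * R) / n) +
        η * (2 * (η * (K * (R + R)))) + 2 * (K * (R + Φ)) * η ^ 2 +
        η * (2 * (K * (R + Φ) * p)) + η * (2 * (K * U * p))) :
    2 * X + 2 * Y ≤ (2 + 20 * K * (R + (R + Φ) + U)) * (p ^ 2 + η ^ 2) +
      100 * (K * (R + (R + Φ) + U) ^ 2) ^ 2 / n ^ 2 := by
  -- A single size majorising all the norms that occur, so that every term becomes a multiple of K Z
  -- or of the error ε = K Z² / n.
  set Z := R + (R + Φ) + U with hZ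
  have hZ0 : 0 ≤ Z := by positivity
  have hKZ : 0 ≤ K * Z := by positivity
  have c1 : K * R ≤ K * Z := by gcongr; linarith
  have c2 : K * (R + Φ) ≤ K * Z := by gcongr; linarith
  have c3 : K * U ≤ K * Z := by gcongr; linarith
  have hε : 0 ≤ K * Z ^ 2 / n := by positivity
  have q1 : 2 * (K * (R + (R + Φ)) * R) / n ≤ 2 * (K * Z ^ 2 / n) := by
    rw [mul_div_assoc]
    have : K * (R + (R + Φ)) * R ≤ K * Z ^ 2 := by
      rw [mul_assoc, sq]; gcongr <;> linarith
    gcongr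
  have q2 : 2 * (K * (R + (R + Φ)) * (R + R)) / n + 2 * (K * U * R) / n ≤
      6 * (K * Z ^ 2 / n) := by
    rw [← add_div, ← mul_div_assoc]
    have a1 : K * (R + (R + Φ)) * (R + R) ≤ K * (Z * (2 * Z)) := by
      rw [mul_assoc]; gcongr <;> linarith
    have a2 : K * U * R ≤ K * (Z * Z) := by
      rw [mul_assoc]; gcongr <;> linarith
    gcongr
    nlinarith
  have f1 : p * (2 * (K * (R + (R + Φ)) * R) / n) ≤ p * (2 * (K * Z ^ 2 / n)) := by
    gcongr
  have f2 : p * (2 * (η * (K * R))) ≤ (p * η) * (2 * (K * Z)) := by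
    have : (p * η) * (2 * (K * R)) ≤ (p * η) * (2 * (K * Z)) := by gcongr
    linarith
  have f3 : η * (2 * (K * (R + (R + Φ)) * (R + R)) / n + 2 * (K * U * R) / n) ≤
      η * (6 * (K * Z ^ 2 / n)) := by gcongr
  have f4 : η * (2 * (η * (K * (R + R)))) ≤ η ^ 2 * (4 * (K * Z)) := by
    have : η ^ 2 * (4 * (K * R)) ≤ η ^ 2 * (4 * (K * Z)) := by gcongr
    linarith
  have f5 : 2 * (K * (R + Φ)) * η ^ 2 ≤ 2 * (K * Z) * η ^ 2 := by gcongr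
  have f6 : η * (2 * (K * (R + Φ) * p)) ≤ (p * η) * (2 * (K * Z)) := by
    have : (p * η) * (2 * (K * (R + Φ))) ≤ (p * η) * (2 * (K * Z)) := by gcongr
    linarith
  have f7 : η * (2 * (K * U * p)) ≤ (p * η) * (2 * (K * Z)) := by
    have : (p * η) * (2 * (K * U)) ≤ (p * η) * (2 * (K * Z)) := by gcongr
    linarith
  have g1 : (p * η) * (K * Z) ≤ (p ^ 2 + η ^ 2) / 2 * (K * Z) := by
    gcongr; nlinarith [sq_nonneg (p - η)]
  have hδ : 100 * (K * Z ^ 2) ^ 2 / n ^ 2 = 100 * (K * Z ^ 2 / n) ^ 2 := by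
    ring
  rw [hδ]
  generalize K * Z ^ 2 / n = ε at *
  have hKp : 0 ≤ K * Z * p ^ 2 := by positivity
  have hKη : 0 ≤ K * Z * η ^ 2 := by positivity
  -- The errors 4pε + 12ηε are at most p² + η² + 40ε², whence the constants 2 and 100; the cross
  -- terms contribute at most 18 K Z (p² + η²), whence 20.
  nlinarith [sq_nonneg (p - 2 * ε), sq_nonneg (η - 6 * ε)]

/-- A solution on many modes is close to the Galerkin solution with the same data. -/
theorem ModeSol.diff_le {uh : Freq → Fin 2 → ℂ} {f : Freq → ℂ} {U Φ : ℝ} (hd : IsData uh f U Φ)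
    {n : ℕ} (hn : 0 < n) {S : Set Freq} (hS : ↑(box n) ⊆ S) {b ω b' ω' : ℝ → Freq → ℂ} {T R : ℝ}
    (hx : ModeSol S uh f b ω T R) (hy : ModeSol (box n) uh f b' ω' T R)
    (hb0 : ∀ k ∈ box n, b 0 k = b' 0 k) (hω0 : ∀ k ∈ box n, ω 0 k = ω' 0 k)
    {t : ℝ} (ht : t ∈ Icc 0 T) :
    ∑ k ∈ box n, 1 * ‖b t k - b' t k‖ ^ 2 + ∑ k ∈ box n, (jb k ^ 2)⁻¹ * ‖ω t k - ω' t k‖ ^ 2 ≤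
      diffConst U Φ R T / n ^ 2 := by
  have hn' : (0 : ℝ) < n := by exact_mod_cast hn
  have hK := embConst_nonneg
  have hU := hd.sobLe_uh.1
  have hΦ := hd.sobLe_f.1
  have hR := (hx.sobLe_b t ht).1
  have hrate : 0 ≤ diffRate U Φ R := by unfold diffRate; positivity
  have hderiv : ∀ s ∈ Icc 0 T, HasDerivWithinAt (fun t =>
      ∑ k ∈ box n, 1 * ‖b t k - b' t k‖ ^ 2 + ∑ k ∈ box n, (jb k ^ 2)⁻¹ * ‖ω t k - ω' t k‖ ^ 2)
      (2 * ∑ k ∈ box n, 1 * ((starRingEnd ℂ) (b s k - b' s k) *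
          (-nlB f (b s) (ω s) k - -nlB f (b' s) (ω' s) k)).re +
        2 * ∑ k ∈ box n, (jb k ^ 2)⁻¹ * ((starRingEnd ℂ) (ω s k - ω' s k) *
          (-nlW uh f (b s) (ω s) k - -nlW uh f (b' s) (ω' s) k)).re) (Icc 0 T) s := by
    intro s hs
    refine HasDerivWithinAt.add ?_ ?_
    · exact hasDerivWithinAt_energy (x := fun t k => b t k - b' t k) (fun _ => 1) fun k hk =>
        (hx.deriv_b s hs k (hS hk)).sub (hy.deriv_b s hs k hk)
    · exact hasDerivWithinAt_energy (x := fun t k => ω t k - ω' t k) (fun k => (jb k ^ 2)⁻¹)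
        fun k hk => (hx.deriv_ω s hs k (hS hk)).sub (hy.deriv_ω s hs k hk)
  have hmain := le_of_deriv_le_linear (δ := 100 * (embConst * (R + (R + Φ) + U) ^ 2) ^ 2 / n ^ 2)
    hrate (by positivity) hderiv ?_ ?_ ht
  · refine hmain.trans (le_of_eq ?_)
    rw [diffConst]
    ring
  · have e1 : ∑ k ∈ box n, 1 * ‖b 0 k - b' 0 k‖ ^ 2 = 0 :=
      Finset.sum_eq_zero fun k hk => by rw [hb0 k hk, sub_self]; simp
    have e2 : ∑ k ∈ box n, (jb k ^ 2)⁻¹ * ‖ω 0 k - ω' 0 k‖ ^ 2 = 0 :=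
      Finset.sum_eq_zero fun k hk => by rw [hω0 k hk, sub_self]; simp
    simp only [e1, e2, add_zero]
  · intro s hs
    set P := ∑ k ∈ box n, 1 * ‖b s k - b' s k‖ ^ 2 with hP
    set H := ∑ k ∈ box n, (jb k ^ 2)⁻¹ * ‖ω s k - ω' s k‖ ^ 2 with hH
    have hP0 : 0 ≤ P := Finset.sum_nonneg fun _ _ => by positivity
    have hH0 : 0 ≤ H := Finset.sum_nonneg fun _ _ => by positivity
    have hp : ∑ k ∈ box n, ‖b s k - b' s k‖ ^ 2 ≤ √P ^ 2 := by
      rw [Real.sq_sqrt hP0, hP]; simp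
    have hη : ∑ k ∈ box n, ((jb k)⁻¹ * ‖ω s k - ω' s k‖) ^ 2 ≤ √H ^ 2 := by
      rw [Real.sq_sqrt hH0, hH]
      exact le_of_eq (Finset.sum_congr rfl fun k _ => by rw [mul_pow, inv_pow])
    have dB := diff_nlB_le hd hn (hx.sobLe_b s hs) (hx.sobLe_ω s hs) (hy.herm_ω s hs)
      (hy.supp_b s hs) (hy.supp_ω s hs) (Real.sqrt_nonneg P) (Real.sqrt_nonneg H) hp hη
    have dW := diff_nlW_le hd hn (hx.sobLe_b s hs) (hx.sobLe_ω s hs) (hy.sobLe_ω s hs)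
      (hy.herm_ω s hs) (hy.supp_b s hs) (hy.supp_ω s hs) (Real.sqrt_nonneg P) (Real.sqrt_nonneg H)
      hp hη
    have sB : ∑ k ∈ box n, 1 * ((starRingEnd ℂ) (b s k - b' s k) *
          (-nlB f (b s) (ω s) k - -nlB f (b' s) (ω' s) k)).re =
        -∑ k ∈ box n, ((starRingEnd ℂ) (b s k - b' s k) *
          (nlB f (b s) (ω s) k - nlB f (b' s) (ω' s) k)).re := by
      rw [← Finset.sum_neg_distrib]
      refine Finset.sum_congr rfl fun k _ => ?_
      rw [one_mul, ← Complex.neg_re]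
      congr 1
      ring
    have sW : ∑ k ∈ box n, (jb k ^ 2)⁻¹ * ((starRingEnd ℂ) (ω s k - ω' s k) *
          (-nlW uh f (b s) (ω s) k - -nlW uh f (b' s) (ω' s) k)).re =
        -∑ k ∈ box n, (jb k ^ 2)⁻¹ * ((starRingEnd ℂ) (ω s k - ω' s k) *
          (nlW uh f (b s) (ω s) k - nlW uh f (b' s) (ω' s) k)).re := by
      rw [← Finset.sum_neg_distrib]
      refine Finset.sum_congr rfl fun k _ => ?_
      rw [← mul_neg, ← Complex.neg_re]
      congr 2
      ring
    rw [sB, sW]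
    have eP : P = √P ^ 2 := (Real.sq_sqrt hP0).symm
    have eH : H = √H ^ 2 := (Real.sq_sqrt hH0).symm
    have hp0 := Real.sqrt_nonneg P
    have hη0 := Real.sqrt_nonneg H
    have dBn := (neg_le_abs _).trans dB
    have dWn := (neg_le_abs _).trans dW
    rw [eP, eH]
    generalize √P = p at *
    generalize √H = η at *
    exact diff_arith hn' hK hU hΦ hR hp0 hη0 dBn dWn

/-! ### The `𝓜`-norm on all modes -/

/-- The squared norms of the derivatives of `b` of order at most three and of the derivatives of
`ω` of order at most two. -/
def energyI (b ω : Freq → ℂ) : MultiIndex 3 ⊕ MultiIndex 2 → ℝ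
  | Sum.inl β => ∑' k, monM β k ^ 2 * ‖b k‖ ^ 2
  | Sum.inr β => ∑' k, monM β k ^ 2 * ‖ω k‖ ^ 2

/-- The norm of `𝓜` in terms of Fourier coefficients. -/
def normI (b ω : Freq → ℂ) : ℝ := ∑ i, √(energyI b ω i)

theorem sum_monM_le {s : ℕ} {x : Freq → ℂ} {R : ℝ} (h : SobLe s x R) (β : MultiIndex s)
    (F : Finset Freq) : ∑ k ∈ F, monM β k ^ 2 * ‖x k‖ ^ 2 ≤ R ^ 2 := by
  refine le_trans (Finset.sum_le_sum fun k _ => ?_) (h.2 F)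
  rw [mul_pow]
  refine mul_le_mul_of_nonneg_right ?_ (sq_nonneg _)
  rw [← sq_abs]
  exact pow_le_pow_left₀ (abs_nonneg _) (abs_monM_le β k) 2

theorem summable_monM {s : ℕ} {x : Freq → ℂ} {R : ℝ} (h : SobLe s x R) (β : MultiIndex s) :
    Summable fun k => monM β k ^ 2 * ‖x k‖ ^ 2 :=
  summable_of_sum_le (fun _ => by positivity) (sum_monM_le h β)

theorem tendsto_energyF {b ω : Freq → ℂ} {R R' : ℝ} (hb : SobLe 3 b R) (hω : SobLe 2 ω R')
    (i : MultiIndex 3 ⊕ MultiIndex 2) :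
    Filter.Tendsto (fun F => energyF F b ω i) Filter.atTop (nhds (energyI b ω i)) := by
  rcases i with β | β
  · exact (summable_monM hb β).hasSum
  · exact (summable_monM hω β).hasSum

theorem tendsto_normF {b ω : Freq → ℂ} {R R' : ℝ} (hb : SobLe 3 b R) (hω : SobLe 2 ω R') :
    Filter.Tendsto (fun F => normF F b ω) Filter.atTop (nhds (normI b ω)) :=
  tendsto_finsetSum _ fun i _ => (tendsto_energyF hb hω i).sqrt

theorem energyF_mono {F G : Finset Freq} (h : F ⊆ G) (b ω : Freq → ℂ)
    (i : MultiIndex 3 ⊕ MultiIndex 2) : energyF F b ω i ≤ energyF G b ω i := by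
  rcases i with β | β <;>
  exact Finset.sum_le_sum_of_subset_of_nonneg h fun _ _ _ => by positivity

theorem normF_mono {F G : Finset Freq} (h : F ⊆ G) (b ω : Freq → ℂ) :
    normF F b ω ≤ normF G b ω :=
  Finset.sum_le_sum fun i _ => Real.sqrt_le_sqrt (energyF_mono h b ω i)

theorem energyF_le_energyI {b ω : Freq → ℂ} {R R' : ℝ} (hb : SobLe 3 b R) (hω : SobLe 2 ω R')
    (F : Finset Freq) (i : MultiIndex 3 ⊕ MultiIndex 2) : energyF F b ω i ≤ energyI b ω i :=
  ge_of_tendsto (tendsto_energyF hb hω i)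
    ((Filter.eventually_ge_atTop F).mono fun _ h => energyF_mono h b ω i)

theorem normF_le_normI {b ω : Freq → ℂ} {R R' : ℝ} (hb : SobLe 3 b R) (hω : SobLe 2 ω R')
    (F : Finset Freq) : normF F b ω ≤ normI b ω :=
  ge_of_tendsto (tendsto_normF hb hω)
    ((Filter.eventually_ge_atTop F).mono fun _ h => normF_mono h b ω)

theorem energyF_trunc (F : Finset Freq) (b ω : Freq → ℂ) (i : MultiIndex 3 ⊕ MultiIndex 2) :
    energyF F (trunc F b) (trunc F ω) i = energyF F b ω i := by
  rcases i with β | β <;>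
  exact Finset.sum_congr rfl fun k hk => by rw [trunc_of_mem _ hk]

theorem normF_trunc (F : Finset Freq) (b ω : Freq → ℂ) :
    normF F (trunc F b) (trunc F ω) = normF F b ω :=
  Finset.sum_congr rfl fun i _ => by rw [energyF_trunc]

theorem normI_nonneg (b ω : Freq → ℂ) : 0 ≤ normI b ω :=
  Finset.sum_nonneg fun _ _ => Real.sqrt_nonneg _

theorem Herm.trunc {g : Freq → ℂ} (hg : Herm g) (n : ℕ) : Herm (trunc (box n) g) := fun k => by
  by_cases hk : k ∈ box n
  · rw [trunc_of_mem g hk, trunc_of_mem g (neg_mem_box.2 hk), hg k]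
  · rw [trunc_of_notMem g hk, trunc_of_notMem g (fun h => hk (neg_mem_box.1 h)), map_zero]

/-- The lower bound of `1 / (1 + ‖·‖²)` on `[0, T]` provided by the a priori estimate. -/
def gap (U Φ : ℝ) (b ω : Freq → ℂ) (T : ℝ) : ℝ := (1 + normI b ω ^ 2)⁻¹ - riccati U Φ * T

theorem riccati_nonneg {U Φ : ℝ} (hU : 0 ≤ U) (hΦ : 0 ≤ Φ) : 0 ≤ riccati U Φ :=
  mul_nonneg (Nat.cast_nonneg _) (rate_nonneg hU hΦ)

theorem le_inv_of_le_inv_one_add_sq {δ N : ℝ} (hδ : 0 < δ) (h : δ ≤ (1 + N ^ 2)⁻¹) :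
    N ≤ δ⁻¹ := by
  have h3 : 1 + N ^ 2 ≤ δ⁻¹ := by
    rw [le_inv_comm₀ (by positivity) hδ]; exact h
  nlinarith [sq_nonneg (N - 1)]

/-- The Galerkin approximations with their uniform bounds. -/
theorem exists_galerkin_seq {uh : Freq → Fin 2 → ℂ} {f : Freq → ℂ} {U Φ : ℝ}
    (hd : IsData uh f U Φ) {b₀ ω₀ : Freq → ℂ} (hHb : Herm b₀) (hHω : Herm ω₀) {R₁ R₂ T : ℝ}
    (hb : SobLe 3 b₀ R₁) (hω : SobLe 2 ω₀ R₂) (hT : 0 ≤ T) (hgap : 0 < gap U Φ b₀ ω₀ T) :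
    ∃ b ω : ℕ → ℝ → Freq → ℂ, ∀ n,
      ModeSol (box n) uh f (b n) (ω n) T (9 * (gap U Φ b₀ ω₀ T)⁻¹) ∧
      b n 0 = trunc (box n) b₀ ∧ ω n 0 = trunc (box n) ω₀ ∧
      (∀ t ∈ Icc 0 T, gap U Φ b₀ ω₀ t ≤ (1 + normF (box n) (b n t) (ω n t) ^ 2)⁻¹) ∧
      ∀ i, ∀ t ∈ Icc 0 T, √(energyF (box n) (b n t) (ω n t) i) ≤
        √(energyI b₀ ω₀ i) + rate U Φ * (1 + (gap U Φ b₀ ω₀ T)⁻¹ ^ 2) * t := by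
  have hricc : 0 ≤ riccati U Φ := riccati_nonneg hd.sobLe_uh.1 hd.sobLe_f.1
  -- Truncation does not increase the 𝓜-norm, so the gap of the full data, and with it the time T,
  -- serves every n.
  have hN : ∀ n, (1 + normI b₀ ω₀ ^ 2)⁻¹ ≤
      (1 + normF (box n) (trunc (box n) b₀) (trunc (box n) ω₀) ^ 2)⁻¹ := fun n => by
    rw [normF_trunc]
    have h1 := normF_le_normI hb hω (box n)
    have h2 := normF_nonneg (box n) b₀ ω₀
    gcongr
  have key : ∀ n, ∃ bω : (ℝ → Freq → ℂ) × (ℝ → Freq → ℂ),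
      ModeSol (box n) uh f bω.1 bω.2 T (9 * (gap U Φ b₀ ω₀ T)⁻¹) ∧
      bω.1 0 = trunc (box n) b₀ ∧ bω.2 0 = trunc (box n) ω₀ ∧
      (∀ t ∈ Icc 0 T, gap U Φ b₀ ω₀ t ≤ (1 + normF (box n) (bω.1 t) (bω.2 t) ^ 2)⁻¹) ∧
      ∀ i, ∀ t ∈ Icc 0 T, √(energyF (box n) (bω.1 t) (bω.2 t) i) ≤
        √(energyI b₀ ω₀ i) + rate U Φ * (1 + (gap U Φ b₀ ω₀ T)⁻¹ ^ 2) * t := by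
    intro n
    obtain ⟨b, ω, hb0, hω0, hH, hS, hdb, hdω⟩ := exists_galerkin hd
      (S := box n) (fun k hk => neg_mem_box.2 hk) (hHb.trunc n) (hHω.trunc n)
      (fun k hk => trunc_of_notMem b₀ hk) (fun k hk => trunc_of_notMem ω₀ hk) hT
      (by have := hN n; unfold gap at hgap; linarith)
    have hap := galerkin_apriori hd (θ := fun _ => 1) (S := box n) (b := b) (ω := ω) (T := T)
      (fun _ => ⟨zero_le_one, le_rfl⟩) (fun t ht => (hH t ht).2) (fun t _ k hk => (hS t k hk).1)
      (fun t _ k hk => (hS t k hk).2)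
      (fun t ht k hk => by simpa using hdb t ht k hk)
      (fun t ht k hk => by simpa using hdω t ht k hk)
    rw [hb0, hω0] at hap
    have hgt : ∀ t ∈ Icc 0 T, gap U Φ b₀ ω₀ t ≤ (1 + normF (box n) (b t) (ω t) ^ 2)⁻¹ :=
      fun t ht => by
        have h1 := hap.1 t ht
        have h2 := hN n
        unfold gap
        linarith
    have hle : ∀ t ∈ Icc 0 T, normF (box n) (b t) (ω t) ≤ (gap U Φ b₀ ω₀ T)⁻¹ := fun t ht => by
      refine le_inv_of_le_inv_one_add_sq hgap (le_trans ?_ (hgt t ht))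
      have := mul_le_mul_of_nonneg_left ht.2 hricc
      unfold gap
      linarith
    refine ⟨(b, ω), ⟨fun t ht => (hH t ht).1, fun t ht => (hH t ht).2,
      fun t _ k hk => (hS t k hk).1, fun t _ k hk => (hS t k hk).2,
      fun t ht => ?_, fun t ht => ?_, hdb, hdω⟩, hb0, hω0, hgt, fun i t ht => ?_⟩
    · exact (sobLe_fst_of_normF (ω := ω t) fun k hk => (hS t k hk).1).mono
        (mul_le_mul_of_nonneg_left (hle t ht) (by norm_num))
    · exact (sobLe_snd_of_normF (b := b t) fun k hk => (hS t k hk).2).mono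
        (mul_le_mul_of_nonneg_left (hle t ht) (by norm_num))
    · have h1 := hap.2 _ hle i t ht
      rw [energyF_trunc] at h1
      have h2 := Real.sqrt_le_sqrt (energyF_le_energyI hb hω (box n) i)
      simp only
      linarith
  choose bω h using key
  exact ⟨fun n => (bω n).1, fun n => (bω n).2, h⟩

/-! ### Passage to the limit -/

/-- Mode by mode closeness to the Galerkin solution. -/
theorem ModeSol.mode_close {uh : Freq → Fin 2 → ℂ} {f : Freq → ℂ} {U Φ : ℝ}
    (hd : IsData uh f U Φ) {n : ℕ} (hn : 0 < n) {S : Set Freq} (hS : ↑(box n) ⊆ S)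
    {b ω b' ω' : ℝ → Freq → ℂ} {T R : ℝ}
    (hx : ModeSol S uh f b ω T R) (hy : ModeSol (box n) uh f b' ω' T R)
    (hb0 : ∀ k ∈ box n, b 0 k = b' 0 k) (hω0 : ∀ k ∈ box n, ω 0 k = ω' 0 k)
    {t : ℝ} (ht : t ∈ Icc 0 T) {k : Freq} (hk : k ∈ box n) :
    ‖b t k - b' t k‖ ≤ √(diffConst U Φ R T) * jb k / n ∧
      ‖ω t k - ω' t k‖ ≤ √(diffConst U Φ R T) * jb k / n := by
  have hn' : (0 : ℝ) < n := by exact_mod_cast hn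
  have hsum := hx.diff_le hd hn hS hy hb0 hω0 ht
  have hT : 0 ≤ T := ht.1.trans ht.2
  have hD : 0 ≤ diffConst U Φ R T := by
    unfold diffConst
    positivity
  have h1 : 1 * ‖b t k - b' t k‖ ^ 2 ≤ ∑ k ∈ box n, 1 * ‖b t k - b' t k‖ ^ 2 :=
    Finset.single_le_sum (f := fun k => 1 * ‖b t k - b' t k‖ ^ 2) (fun _ _ => by positivity) hk
  have h2 : (jb k ^ 2)⁻¹ * ‖ω t k - ω' t k‖ ^ 2 ≤
      ∑ k ∈ box n, (jb k ^ 2)⁻¹ * ‖ω t k - ω' t k‖ ^ 2 :=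
    Finset.single_le_sum (f := fun k => (jb k ^ 2)⁻¹ * ‖ω t k - ω' t k‖ ^ 2)
      (fun _ _ => by positivity) hk
  have h1' : 0 ≤ ∑ k ∈ box n, 1 * ‖b t k - b' t k‖ ^ 2 :=
    Finset.sum_nonneg fun _ _ => by positivity
  have h2' : 0 ≤ ∑ k ∈ box n, (jb k ^ 2)⁻¹ * ‖ω t k - ω' t k‖ ^ 2 :=
    Finset.sum_nonneg fun _ _ => by positivity
  have hj := one_le_jb k
  have hj0 := jb_pos k
  have hsq : (√(diffConst U Φ R T) * jb k / n) ^ 2 = diffConst U Φ R T / n ^ 2 * jb k ^ 2 := by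
    rw [div_pow, mul_pow, Real.sq_sqrt hD]
    ring
  have hq : 0 ≤ diffConst U Φ R T / (n : ℝ) ^ 2 := by positivity
  constructor
  · refine abs_le_of_sq_le_sq' ?_ (by positivity) |>.2
    rw [hsq]
    -- For b the factor ⟨k⟩ is superfluous; it is kept so that both components share one bound. For
    -- ω it is the price of the H⁻¹ weight.
    nlinarith [mul_le_mul hj hj zero_le_one hj0.le]
  · refine abs_le_of_sq_le_sq' ?_ (by positivity) |>.2
    rw [hsq, ← div_le_iff₀ (by positivity), div_eq_inv_mul]
    linarith

theorem hasDerivWithinAt_of_integral {y q : ℝ → ℂ} {T : ℝ} {y₀ : ℂ} (hq : ContinuousOn q (Icc 0 T))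
    (hy : ∀ t ∈ Icc 0 T, y t = y₀ + ∫ s in (0 : ℝ)..t, q s) {t : ℝ} (ht : t ∈ Icc 0 T) :
    HasDerivWithinAt y (q t) (Icc 0 T) t := by
  have : Fact (t ∈ Icc 0 T) := ⟨ht⟩
  have h0T : (0 : ℝ) ∈ Icc 0 T := ⟨le_rfl, ht.1.trans ht.2⟩
  have h := intervalIntegral.integral_hasDerivWithinAt_right (a := 0) (s := Icc 0 T)
    (hq.mono (uIcc_subset_Icc h0T ht)).intervalIntegrable
    (hq.stronglyMeasurableAtFilter_nhdsWithin measurableSet_Icc t) (hq t ht)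
  exact (h.const_add y₀).congr hy (hy t ht)

theorem integral_of_hasDerivWithinAt {E : Type*} [NormedAddCommGroup E] [NormedSpace ℝ E]
    [CompleteSpace E] {y q : ℝ → E} {T : ℝ} (hq : ContinuousOn q (Icc 0 T))
    (hy : ∀ t ∈ Icc 0 T, HasDerivWithinAt y (q t) (Icc 0 T) t) {t : ℝ} (ht : t ∈ Icc 0 T) :
    y t = y 0 + ∫ s in (0 : ℝ)..t, q s := by
  have hsub : Icc 0 t ⊆ Icc 0 T := Icc_subset_Icc_right ht.2
  rw [intervalIntegral.integral_eq_sub_of_hasDerivAt_of_le ht.1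
    (fun s hs => (hy s (hsub hs)).continuousWithinAt.mono hsub)
    (fun s hs => (hy s (hsub (Ioo_subset_Icc_self hs))).hasDerivAt
      (Icc_mem_nhds hs.1 (hs.2.trans_le ht.2)))
    ((hq.mono hsub).intervalIntegrable_of_Icc ht.1)]
  abel

/-- A uniformly convergent sequence of curves. -/
theorem exists_limit_curve {y : ℕ → ℝ → ℂ} {T C : ℝ} {N₀ : ℕ}
    (hclose : ∀ n ≥ N₀, ∀ m ≥ n, ∀ t ∈ Icc 0 T, ‖y m t - y n t‖ ≤ C / n)
    (hcont : ∀ n ≥ N₀, ContinuousOn (y n) (Icc 0 T)) :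
    ∃ z : ℝ → ℂ, (∀ t ∈ Icc 0 T, Filter.Tendsto (fun n => y n t) Filter.atTop (nhds (z t))) ∧
      ContinuousOn z (Icc 0 T) := by
  have hC : Filter.Tendsto (fun n : ℕ => C / n) Filter.atTop (nhds 0) :=
    tendsto_const_div_atTop_nhds_zero_nat C
  have hcau : ∀ t ∈ Icc 0 T, ∃ z, Filter.Tendsto (fun n => y n t) Filter.atTop (nhds z) := by
    intro t ht
    refine cauchySeq_tendsto_of_complete (Metric.cauchySeq_iff'.2 fun ε hε => ?_)
    obtain ⟨n, hn, hn0⟩ := ((hC.eventually (gt_mem_nhds hε)).and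
      (Filter.eventually_ge_atTop N₀)).exists
    exact ⟨n, fun m hm => by rw [dist_eq_norm]; exact (hclose n hn0 m hm t ht).trans_lt hn⟩
  choose! z hz using hcau
  refine ⟨z, hz, ?_⟩
  have hunif : TendstoUniformlyOn y z Filter.atTop (Icc 0 T) := by
    rw [Metric.tendstoUniformlyOn_iff]
    intro ε hε
    filter_upwards [hC.eventually (gt_mem_nhds hε), Filter.eventually_ge_atTop N₀] with n hn hn0 t ht
    refine lt_of_le_of_lt ?_ hn
    rw [dist_eq_norm]
    refine le_of_tendsto (((hz t ht).sub_const (y n t)).norm) ?_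
    filter_upwards [Filter.eventually_ge_atTop n] with m hm using hclose n hn0 m hm t ht
  exact hunif.continuousOn ((Filter.eventually_ge_atTop N₀).mono hcont).frequently

/-- Limits of solutions of scalar differential equations with bounded right-hand sides. -/
theorem hasDerivWithinAt_limit {y q : ℕ → ℝ → ℂ} {z p : ℝ → ℂ} {T M : ℝ} {N₀ : ℕ}
    (hyz : ∀ t ∈ Icc 0 T, Filter.Tendsto (fun n => y n t) Filter.atTop (nhds (z t)))
    (hy : ∀ n ≥ N₀, ∀ t ∈ Icc 0 T, HasDerivWithinAt (y n) (q n t) (Icc 0 T) t)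
    (hqc : ∀ n ≥ N₀, ContinuousOn (q n) (Icc 0 T))
    (hqM : ∀ n ≥ N₀, ∀ t ∈ Icc 0 T, ‖q n t‖ ≤ M)
    (hqp : ∀ t ∈ Icc 0 T, Filter.Tendsto (fun n => q n t) Filter.atTop (nhds (p t)))
    (hp : ContinuousOn p (Icc 0 T)) {t : ℝ} (ht : t ∈ Icc 0 T) :
    HasDerivWithinAt z (p t) (Icc 0 T) t := by
  -- The limit is taken in the integrated equation by dominated convergence; continuity of the
  -- limiting right-hand side then returns the derivative.
  refine hasDerivWithinAt_of_integral (y₀ := z 0) hp (fun s hs => ?_) ht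
  have h0T : (0 : ℝ) ∈ Icc 0 T := ⟨le_rfl, hs.1.trans hs.2⟩
  have hsub : Set.uIoc (0 : ℝ) s ⊆ Icc 0 T :=
    uIoc_subset_uIcc.trans (uIcc_subset_Icc h0T hs)
  have hinteg : Filter.Tendsto (fun n => ∫ r in (0 : ℝ)..s, q n r) Filter.atTop
      (nhds (∫ r in (0 : ℝ)..s, p r)) := by
    refine intervalIntegral.tendsto_integral_filter_of_dominated_convergence (fun _ => M) ?_ ?_
      intervalIntegrable_const ?_
    · filter_upwards [Filter.eventually_ge_atTop N₀] with n hn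
      exact ((hqc n hn).mono hsub).aestronglyMeasurable measurableSet_uIoc
    · filter_upwards [Filter.eventually_ge_atTop N₀] with n hn
      exact Filter.Eventually.of_forall fun r hr => hqM n hn r (hsub hr)
    · exact Filter.Eventually.of_forall fun r hr => hqp r (hsub hr)
  refine tendsto_nhds_unique (hyz s hs) (Filter.Tendsto.congr' ?_ ((hyz 0 h0T).add hinteg))
  filter_upwards [Filter.eventually_ge_atTop N₀] with n hn
  exact (integral_of_hasDerivWithinAt (hqc n hn) (hy n hn) hs).symm

section Limits

variable {uh : Freq → Fin 2 → ℂ} {f : Freq → ℂ} {U Φ R : ℝ}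

theorem tendsto_nlB (hd : IsData uh f U Φ) {ι : Type*} {l : Filter ι} [l.NeBot]
    {b ω : ι → Freq → ℂ} {b' ω' : Freq → ℂ} (hb : ∀ᶠ i in l, SobLe 3 (b i) R)
    (hω : ∀ᶠ i in l, SobLe 2 (ω i) R)
    (hbb : ∀ k, Filter.Tendsto (fun i => b i k) l (nhds (b' k)))
    (hωω : ∀ k, Filter.Tendsto (fun i => ω i k) l (nhds (ω' k))) (k : Freq) :
    Filter.Tendsto (fun i => nlB f (b i) (ω i) k) l (nhds (nlB f b' ω' k)) :=
  tendsto_adv (V := R + Φ) (G := R)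
    (hω.mono fun _ h => ((h.sub hd.sobLe_f).bs).of_le (Nat.zero_le _))
    (hb.mono fun _ h => h.of_le (by norm_num))
    (tendsto_bs fun k => (hωω k).sub_const _) hbb k

theorem tendsto_nlW (hd : IsData uh f U Φ) {ι : Type*} {l : Filter ι} [l.NeBot]
    {b ω : ι → Freq → ℂ} {b' ω' : Freq → ℂ} (hb : ∀ᶠ i in l, SobLe 3 (b i) R)
    (hω : ∀ᶠ i in l, SobLe 2 (ω i) R)
    (hbb : ∀ k, Filter.Tendsto (fun i => b i k) l (nhds (b' k)))
    (hωω : ∀ k, Filter.Tendsto (fun i => ω i k) l (nhds (ω' k))) (k : Freq) :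
    Filter.Tendsto (fun i => nlW uh f (b i) (ω i) k) l (nhds (nlW uh f b' ω' k)) := by
  refine Filter.Tendsto.add (tendsto_adv (V := R + Φ) (G := R + R)
    (hω.mono fun _ h => ((h.sub hd.sobLe_f).bs).of_le (Nat.zero_le _)) ?_
    (tendsto_bs fun k => (hωω k).sub_const _) (fun k => (hωω k).sub (hbb k)) k)
    (tendsto_adv (V := U) (G := R) (Filter.Eventually.of_forall fun _ =>
      hd.sobLe_uh.of_le (Nat.zero_le 3)) (hb.mono fun _ h => h.of_le (by norm_num))
      (fun _ => tendsto_const_nhds) hbb k)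
  filter_upwards [hb, hω] with i h1 h2 using h2.sub (h1.of_le (by norm_num))

theorem continuousOn_nlB (hd : IsData uh f U Φ) {b ω : ℝ → Freq → ℂ} {J : Set ℝ}
    (hb : ∀ t ∈ J, SobLe 3 (b t) R) (hω : ∀ t ∈ J, SobLe 2 (ω t) R)
    (hbc : ∀ k, ContinuousOn (fun t => b t k) J) (hωc : ∀ k, ContinuousOn (fun t => ω t k) J)
    (k : Freq) : ContinuousOn (fun t => nlB f (b t) (ω t) k) J := fun t ht => by
  have : (nhdsWithin t J).NeBot := mem_closure_iff_nhdsWithin_neBot.1 (subset_closure ht)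
  exact tendsto_nlB hd (Filter.eventually_of_mem self_mem_nhdsWithin hb)
    (Filter.eventually_of_mem self_mem_nhdsWithin hω) (fun k => hbc k t ht)
    (fun k => hωc k t ht) k

theorem continuousOn_nlW (hd : IsData uh f U Φ) {b ω : ℝ → Freq → ℂ} {J : Set ℝ}
    (hb : ∀ t ∈ J, SobLe 3 (b t) R) (hω : ∀ t ∈ J, SobLe 2 (ω t) R)
    (hbc : ∀ k, ContinuousOn (fun t => b t k) J) (hωc : ∀ k, ContinuousOn (fun t => ω t k) J)
    (k : Freq) : ContinuousOn (fun t => nlW uh f (b t) (ω t) k) J := fun t ht => by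
  have : (nhdsWithin t J).NeBot := mem_closure_iff_nhdsWithin_neBot.1 (subset_closure ht)
  exact tendsto_nlW hd (Filter.eventually_of_mem self_mem_nhdsWithin hb)
    (Filter.eventually_of_mem self_mem_nhdsWithin hω) (fun k => hbc k t ht)
    (fun k => hωc k t ht) k

theorem sobLe_nlB (hd : IsData uh f U Φ) {b ω : Freq → ℂ} (hb : SobLe 3 b R) (hω : SobLe 2 ω R) :
    SobLe 1 (nlB f b ω) (2 ^ 2 * (embConst * (R + Φ) * R)) :=
  SobLe.adv (hω.sub hd.sobLe_f).bs (hb.of_le (by norm_num))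

theorem sobLe_nlW (hd : IsData uh f U Φ) {b ω : Freq → ℂ} (hb : SobLe 3 b R) (hω : SobLe 2 ω R) :
    SobLe 1 (nlW uh f b ω) (2 ^ 2 * (embConst * (R + Φ) * (R + R)) + 2 ^ 2 * (embConst * U * R)) :=
  (SobLe.adv (hω.sub hd.sobLe_f).bs (hω.sub (hb.of_le (by norm_num)))).add
    (SobLe.adv hd.sobLe_uh (hb.of_le (by norm_num)))

theorem ModeSol.continuousOn_b {S : Set Freq} {b ω : ℝ → Freq → ℂ} {T : ℝ}
    (h : ModeSol S uh f b ω T R) (k : Freq) : ContinuousOn (fun t => b t k) (Icc 0 T) := by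
  by_cases hk : k ∈ S
  · exact fun t ht => (h.deriv_b t ht k hk).continuousWithinAt
  · exact continuousOn_const.congr fun t ht => h.supp_b t ht k hk

theorem ModeSol.continuousOn_ω {S : Set Freq} {b ω : ℝ → Freq → ℂ} {T : ℝ}
    (h : ModeSol S uh f b ω T R) (k : Freq) : ContinuousOn (fun t => ω t k) (Icc 0 T) := by
  by_cases hk : k ∈ S
  · exact fun t ht => (h.deriv_ω t ht k hk).continuousWithinAt
  · exact continuousOn_const.congr fun t ht => h.supp_ω t ht k hk

end Limits

theorem tendsto_energyF_of_modes {ι : Type*} {l : Filter ι} {b ω : ι → Freq → ℂ}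
    {b' ω' : Freq → ℂ} (hb : ∀ k, Filter.Tendsto (fun i => b i k) l (nhds (b' k)))
    (hω : ∀ k, Filter.Tendsto (fun i => ω i k) l (nhds (ω' k))) (F : Finset Freq)
    (i : MultiIndex 3 ⊕ MultiIndex 2) :
    Filter.Tendsto (fun j => energyF F (b j) (ω j) i) l (nhds (energyF F b' ω' i)) := by
  rcases i with β | β
  · exact tendsto_finsetSum _ fun k _ => ((hb k).norm.pow 2).const_mul _
  · exact tendsto_finsetSum _ fun k _ => ((hω k).norm.pow 2).const_mul _

theorem exists_box_superset (F : Finset Freq) : ∀ᶠ n in Filter.atTop, F ⊆ box n := by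
  have : ∀ᶠ n in Filter.atTop, ∀ k ∈ F, k ∈ box n :=
    (Filter.eventually_all_finset F).2 fun k _ => eventually_mem_box k
  exact this

/-- Existence, uniqueness and bounds for the full modewise system. -/
theorem exists_modeSol {uh : Freq → Fin 2 → ℂ} {f : Freq → ℂ} {U Φ : ℝ}
    (hd : IsData uh f U Φ) {b₀ ω₀ : Freq → ℂ} (hHb : Herm b₀) (hHω : Herm ω₀) {R₁ R₂ T : ℝ}
    (hb : SobLe 3 b₀ R₁) (hω : SobLe 2 ω₀ R₂) (hT : 0 ≤ T) (hgap : 0 < gap U Φ b₀ ω₀ T) :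
    ∃ b ω : ℝ → Freq → ℂ, ModeSol univ uh f b ω T (9 * (gap U Φ b₀ ω₀ T)⁻¹) ∧
      b 0 = b₀ ∧ ω 0 = ω₀ ∧
      (∀ t ∈ Icc 0 T, gap U Φ b₀ ω₀ t ≤ (1 + normI (b t) (ω t) ^ 2)⁻¹) ∧
      (∀ i, ∀ t ∈ Icc 0 T, √(energyI (b t) (ω t) i) ≤
        √(energyI b₀ ω₀ i) + rate U Φ * (1 + (gap U Φ b₀ ω₀ T)⁻¹ ^ 2) * t) ∧
      ∀ R' b' ω', ModeSol univ uh f b' ω' T R' → b' 0 = b₀ → ω' 0 = ω₀ →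
        ∀ t ∈ Icc 0 T, b' t = b t ∧ ω' t = ω t := by
  obtain ⟨y, w, hyw⟩ := exists_galerkin_seq hd hHb hHω hb hω hT hgap
  have h0T : (0 : ℝ) ∈ Icc 0 T := ⟨le_rfl, hT⟩
  set R := 9 * (gap U Φ b₀ ω₀ T)⁻¹ with hR
  have hsol : ∀ n, ModeSol (box n) uh f (y n) (w n) T R := fun n => (hyw n).1
  have hinit : ∀ n, ∀ k ∈ box n, y n 0 k = b₀ k ∧ w n 0 k = ω₀ k := fun n k hk => by
    rw [(hyw n).2.1, (hyw n).2.2.1, trunc_of_mem _ hk, trunc_of_mem _ hk]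
    exact ⟨rfl, rfl⟩
  have hN0 : ∀ k : Freq, ∃ N₀ : ℕ, 0 < N₀ ∧ ∀ n ≥ N₀, k ∈ box n := fun k => by
    obtain ⟨N, hN⟩ := Filter.eventually_atTop.1 (eventually_mem_box k)
    exact ⟨N + 1, Nat.succ_pos _, fun n hn => hN n (by omega)⟩
  -- A Galerkin solution on the larger box is itself a solution on more modes, so the comparison
  -- makes each mode uniformly Cauchy in time.
  have hclose : ∀ (k : Freq) (n m : ℕ), 0 < n → n ≤ m → k ∈ box n → ∀ t ∈ Icc 0 T,
      ‖y m t k - y n t k‖ ≤ √(diffConst U Φ R T) * jb k / n ∧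
      ‖w m t k - w n t k‖ ≤ √(diffConst U Φ R T) * jb k / n := by
    intro k n m hn hnm hk t ht
    exact (hsol m).mode_close hd hn (by exact_mod_cast box_mono hnm) (hsol n)
      (fun k hk => by rw [(hinit n k hk).1, (hinit m k (box_mono hnm hk)).1])
      (fun k hk => by rw [(hinit n k hk).2, (hinit m k (box_mono hnm hk)).2]) ht hk
  have hexb : ∀ k, ∃ z : ℝ → ℂ, (∀ t ∈ Icc 0 T,
      Filter.Tendsto (fun n => y n t k) Filter.atTop (nhds (z t))) ∧ ContinuousOn z (Icc 0 T) := by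
    intro k
    obtain ⟨N₀, hN, hk⟩ := hN0 k
    exact exists_limit_curve (N₀ := N₀)
      (fun n hn m hm t ht => (hclose k n m (by omega) hm (hk n hn) t ht).1)
      (fun n _ => (hsol n).continuousOn_b k)
  have hexw : ∀ k, ∃ z : ℝ → ℂ, (∀ t ∈ Icc 0 T,
      Filter.Tendsto (fun n => w n t k) Filter.atTop (nhds (z t))) ∧ ContinuousOn z (Icc 0 T) := by
    intro k
    obtain ⟨N₀, hN, hk⟩ := hN0 k
    exact exists_limit_curve (N₀ := N₀)
      (fun n hn m hm t ht => (hclose k n m (by omega) hm (hk n hn) t ht).2)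
      (fun n _ => (hsol n).continuousOn_ω k)
  choose zb hzb hzbc using hexb
  choose zw hzw hzwc using hexw
  set b : ℝ → Freq → ℂ := fun t k => zb k t with hbdef
  set ω : ℝ → Freq → ℂ := fun t k => zw k t with hωdef
  have hlb : ∀ t ∈ Icc 0 T, ∀ k, Filter.Tendsto (fun n => y n t k) Filter.atTop (nhds (b t k)) :=
    fun t ht k => hzb k t ht
  have hlw : ∀ t ∈ Icc 0 T, ∀ k, Filter.Tendsto (fun n => w n t k) Filter.atTop (nhds (ω t k)) :=
    fun t ht k => hzw k t ht
  have hSb : ∀ t ∈ Icc 0 T, SobLe 3 (b t) R := fun t ht =>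
    SobLe.of_tendsto (Filter.Eventually.of_forall fun n => (hsol n).sobLe_b t ht) (hlb t ht)
  have hSw : ∀ t ∈ Icc 0 T, SobLe 2 (ω t) R := fun t ht =>
    SobLe.of_tendsto (Filter.Eventually.of_forall fun n => (hsol n).sobLe_ω t ht) (hlw t ht)
  have hherm : ∀ {x : ℕ → Freq → ℂ} {z : Freq → ℂ}, (∀ n, Herm (x n)) →
      (∀ k, Filter.Tendsto (fun n => x n k) Filter.atTop (nhds (z k))) → Herm z := by
    intro x z hx hz k
    refine tendsto_nhds_unique (hz (-k)) ?_
    have := (Complex.continuous_conj.tendsto _).comp (hz k)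
    exact this.congr fun n => (hx n k).symm
  have hmode : ModeSol univ uh f b ω T R := by
    refine ⟨fun t ht => hherm (fun n => (hsol n).herm_b t ht) (hlb t ht),
      fun t ht => hherm (fun n => (hsol n).herm_ω t ht) (hlw t ht),
      fun t _ k hk => absurd (mem_univ k) hk, fun t _ k hk => absurd (mem_univ k) hk,
      hSb, hSw, fun t ht k _ => ?_, fun t ht k _ => ?_⟩
    · obtain ⟨N₀, hN, hk⟩ := hN0 k
      refine hasDerivWithinAt_limit (N₀ := N₀) (y := fun n t => y n t k)
        (q := fun n t => -nlB f (y n t) (w n t) k) (p := fun t => -nlB f (b t) (ω t) k)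
        (M := 2 ^ 2 * (embConst * (R + Φ) * R)) (fun t ht => hlb t ht k)
        (fun n hn t ht => (hsol n).deriv_b t ht k (hk n hn)) (fun n _ => ?_) (fun n _ t ht => ?_)
        (fun t ht => ?_) ?_ ht
      · exact (continuousOn_nlB hd (hsol n).sobLe_b (hsol n).sobLe_ω (hsol n).continuousOn_b
          (hsol n).continuousOn_ω k).neg
      · rw [norm_neg]
        exact (sobLe_nlB hd ((hsol n).sobLe_b t ht) ((hsol n).sobLe_ω t ht)).norm_apply_le k
      · exact (tendsto_nlB hd (Filter.Eventually.of_forall fun n => (hsol n).sobLe_b t ht)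
          (Filter.Eventually.of_forall fun n => (hsol n).sobLe_ω t ht) (hlb t ht) (hlw t ht) k).neg
      · exact (continuousOn_nlB hd hSb hSw hzbc hzwc k).neg
    · obtain ⟨N₀, hN, hk⟩ := hN0 k
      refine hasDerivWithinAt_limit (N₀ := N₀) (y := fun n t => w n t k)
        (q := fun n t => -nlW uh f (y n t) (w n t) k) (p := fun t => -nlW uh f (b t) (ω t) k)
        (M := 2 ^ 2 * (embConst * (R + Φ) * (R + R)) + 2 ^ 2 * (embConst * U * R))
        (fun t ht => hlw t ht k)
        (fun n hn t ht => (hsol n).deriv_ω t ht k (hk n hn)) (fun n _ => ?_) (fun n _ t ht => ?_)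
        (fun t ht => ?_) ?_ ht
      · exact (continuousOn_nlW hd (hsol n).sobLe_b (hsol n).sobLe_ω (hsol n).continuousOn_b
          (hsol n).continuousOn_ω k).neg
      · rw [norm_neg]
        exact (sobLe_nlW hd ((hsol n).sobLe_b t ht) ((hsol n).sobLe_ω t ht)).norm_apply_le k
      · exact (tendsto_nlW hd (Filter.Eventually.of_forall fun n => (hsol n).sobLe_b t ht)
          (Filter.Eventually.of_forall fun n => (hsol n).sobLe_ω t ht) (hlb t ht) (hlw t ht) k).neg
      · exact (continuousOn_nlW hd hSb hSw hzbc hzwc k).neg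
  have hb0 : b 0 = b₀ := by
    funext k
    refine tendsto_nhds_unique (hlb 0 h0T k) (tendsto_const_nhds.congr' ?_)
    filter_upwards [eventually_mem_box k] with n hn using (hinit n k hn).1.symm
  have hω0 : ω 0 = ω₀ := by
    funext k
    refine tendsto_nhds_unique (hlw 0 h0T k) (tendsto_const_nhds.congr' ?_)
    filter_upwards [eventually_mem_box k] with n hn using (hinit n k hn).2.symm
  refine ⟨b, ω, hmode, hb0, hω0, fun t ht => ?_, fun i t ht => ?_, ?_⟩
  -- Two successive limits: n tends to infinity with F fixed, where only finitely many modes matter,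
  -- and then F exhausts the lattice.
  · have hF : ∀ F, gap U Φ b₀ ω₀ t ≤ (1 + normF F (b t) (ω t) ^ 2)⁻¹ := by
      intro F
      have hlim : Filter.Tendsto (fun n => (1 + normF F (y n t) (w n t) ^ 2)⁻¹) Filter.atTop
          (nhds (1 + normF F (b t) (ω t) ^ 2)⁻¹) :=
        (((tendsto_finsetSum _ fun i _ =>
          (tendsto_energyF_of_modes (hlb t ht) (hlw t ht) F i).sqrt).pow 2).const_add 1).inv₀
            (by positivity)
      refine ge_of_tendsto hlim ?_
      filter_upwards [exists_box_superset F] with n hn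
      refine ((hyw n).2.2.2.1 t ht).trans ?_
      have h1 := normF_mono hn (y n t) (w n t)
      have h2 := normF_nonneg F (y n t) (w n t)
      gcongr
    exact ge_of_tendsto' ((((tendsto_normF (hSb t ht) (hSw t ht)).pow 2).const_add 1).inv₀
      (by positivity)) hF
  · refine le_of_tendsto' (tendsto_energyF (hSb t ht) (hSw t ht) i).sqrt fun F => ?_
    refine le_of_tendsto (tendsto_energyF_of_modes (hlb t ht) (hlw t ht) F i).sqrt ?_
    filter_upwards [exists_box_superset F] with n hn
    exact (Real.sqrt_le_sqrt (energyF_mono hn _ _ i)).trans ((hyw n).2.2.2.2 i t ht)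
  -- Uniqueness comes from the same comparison: another solution is close to every Galerkin
  -- solution, with constants computed from the larger of the two bounds, so both have the same
  -- limit.
  · intro R' b' ω' h' hb' hω' t ht
    have hcl : ∀ k, Filter.Tendsto (fun n => b' t k - y n t k) Filter.atTop (nhds 0) ∧
        Filter.Tendsto (fun n => ω' t k - w n t k) Filter.atTop (nhds 0) := by
      intro k
      obtain ⟨N₀, hN, hk⟩ := hN0 k
      have hz : Filter.Tendsto (fun n : ℕ => √(diffConst U Φ (max R R') T) * jb k / n)
          Filter.atTop (nhds 0) := tendsto_const_div_atTop_nhds_zero_nat _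
      have hev : ∀ᶠ n : ℕ in Filter.atTop,
          ‖b' t k - y n t k‖ ≤ √(diffConst U Φ (max R R') T) * jb k / n ∧
          ‖ω' t k - w n t k‖ ≤ √(diffConst U Φ (max R R') T) * jb k / n := by
        filter_upwards [Filter.eventually_ge_atTop N₀] with n hn
        exact (h'.mono (le_max_right R R')).mode_close hd (by omega) (subset_univ _)
          ((hsol n).mono (le_max_left R R'))
          (fun k hk => by rw [hb', (hinit n k hk).1]) (fun k hk => by rw [hω', (hinit n k hk).2])
          ht (hk n hn)
      exact ⟨squeeze_zero_norm' (hev.mono fun _ h => h.1) hz,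
        squeeze_zero_norm' (hev.mono fun _ h => h.2) hz⟩
    refine ⟨funext fun k => ?_, funext fun k => ?_⟩
    · have := tendsto_nhds_unique (hcl k).1 ((hlb t ht k).const_sub (b' t k))
      exact (sub_eq_zero.1 this.symm)
    · have := tendsto_nhds_unique (hcl k).2 ((hlw t ht k).const_sub (ω' t k))
      exact (sub_eq_zero.1 this.symm)

/-! ### Strong continuity of the derivative norms -/

theorem IsData.neg {uh : Freq → Fin 2 → ℂ} {f : Freq → ℂ} {U Φ : ℝ} (hd : IsData uh f U Φ) :
    IsData (-uh) (-f) U Φ where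
  divFree := fun k => by
    have := hd.divFree k
    simp only [dot, Pi.neg_apply] at this ⊢
    linear_combination -this
  hermV := fun k j => by
    have := hd.hermV k j
    simp [this]
  sobLe_uh := hd.sobLe_uh.neg
  herm := hd.herm.neg
  sobLe_f := hd.sobLe_f.neg

/-- The nonlinearity is quadratic in all the data together, hence even. Time reversal combined with
a global change of sign therefore preserves the system. -/
theorem nlB_neg (f b ω : Freq → ℂ) : nlB (-f) (-b) (-ω) = nlB f b ω := by
  funext k
  have h : -ω - -f = -(ω - f) := by abel
  rw [nlB, h, bs_neg, adv_neg_neg, nlB]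

theorem nlW_neg (uh : Freq → Fin 2 → ℂ) (f b ω : Freq → ℂ) :
    nlW (-uh) (-f) (-b) (-ω) = nlW uh f b ω := by
  funext k
  have h : -ω - -f = -(ω - f) := by abel
  have h' : -ω - -b = -(ω - b) := by abel
  simp only [nlW, Pi.add_apply]
  rw [h, h', bs_neg, adv_neg_neg, adv_neg_neg]

section Continuity

variable {uh : Freq → Fin 2 → ℂ} {f : Freq → ℂ} {b ω : ℝ → Freq → ℂ} {U Φ T R : ℝ}

theorem ModeSol.shift (h : ModeSol univ uh f b ω T R) {s T' : ℝ} (hs : 0 ≤ s)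
    (hT : s + T' ≤ T) :
    ModeSol univ uh f (fun τ => b (s + τ)) (fun τ => ω (s + τ)) T' R := by
  have hm : MapsTo (fun τ => s + τ) (Icc 0 T') (Icc 0 T) := fun τ hτ =>
    ⟨by linarith [hτ.1], by linarith [hτ.2]⟩
  have hda : ∀ τ ∈ Icc 0 T', HasDerivWithinAt (fun τ => s + τ) 1 (Icc 0 T') τ := fun τ _ =>
    ((hasDerivAt_id τ).const_add s).hasDerivWithinAt
  refine ⟨fun t ht => h.herm_b _ (hm ht), fun t ht => h.herm_ω _ (hm ht),
    fun t _ k hk => absurd (mem_univ k) hk, fun t _ k hk => absurd (mem_univ k) hk,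
    fun t ht => h.sobLe_b _ (hm ht), fun t ht => h.sobLe_ω _ (hm ht), fun t ht k hk => ?_,
    fun t ht k hk => ?_⟩
  · have := (h.deriv_b _ (hm ht) k hk).scomp t (hda t ht) hm
    rwa [one_smul] at this
  · have := (h.deriv_ω _ (hm ht) k hk).scomp t (hda t ht) hm
    rwa [one_smul] at this

/-- The system is invariant under time reversal with a change of sign. -/
theorem ModeSol.reverse (h : ModeSol univ uh f b ω T R) {s T' : ℝ} (hs : s ≤ T)
    (hT : T' ≤ s) :
    ModeSol univ (-uh) (-f) (fun τ => -b (s - τ)) (fun τ => -ω (s - τ)) T' R := by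
  have hm : MapsTo (fun τ => s - τ) (Icc 0 T') (Icc 0 T) := fun τ hτ =>
    ⟨by linarith [hτ.2], by linarith [hτ.1]⟩
  have hda : ∀ τ ∈ Icc 0 T', HasDerivWithinAt (fun τ => s - τ) (-1) (Icc 0 T') τ := fun τ _ =>
    ((hasDerivAt_id τ).const_sub s).hasDerivWithinAt
  refine ⟨fun t ht => (h.herm_b _ (hm ht)).neg, fun t ht => (h.herm_ω _ (hm ht)).neg,
    fun t _ k hk => absurd (mem_univ k) hk, fun t _ k hk => absurd (mem_univ k) hk,
    fun t ht => (h.sobLe_b _ (hm ht)).neg, fun t ht => (h.sobLe_ω _ (hm ht)).neg,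
    fun t ht k hk => ?_, fun t ht k hk => ?_⟩
  · have := ((h.deriv_b _ (hm ht) k hk).scomp t (hda t ht) hm).neg
    rw [nlB_neg]
    exact this.congr_deriv (by simp)
  · have := ((h.deriv_ω _ (hm ht) k hk).scomp t (hda t ht) hm).neg
    rw [nlW_neg]
    exact this.congr_deriv (by simp)

theorem energyI_neg (b ω : Freq → ℂ) (i : MultiIndex 3 ⊕ MultiIndex 2) :
    energyI (-b) (-ω) i = energyI b ω i := by
  rcases i with β | β <;> simp [energyI]

theorem energyI_le {b ω : Freq → ℂ} (hb : SobLe 3 b R) (hω : SobLe 2 ω R)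
    (i : MultiIndex 3 ⊕ MultiIndex 2) : √(energyI b ω i) ≤ R := by
  refine (Real.sqrt_le_left hb.1).2 ?_
  rcases i with β | β
  · exact (summable_monM hb β).tsum_le_of_sum_le (sum_monM_le hb β)
  · exact (summable_monM hω β).tsum_le_of_sum_le (sum_monM_le hω β)

theorem normI_le {b ω : Freq → ℂ} (hb : SobLe 3 b R) (hω : SobLe 2 ω R) :
    normI b ω ≤ Fintype.card (MultiIndex 3 ⊕ MultiIndex 2) * R := by
  refine (Finset.sum_le_sum fun i _ => energyI_le hb hω i).trans_eq ?_
  rw [Finset.sum_const, nsmul_eq_mul]; rfl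

/-- A lower bound of `1 / (1 + ‖·‖²)` in terms of the Sobolev bound. -/
def floorI (R : ℝ) : ℝ := (1 + (Fintype.card (MultiIndex 3 ⊕ MultiIndex 2) * R) ^ 2)⁻¹

theorem floorI_pos (R : ℝ) : 0 < floorI R := by unfold floorI; positivity

/-- A time step on which solutions bounded by `R` can be restarted. -/
def stepI (U Φ R : ℝ) : ℝ := floorI R / (2 * (riccati U Φ + 1))

theorem stepI_pos (hU : 0 ≤ U) (hΦ : 0 ≤ Φ) (R : ℝ) : 0 < stepI U Φ R := by
  have := riccati_nonneg hU hΦ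
  have := floorI_pos R
  unfold stepI; positivity

/-- The Lipschitz constant of the derivative norms of solutions bounded by `R`. -/
def lipI (U Φ R : ℝ) : ℝ := rate U Φ * (1 + (2 / floorI R) ^ 2)

/-- The growth bound is known for the Galerkin limit issued from the initial state, and by
uniqueness an arbitrary bounded solution is that limit. No energy identity for the given solution is
needed. -/
theorem ModeSol.sqrt_energyI_le (hd : IsData uh f U Φ) (hT : 0 ≤ T)
    (h : ModeSol univ uh f b ω T R) (hstep : T ≤ stepI U Φ R) (i : MultiIndex 3 ⊕ MultiIndex 2) :
    √(energyI (b T) (ω T) i) ≤ √(energyI (b 0) (ω 0) i) + lipI U Φ R * T := by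
  have h0 : (0 : ℝ) ∈ Icc 0 T := ⟨le_rfl, hT⟩
  have hTm : T ∈ Icc 0 T := ⟨hT, le_rfl⟩
  have hU := hd.sobLe_uh.1
  have hΦ := hd.sobLe_f.1
  have hric := riccati_nonneg hU hΦ
  have hg := floorI_pos R
  have hfl : floorI R ≤ (1 + normI (b 0) (ω 0) ^ 2)⁻¹ := by
    have h1 := normI_nonneg (b 0) (ω 0)
    have h2 := normI_le (h.sobLe_b 0 h0) (h.sobLe_ω 0 h0)
    unfold floorI
    gcongr
  -- The step is chosen to consume at most half of the guaranteed floor of 1/(1 + N²). The 1 added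
  -- to `riccati` in `stepI` keeps the denominator positive.
  have hst : riccati U Φ * T ≤ floorI R / 2 := by
    have h3 : riccati U Φ * T ≤ (riccati U Φ + 1) * stepI U Φ R := by
      refine mul_le_mul (by linarith) hstep hT (by linarith)
    refine h3.trans_eq ?_
    unfold stepI; field_simp
  have hgap : floorI R / 2 ≤ gap U Φ (b 0) (ω 0) T := by unfold gap; linarith
  have hgap0 : 0 < gap U Φ (b 0) (ω 0) T := by linarith
  obtain ⟨b', ω', -, -, -, -, hlip, huniq⟩ := exists_modeSol hd (h.herm_b 0 h0) (h.herm_ω 0 h0)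
    (h.sobLe_b 0 h0) (h.sobLe_ω 0 h0) hT hgap0
  obtain ⟨e1, e2⟩ := huniq R b ω h rfl rfl T hTm
  rw [e1, e2]
  refine (hlip i T hTm).trans ?_
  have hinv : (gap U Φ (b 0) (ω 0) T)⁻¹ ≤ 2 / floorI R := by
    rw [← inv_div]
    exact inv_anti₀ (by linarith) hgap
  have := rate_nonneg hU hΦ
  have hgi : 0 ≤ (gap U Φ (b 0) (ω 0) T)⁻¹ := (inv_pos.2 hgap0).le
  unfold lipI
  gcongr

/-- Running forwards from s limits the increase of a derivative norm; running the reversed system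
backwards from t limits its decrease. -/
theorem ModeSol.abs_sqrt_energyI_sub_le (hd : IsData uh f U Φ)
    (h : ModeSol univ uh f b ω T R) {s t : ℝ} (hs : 0 ≤ s) (hst : s ≤ t) (ht : t ≤ T)
    (hstep : t - s ≤ stepI U Φ R) (i : MultiIndex 3 ⊕ MultiIndex 2) :
    |√(energyI (b t) (ω t) i) - √(energyI (b s) (ω s) i)| ≤ lipI U Φ R * (t - s) := by
  have h1 := (h.shift (T' := t - s) hs (by linarith)).sqrt_energyI_le hd (by linarith) hstep i
  have h2 := (h.reverse (T' := t - s) ht (by linarith)).sqrt_energyI_le hd.neg (by linarith)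
    hstep i
  simp only [energyI_neg, add_sub_cancel, add_zero, sub_zero, sub_sub_cancel] at h1 h2
  rw [abs_le]
  constructor <;> linarith

theorem ModeSol.continuousOn_energyI (hd : IsData uh f U Φ)
    (h : ModeSol univ uh f b ω T R) (i : MultiIndex 3 ⊕ MultiIndex 2) :
    ContinuousOn (fun t => energyI (b t) (ω t) i) (Icc 0 T) := by
  have hδ := stepI_pos hd.sobLe_uh.1 hd.sobLe_f.1 R
  have key : ContinuousOn (fun t => √(energyI (b t) (ω t) i)) (Icc 0 T) := by
    intro s hs
    rw [ContinuousWithinAt, tendsto_iff_dist_tendsto_zero]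
    have hlim : Filter.Tendsto (fun t => lipI U Φ R * |t - s|) (nhdsWithin s (Icc 0 T))
        (nhds 0) := by
      have : Continuous fun t => lipI U Φ R * |t - s| := by fun_prop
      have := (this.tendsto s).mono_left (nhdsWithin_le_nhds (s := Icc 0 T))
      simpa using this
    refine squeeze_zero' (Filter.Eventually.of_forall fun _ => dist_nonneg) ?_ hlim
    filter_upwards [self_mem_nhdsWithin,
      nhdsWithin_le_nhds (Metric.closedBall_mem_nhds s hδ)] with t ht hts
    rw [Metric.mem_closedBall, Real.dist_eq] at hts
    rw [Real.dist_eq]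
    rcases le_total s t with hle | hle
    · rw [abs_of_nonneg (sub_nonneg.2 hle)] at hts ⊢
      exact h.abs_sqrt_energyI_sub_le hd hs.1 hle ht.2 hts i
    · rw [abs_sub_comm t s, abs_of_nonneg (sub_nonneg.2 hle)] at hts ⊢
      rw [abs_sub_comm]
      exact h.abs_sqrt_energyI_sub_le hd ht.1 hle hs.2 hts i
  refine (key.pow 2).congr fun t _ => (Real.sq_sqrt ?_).symm
  rcases i with β | β <;> exact tsum_nonneg fun _ => by positivity

end Continuity

/-! ### Criteria for strong convergence -/

theorem sq_norm_sub_le (x y : ℂ) : ‖x - y‖ ^ 2 ≤ 2 * ‖x‖ ^ 2 + 2 * ‖y‖ ^ 2 := by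
  have h1 := norm_sub_le x y
  have h2 := norm_nonneg (x - y)
  nlinarith [sq_nonneg (‖x‖ - ‖y‖)]

theorem summable_sub_sq {m : Freq → ℝ} {x y : Freq → ℂ}
    (hx : Summable fun k => m k ^ 2 * ‖x k‖ ^ 2) (hy : Summable fun k => m k ^ 2 * ‖y k‖ ^ 2) :
    Summable fun k => m k ^ 2 * ‖x k - y k‖ ^ 2 := by
  refine Summable.of_nonneg_of_le (fun _ => by positivity) (fun k => ?_)
    ((hx.mul_left 2).add (hy.mul_left 2))
  nlinarith [mul_le_mul_of_nonneg_left (sq_norm_sub_le (x k) (y k)) (sq_nonneg (m k))]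

/-- Outside F the difference is bounded by the two tails, each written as total minus partial sum.
In this form convergence of the totals controls the tail of x. -/
theorem tsum_sub_sq_le {m : Freq → ℝ} {x y : Freq → ℂ}
    (hx : Summable fun k => m k ^ 2 * ‖x k‖ ^ 2) (hy : Summable fun k => m k ^ 2 * ‖y k‖ ^ 2)
    (F : Finset Freq) :
    ∑' k, m k ^ 2 * ‖x k - y k‖ ^ 2 ≤ ∑ k ∈ F, m k ^ 2 * ‖x k - y k‖ ^ 2 +
      2 * (∑' k, m k ^ 2 * ‖x k‖ ^ 2 - ∑ k ∈ F, m k ^ 2 * ‖x k‖ ^ 2) +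
      2 * (∑' k, m k ^ 2 * ‖y k‖ ^ 2 - ∑ k ∈ F, m k ^ 2 * ‖y k‖ ^ 2) := by
  have hxy := summable_sub_sq hx hy
  have hs := (((hx.mul_left 2).add (hy.mul_left 2)).sub hxy).sum_le_tsum F fun k _ => by
    nlinarith [mul_le_mul_of_nonneg_left (sq_norm_sub_le (x k) (y k)) (sq_nonneg (m k))]
  rw [((hx.mul_left 2).add (hy.mul_left 2)).tsum_sub hxy,
    (hx.mul_left 2).tsum_add (hy.mul_left 2), tsum_mul_left, tsum_mul_left, Finset.sum_sub_distrib,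
    Finset.sum_add_distrib, ← Finset.mul_sum, ← Finset.mul_sum] at hs
  linarith

/-- Modewise convergence together with convergence of the norms is strong convergence. -/
theorem tendsto_tsum_sub_sq {ι : Type*} {l : Filter ι} {m : Freq → ℝ} {x : ι → Freq → ℂ}
    {y : Freq → ℂ} (hx : ∀ᶠ i in l, Summable fun k => m k ^ 2 * ‖x i k‖ ^ 2)
    (hy : Summable fun k => m k ^ 2 * ‖y k‖ ^ 2)
    (hk : ∀ k, Filter.Tendsto (fun i => x i k) l (nhds (y k)))
    (hn : Filter.Tendsto (fun i => ∑' k, m k ^ 2 * ‖x i k‖ ^ 2) l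
      (nhds (∑' k, m k ^ 2 * ‖y k‖ ^ 2))) :
    Filter.Tendsto (fun i => ∑' k, m k ^ 2 * ‖x i k - y k‖ ^ 2) l (nhds 0) := by
  rw [Metric.tendsto_nhds]
  intro ε hε
  -- The tail of y enters twice with coefficient 2, since the tail of x converges to it; hence ε /
  -- 4.
  have hF : ∀ᶠ F : Finset Freq in Filter.atTop,
      ∑' k, m k ^ 2 * ‖y k‖ ^ 2 - ε / 4 < ∑ k ∈ F, m k ^ 2 * ‖y k‖ ^ 2 :=
    hy.hasSum.eventually (lt_mem_nhds (by linarith))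
  obtain ⟨F, hF⟩ := hF.exists
  have h1 : Filter.Tendsto (fun i => ∑ k ∈ F, m k ^ 2 * ‖x i k - y k‖ ^ 2) l (nhds 0) := by
    have : Filter.Tendsto (fun i => ∑ k ∈ F, m k ^ 2 * ‖x i k - y k‖ ^ 2) l
        (nhds (∑ k ∈ F, m k ^ 2 * ‖y k - y k‖ ^ 2)) :=
      tendsto_finsetSum _ fun k _ => ((((hk k).sub_const _).norm).pow 2).const_mul _
    simpa using this
  have h2 : Filter.Tendsto (fun i => ∑ k ∈ F, m k ^ 2 * ‖x i k‖ ^ 2) l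
      (nhds (∑ k ∈ F, m k ^ 2 * ‖y k‖ ^ 2)) :=
    tendsto_finsetSum _ fun k _ => (((hk k).norm).pow 2).const_mul _
  have h3 := (h1.add ((hn.sub h2).const_mul 2)).add_const
    (2 * (∑' k, m k ^ 2 * ‖y k‖ ^ 2 - ∑ k ∈ F, m k ^ 2 * ‖y k‖ ^ 2))
  filter_upwards [h3.eventually_lt_const (u := ε) (by linarith), hx] with i hi hxi
  rw [dist_zero_right, Real.norm_of_nonneg (tsum_nonneg fun _ => by positivity)]
  exact (tsum_sub_sq_le hxi hy F).trans_lt hi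

/-- Modewise convergence together with a bound of higher order is strong convergence. -/
theorem tendsto_tsum_sub_sq_of_sobLe {ι : Type*} {l : Filter ι} [l.NeBot] {x : ι → Freq → ℂ}
    {y : Freq → ℂ} {M : ℝ} (hx : ∀ᶠ i in l, SobLe 1 (x i) M)
    (hk : ∀ k, Filter.Tendsto (fun i => x i k) l (nhds (y k))) :
    Filter.Tendsto (fun i => ∑' k, ‖x i k - y k‖ ^ 2) l (nhds 0) := by
  have hy := SobLe.of_tendsto hx hk
  have hM := hy.1
  rw [Metric.tendsto_nhds]
  intro ε hε
  -- The difference has H¹ norm at most 2M, so its tail is at most (2M/n)² ≤ 4M²/n < ε/2.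
  obtain ⟨n, hn⟩ := exists_nat_gt (8 * M ^ 2 / ε)
  have hn0 : (0 : ℝ) < n := lt_of_le_of_lt (by positivity) hn
  have hn1 : (1 : ℝ) ≤ n := by exact_mod_cast (by exact_mod_cast hn0 : 0 < n)
  have h1 : Filter.Tendsto (fun i => ∑ k ∈ box n, ‖x i k - y k‖ ^ 2) l (nhds 0) := by
    have : Filter.Tendsto (fun i => ∑ k ∈ box n, ‖x i k - y k‖ ^ 2) l
        (nhds (∑ k ∈ box n, ‖y k - y k‖ ^ 2)) :=
      tendsto_finsetSum _ fun k _ => ((((hk k).sub_const _).norm).pow 2)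
    simpa using this
  filter_upwards [h1.eventually_lt_const (u := ε / 2) (by linarith), hx] with i hi hxi
  rw [dist_zero_right, Real.norm_of_nonneg (tsum_nonneg fun _ => by positivity)]
  have htail : SobLe 1 (fun k => if k ∈ box n then 0 else x i k - y k) (M + M) :=
    (hxi.sub hy).of_norm_le fun k => by
      by_cases hk : k ∈ box n
      · simp only [hk, if_true, norm_zero, mul_zero]; have := jb_nonneg k; positivity
      · simp [hk]
  have htail0 := SobLe.tail (s := 0) htail (n := n) (by exact_mod_cast hn0)
    (fun k hk => by simp [hk])
  have hb : ∀ F : Finset Freq, ∑ k ∈ F, ‖x i k - y k‖ ^ 2 ≤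
      ∑ k ∈ box n, ‖x i k - y k‖ ^ 2 + ((M + M) / n) ^ 2 := by
    intro F
    have h3 := htail0.2 (F \ box n)
    have h4 : ∑ k ∈ F \ box n, ‖x i k - y k‖ ^ 2 ≤ ((M + M) / n) ^ 2 := by
      refine le_trans (Finset.sum_le_sum fun k hk => ?_) h3
      rw [Finset.mem_sdiff] at hk
      simp [hk.2]
    have h5 : ∑ k ∈ F, ‖x i k - y k‖ ^ 2 ≤ ∑ k ∈ (F \ box n) ∪ box n, ‖x i k - y k‖ ^ 2 :=
      Finset.sum_le_sum_of_subset_of_nonneg (by intro k hk; by_cases h : k ∈ box n <;> simp [hk, h])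
        fun _ _ _ => by positivity
    rw [Finset.sum_union Finset.sdiff_disjoint] at h5
    linarith
  have hsm := (summable_of_sum_le (fun k => by positivity) hb).tsum_le_of_sum_le hb
  have h6 : ((M + M) / n) ^ 2 < ε / 2 := by
    rw [div_lt_iff₀ hε] at hn
    rw [div_pow, div_lt_iff₀ (by positivity)]
    nlinarith
  linarith

/-! ### Fourier coefficients of square integrable functions -/

/-- The exponential with frequency `k`. -/
abbrev expo (k : Freq) : C(Torus, ℂ) := UnitAddTorus.mFourier (d := Fin 2) k

/-- The exponential with frequency `k` as an element of `L²`. -/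
def expoL2 (k : Freq) : L2 ℂ := UnitAddTorus.mFourierLp (d := Fin 2) 2 k

theorem coeFn_expoL2 (k : Freq) : expoL2 k =ᵐ[torusMeasure] expo k :=
  UnitAddTorus.coeFn_mFourierLp 2 k

theorem norm_expo (k : Freq) (x : Torus) : ‖expo k x‖ = 1 := by
  simp only [expo, UnitAddTorus.mFourier, fourier_apply, ContinuousMap.coe_mk, norm_prod,
    Circle.norm_coe, Finset.prod_const_one]

theorem expo_neg (k : Freq) (x : Torus) : expo (-k) x = (starRingEnd ℂ) (expo k x) :=
  UnitAddTorus.mFourier_neg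

theorem expo_add (k l : Freq) (x : Torus) : expo (k + l) x = expo k x * expo l x :=
  UnitAddTorus.mFourier_add

/-- The Fourier coefficient of a complex function. -/
def coef (k : Freq) : L2 ℂ →L[ℂ] ℂ := innerSL ℂ (expoL2 k)

theorem coef_eq_integral (k : Freq) (g : L2 ℂ) :
    coef k g = ∫ x, expo (-k) x * g x ∂torusMeasure := by
  rw [coef, innerSL_apply_apply, MeasureTheory.L2.inner_def]
  refine integral_congr_ae ?_
  filter_upwards [coeFn_expoL2 k] with x hx
  rw [hx, expo_neg, RCLike.inner_apply, mul_comm]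

theorem coef_eq_mFourierCoeff (k : Freq) (g : L2 ℂ) :
    coef k g = UnitAddTorus.mFourierCoeff (d := Fin 2) g k := coef_eq_integral k g

theorem coef_eq_repr (k : Freq) (g : L2 ℂ) :
    coef k g = UnitAddTorus.mFourierBasis.repr g k := by
  rw [UnitAddTorus.mFourierBasis_repr, coef_eq_mFourierCoeff]

theorem hasSum_conj_coef_mul (f g : L2 ℂ) :
    HasSum (fun k => (starRingEnd ℂ) (coef k f) * coef k g)
      (∫ x, (starRingEnd ℂ) (f x) * g x ∂torusMeasure) := by
  simp only [coef_eq_mFourierCoeff]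
  exact UnitAddTorus.hasSum_prod_mFourierCoeff f g

/-- A real function as a complex one. -/
def cplx : L2 ℝ →L[ℝ] L2 ℂ := Complex.ofRealCLM.compLpL 2 torusMeasure

theorem coeFn_cplx (v : L2 ℝ) : cplx v =ᵐ[torusMeasure] fun x => (v x : ℂ) :=
  Complex.ofRealCLM.coeFn_compLpL v

/-- The Fourier coefficient of a real function, as a continuous linear functional. -/
def hatL (k : Freq) : L2 ℝ →L[ℝ] ℂ := ((coef k).restrictScalars ℝ).comp cplx

/-- The Fourier coefficients of a real function. -/
def hat (v : L2 ℝ) : Freq → ℂ := fun k => hatL k v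

theorem hat_eq_coef (v : L2 ℝ) (k : Freq) : hat v k = coef k (cplx v) := rfl

theorem hat_eq_integral (v : L2 ℝ) (k : Freq) :
    hat v k = ∫ x, expo (-k) x * (v x : ℂ) ∂torusMeasure := by
  rw [hat_eq_coef, coef_eq_integral]
  refine integral_congr_ae ?_
  filter_upwards [coeFn_cplx v] with x hx
  rw [hx]

theorem hat_add (v w : L2 ℝ) : hat (v + w) = hat v + hat w := funext fun k => map_add (hatL k) v w

theorem hat_sub (v w : L2 ℝ) : hat (v - w) = hat v - hat w := funext fun k => map_sub (hatL k) v w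

theorem hat_neg (v : L2 ℝ) : hat (-v) = -hat v := funext fun k => map_neg (hatL k) v

theorem hat_zero : hat 0 = 0 := funext fun k => map_zero (hatL k)

theorem herm_hat (v : L2 ℝ) : Herm (hat v) := fun k => by
  rw [hat_eq_integral, hat_eq_integral, ← integral_conj]
  refine integral_congr_ae (Filter.Eventually.of_forall fun x => ?_)
  simp only [map_mul, Complex.conj_ofReal, ← expo_neg]

theorem _root_.HasSum.congr_val {α β : Type*} [AddCommMonoid α] [TopologicalSpace α] {f : β → α}
    {a a' : α} (h : HasSum f a) (e : a = a') : HasSum f a' := e ▸ h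

theorem hasSum_hat_mul (v w : L2 ℝ) :
    HasSum (fun k => (starRingEnd ℂ) (hat v k) * hat w k)
      ((∫ x, v x * w x ∂torusMeasure : ℝ) : ℂ) := by
  have h := hasSum_conj_coef_mul (cplx v) (cplx w)
  refine h.congr_val ?_
  rw [← integral_complex_ofReal]
  refine integral_congr_ae ?_
  filter_upwards [coeFn_cplx v, coeFn_cplx w] with x hv hw
  rw [hv, hw]; simp

theorem integral_mul_self (v : L2 ℝ) : ∫ x, v x * v x ∂torusMeasure = ‖v‖ ^ 2 := by
  rw [← real_inner_self_eq_norm_sq, MeasureTheory.L2.inner_def]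
  refine integral_congr_ae (Filter.Eventually.of_forall fun x => ?_)
  simp [sq]

theorem hasSum_norm_hat_sq (v : L2 ℝ) : HasSum (fun k => ‖hat v k‖ ^ 2) (‖v‖ ^ 2) := by
  have h := hasSum_hat_mul v v
  rw [integral_mul_self] at h
  rw [← Complex.hasSum_ofReal]
  convert h using 2 with k
  rw [Complex.conj_mul']
  simp

theorem hat_injective : Function.Injective hat := fun v w h => by
  have h1 := hasSum_norm_hat_sq (v - w)
  rw [hat_sub, h, sub_self] at h1
  have h2 : ‖v - w‖ ^ 2 = 0 := h1.unique (by simp)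
  exact sub_eq_zero.1 (norm_eq_zero.1 (pow_eq_zero_iff two_ne_zero |>.1 h2))

/-- Every Hermitian square summable family is the family of coefficients of a real function. -/
theorem exists_hat_eq {x : Freq → ℂ} (hx : Herm x) (hs : Summable fun k => ‖x k‖ ^ 2) :
    ∃ v : L2 ℝ, hat v = x := by
  have hmem : Memℓp x 2 := memℓp_gen (by simpa using hs)
  set g : L2 ℂ := UnitAddTorus.mFourierBasis.repr.symm ⟨x, hmem⟩ with hg
  have hgk : ∀ k, ∫ y, expo (-k) y * g y ∂torusMeasure = x k := fun k => by
    rw [← coef_eq_integral, coef_eq_repr, hg, LinearIsometryEquiv.apply_symm_apply]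
  have hinteg : ∀ k, Integrable (fun y => expo (-k) y * g y) torusMeasure := fun k =>
    ((Lp.memLp g).integrable (by norm_num)).bdd_mul (c := 1)
      (expo (-k)).continuous.aestronglyMeasurable
      (Filter.Eventually.of_forall fun y => (norm_expo _ _).le)
  -- The complex function with the prescribed coefficients is replaced by its real part; Hermitian
  -- symmetry makes the two halves of Re g contribute equally.
  refine ⟨Complex.reCLM.compLpL 2 torusMeasure g, funext fun k => ?_⟩
  rw [hat_eq_integral]
  have h1 : ∀ᵐ y ∂torusMeasure, expo (-k) y * ((Complex.reCLM.compLpL 2 torusMeasure g) y : ℂ) =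
      (2 : ℂ)⁻¹ * (expo (-k) y * g y + (starRingEnd ℂ) (expo (- -k) y * g y)) := by
    filter_upwards [Complex.reCLM.coeFn_compLpL g] with y hy
    rw [hy, map_mul, ← expo_neg, neg_neg, Complex.reCLM_apply, Complex.re_eq_add_conj]
    ring
  have hconj : Integrable (fun y => (starRingEnd ℂ) (expo (- -k) y * g y)) torusMeasure :=
    Complex.conjCLE.toContinuousLinearMap.integrable_comp (hinteg (-k))
  rw [integral_congr_ae h1, integral_const_mul, integral_add (hinteg k) hconj, integral_conj,
    hgk, hgk, hx k]
  simp only [Complex.conj_conj]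
  ring

/-- The coefficients of a product are the convolution of the coefficients. -/
theorem hasSum_hat_conv (v w : L2 ℝ) (k : Freq) :
    HasSum (fun l => hat v (k - l) * hat w l)
      (∫ x, expo (-k) x * ((v x * w x : ℝ) : ℂ) ∂torusMeasure) := by
  -- The convolution formula is Parseval's identity for the pair e_k v and w; modulation by e_k
  -- shifts the coefficients of v.
  have hmem : MemLp (fun x => expo k x * (cplx v) x) 2 torusMeasure := by
    refine MemLp.of_le (Lp.memLp (cplx v))
      ((expo k).continuous.aestronglyMeasurable.mul (Lp.aestronglyMeasurable _))
      (Filter.Eventually.of_forall fun x => ?_)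
    rw [norm_mul, norm_expo, one_mul]
  have h := hasSum_conj_coef_mul hmem.toLp (cplx w)
  have e1 : ∀ l, (starRingEnd ℂ) (coef l hmem.toLp) = hat v (k - l) := fun l => by
    rw [coef_eq_integral, hat_eq_integral, ← integral_conj]
    refine integral_congr_ae ?_
    filter_upwards [hmem.coeFn_toLp, coeFn_cplx v] with x h1 h2
    rw [h1, h2, ← mul_assoc, ← expo_add, map_mul, Complex.conj_ofReal, ← expo_neg]
    congr 2
    abel_nf
  simp only [e1] at h
  refine h.congr_val ?_
  refine integral_congr_ae ?_
  filter_upwards [hmem.coeFn_toLp, coeFn_cplx v, coeFn_cplx w] with x h1 h2 h3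
  rw [h1, h2, h3, map_mul, Complex.conj_ofReal, ← expo_neg]
  push_cast; ring

/-- A function with absolutely summable coefficients is bounded. -/
theorem exists_bound_of_summable_hat {v : L2 ℝ} (h : Summable fun k => ‖hat v k‖) :
    ∃ C : ℝ, ∀ᵐ x ∂torusMeasure, ‖v x‖ ≤ C := by
  have hs : Summable fun k => hat v k • expo k := by
    refine Summable.of_norm ?_
    simpa only [norm_smul, UnitAddTorus.mFourier_norm, mul_one] using h
  set G : C(Torus, ℂ) := ∑' k, hat v k • expo k with hG
  -- The series converges uniformly to the continuous function G and in L² to v, so v agrees almost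
  -- everywhere with G.
  have hL : HasSum (fun k => hat v k • expoL2 k) (ContinuousMap.toLp (E := ℂ) 2 torusMeasure ℂ G) := by
    have := (ContinuousMap.toLp (E := ℂ) 2 torusMeasure ℂ).hasSum hs.hasSum
    simp only [map_smul] at this
    exact this
  have hR : HasSum (fun k => hat v k • expoL2 k) (cplx v) := by
    have := UnitAddTorus.hasSum_mFourier_series_L2 (d := Fin 2) (cplx v)
    simp only [← coef_eq_mFourierCoeff] at this
    exact this
  have heq := hL.unique hR
  refine ⟨‖G‖, ?_⟩
  filter_upwards [coeFn_cplx v, ContinuousMap.coeFn_toLp (𝕜 := ℂ) (p := 2) torusMeasure G]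
    with x h1 h2
  rw [heq, h1] at h2
  rw [← Complex.norm_real, h2]
  exact G.norm_coe_le_norm x

/-! ### Trigonometric test functions and integration by parts -/

/-- The real trigonometric function `Re (c e_k)`. -/
def trig (c : ℂ) (k : Freq) (x : Torus) : ℝ := (c * expo k x).re

theorem expo_proj (k : Freq) (y : Fin 2 → ℝ) :
    expo k (proj y) = Complex.exp (Complex.I * (lam k 0 * y 0 + lam k 1 * y 1)) := by
  simp only [expo, UnitAddTorus.mFourier, ContinuousMap.coe_mk, Fin.prod_univ_two, proj,
    fourier_coe_apply, ← Complex.exp_add, lam]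
  congr 1
  push_cast
  ring

theorem isTest_trig (c : ℂ) (k : Freq) : IsTest (trig c k) := by
  unfold IsTest trig
  simp only [expo_proj]
  have h : ContDiff ℝ ((⊤ : ℕ∞) : WithTop ℕ∞) fun y : Fin 2 → ℝ =>
      c * Complex.exp (Complex.I * (lam k 0 * ((y 0 : ℝ) : ℂ) + lam k 1 * ((y 1 : ℝ) : ℂ))) := by
    have hy : ∀ j : Fin 2, ContDiff ℝ ((⊤ : ℕ∞) : WithTop ℕ∞) fun y : Fin 2 → ℝ =>
        ((y j : ℝ) : ℂ) := fun j =>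
      Complex.ofRealCLM.contDiff.comp (contDiff_apply ℝ ℝ j)
    exact contDiff_const.mul (Complex.contDiff_exp.comp
      (contDiff_const.mul ((contDiff_const.mul (hy 0)).add (contDiff_const.mul (hy 1)))))
  exact Complex.reCLM.contDiff.comp h

theorem exists_proj (x : Torus) : ∃ y, proj y = x := isOpenQuotientMap_proj.surjective x

/-- The partial derivative is defined at parameter 0 only; translating along the coordinate circle
gives the derivative at every parameter. -/
theorem IsTest.hasDerivAt {φ : Torus → ℝ} (hφ : IsTest φ) (j : Fin 2) (x : Torus) (s : ℝ) :
    HasDerivAt (fun s : ℝ => φ (x + Pi.single j (s : UnitAddCircle)))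
      (TQG.partialDeriv j φ (x + Pi.single j (s : UnitAddCircle))) s := by
  obtain ⟨y, rfl⟩ := exists_proj x
  have hdiff : Differentiable ℝ (fun s : ℝ => φ (proj y + Pi.single j (s : UnitAddCircle))) := by
    simp only [proj_add_single]
    have h1 : Differentiable ℝ (fun y : Fin 2 → ℝ => φ (proj y)) :=
      ContDiff.differentiable hφ (by simp)
    exact h1.comp (by fun_prop : Differentiable ℝ fun s : ℝ => y + s • Pi.single j (1 : ℝ))
  have h2 := (hdiff s).hasDerivAt
  refine h2.congr_deriv ?_
  have h3 : ∀ r : ℝ, φ (proj y + Pi.single j (s : UnitAddCircle) + Pi.single j (r : UnitAddCircle)) =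
      φ (proj y + Pi.single j ((s + r : ℝ) : UnitAddCircle)) := fun r => by
    rw [add_assoc, ← Pi.single_add]; rfl
  unfold TQG.partialDeriv
  simp only [h3]
  have h4 := deriv_comp_const_add (fun s : ℝ => φ (proj y + Pi.single j (s : UnitAddCircle))) s 0
  rw [add_zero] at h4
  exact h4.symm

theorem IsTest.hasDerivAt_zero {φ : Torus → ℝ} (hφ : IsTest φ) (j : Fin 2) (x : Torus) :
    HasDerivAt (fun s : ℝ => φ (x + Pi.single j (s : UnitAddCircle)))
      (TQG.partialDeriv j φ x) 0 := by
  have := hφ.hasDerivAt j x 0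
  have h0 : x + Pi.single j (((0 : ℝ)) : UnitAddCircle) = x := by
    rw [AddCircle.coe_zero, Pi.single_zero, add_zero]
  rwa [h0] at this

theorem partialDeriv_trig (j : Fin 2) (c : ℂ) (k : Freq) :
    partialDeriv j (trig c k) = trig (c * (Complex.I * lam k j)) k := by
  funext x
  obtain ⟨y, rfl⟩ := exists_proj x
  rw [partialDeriv]
  have e : ∀ s : ℝ, trig c k (proj y + Pi.single j (s : UnitAddCircle)) =
      (c * expo k (proj y) * Complex.exp (s * (Complex.I * lam k j))).re := fun s => by
    rw [proj_add_single, trig, expo_proj, expo_proj, mul_assoc, ← Complex.exp_add]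
    congr 3
    fin_cases j <;> simp <;> ring
  simp only [e]
  have h1 : HasDerivAt (fun s : ℝ => c * expo k (proj y) * Complex.exp (s * (Complex.I * lam k j)))
      (c * expo k (proj y) * (Complex.exp ((0 : ℝ) * (Complex.I * lam k j)) *
        (1 * (Complex.I * lam k j)))) 0 :=
    (((Complex.ofRealCLM.hasDerivAt (x := (0 : ℝ))).mul_const _).cexp).const_mul _
  have h2 := (Complex.reCLM.hasFDerivAt.comp_hasDerivAt (0 : ℝ) h1).deriv
  refine h2.trans ?_
  rw [trig, Complex.reCLM_apply]
  congr 1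
  simp
  ring

theorem iterate_partialDeriv_trig (j : Fin 2) (n : ℕ) (c : ℂ) (k : Freq) :
    (partialDeriv j)^[n] (trig c k) = trig (c * (Complex.I * lam k j) ^ n) k := by
  induction n with
  | zero => simp
  | succ n ih =>
    rw [Function.iterate_succ_apply', ih, partialDeriv_trig, mul_assoc, ← pow_succ]

theorem classicalDeriv_trig (m n : ℕ) (c : ℂ) (k : Freq) :
    classicalDeriv m n (trig c k) =
      trig (c * ((Complex.I * lam k 0) ^ m * (Complex.I * lam k 1) ^ n)) k := by
  rw [classicalDeriv, iterate_partialDeriv_trig, iterate_partialDeriv_trig]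
  congr 1
  ring

theorem integrable_expo_mul (k : Freq) {F : Torus → ℝ} (hF : Integrable F torusMeasure) :
    Integrable (fun x => expo k x * (F x : ℂ)) torusMeasure :=
  hF.ofReal.bdd_mul (c := 1) (expo k).continuous.aestronglyMeasurable
    (Filter.Eventually.of_forall fun _ => (norm_expo _ _).le)

theorem integral_trig_mul (c : ℂ) (k : Freq) {F : Torus → ℝ} (hF : Integrable F torusMeasure) :
    ∫ x, trig c k x * F x ∂torusMeasure =
      (c * ∫ x, expo k x * (F x : ℂ) ∂torusMeasure).re := by
  rw [← integral_const_mul]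
  have h := Complex.reCLM.integral_comp_comm ((integrable_expo_mul k hF).const_mul c)
  simp only [Complex.reCLM_apply] at h
  rw [← h]
  refine integral_congr_ae (Filter.Eventually.of_forall fun x => ?_)
  simp only [trig]
  rw [← mul_assoc, Complex.re_mul_ofReal]

theorem integral_trig_mul_L2 (c : ℂ) (k : Freq) (v : L2 ℝ) :
    ∫ x, trig c (-k) x * v x ∂torusMeasure = (c * hat v k).re := by
  rw [integral_trig_mul _ _ ((Lp.memLp v).integrable (by norm_num)), hat_eq_integral]

/-- Test functions are real, so a complex coefficient is recovered by testing with Re(c e₋ₖ) for all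
complex c. -/
theorem eq_of_forall_re_mul {z w : ℂ} (h : ∀ c : ℂ, (c * z).re = (c * w).re) : z = w := by
  refine Complex.ext (by simpa using h 1) ?_
  simpa using h (-Complex.I)

theorem IsTest.mul {φ χ : Torus → ℝ} (hφ : IsTest φ) (hχ : IsTest χ) :
    IsTest fun x => φ x * χ x := ContDiff.mul hφ hχ

theorem IsTest.partialDeriv_mul {φ χ : Torus → ℝ} (hφ : IsTest φ) (hχ : IsTest χ) (j : Fin 2)
    (x : Torus) : TQG.partialDeriv j (fun x => φ x * χ x) x =
      TQG.partialDeriv j φ x * χ x + φ x * TQG.partialDeriv j χ x := by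
  have h := ((hφ.hasDerivAt_zero j x).mul (hχ.hasDerivAt_zero j x)).deriv
  have h0 : x + Pi.single j (((0 : ℝ)) : UnitAddCircle) = x := by
    rw [AddCircle.coe_zero, Pi.single_zero, add_zero]
  rw [h0] at h
  exact h

theorem IsTest.integrable {φ : Torus → ℝ} (hφ : IsTest φ) : Integrable φ torusMeasure := by
  obtain ⟨C, hC⟩ := IsCompact.exists_bound_of_continuousOn isCompact_univ hφ.continuous.continuousOn
  exact Integrable.of_bound hφ.continuous.aestronglyMeasurable C
    (Filter.Eventually.of_forall fun x => hC x (mem_univ x))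

theorem IsTest.memLp {φ : Torus → ℝ} (hφ : IsTest φ) : MemLp φ 2 torusMeasure := by
  obtain ⟨C, hC⟩ := IsCompact.exists_bound_of_continuousOn isCompact_univ hφ.continuous.continuousOn
  exact MemLp.of_bound hφ.continuous.aestronglyMeasurable C
    (Filter.Eventually.of_forall fun x => hC x (mem_univ x))

theorem integral_translate (φ : Torus → ℝ) (a : Torus) :
    ∫ x, φ (x + a) ∂torusMeasure = ∫ x, φ x ∂torusMeasure := integral_add_right_eq_self φ a

/-- The integral of a translate of φ does not depend on the translation; differentiating under the
integral sign gives the claim. -/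
theorem IsTest.integral_partialDeriv {φ : Torus → ℝ} (hφ : IsTest φ) (j : Fin 2) :
    ∫ x, TQG.partialDeriv j φ x ∂torusMeasure = 0 := by
  obtain ⟨C, hC⟩ := IsCompact.exists_bound_of_continuousOn isCompact_univ
    (hφ.partialDeriv j).continuous.continuousOn
  obtain ⟨a, ha⟩ : ∃ a : ℝ → Torus, ∀ s, a s = Pi.single j (s : UnitAddCircle) :=
    ⟨_, fun _ => rfl⟩
  have ha0 : a 0 = 0 := by rw [ha, AddCircle.coe_zero, Pi.single_zero]
  have hcont : ∀ s : ℝ, Continuous fun x : Torus => x + a s := fun s => continuous_add_const _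
  have hm : ∀ s : ℝ, AEStronglyMeasurable (fun x => φ (x + a s)) torusMeasure := fun s =>
    (hφ.continuous.comp (hcont s)).aestronglyMeasurable
  have hm' : AEStronglyMeasurable (fun x => TQG.partialDeriv j φ (x + a 0)) torusMeasure :=
    ((hφ.partialDeriv j).continuous.comp (hcont 0)).aestronglyMeasurable
  have hinteg : Integrable (fun x => φ (x + a 0)) torusMeasure := by
    simp only [ha0, add_zero]
    exact hφ.integrable
  have hd : ∀ x s, HasDerivAt (fun s => φ (x + a s)) (TQG.partialDeriv j φ (x + a s)) s := by
    intro x s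
    simp only [ha]
    exact hφ.hasDerivAt j x s
  have hb : ∀ x s, ‖TQG.partialDeriv j φ (x + a s)‖ ≤ C := fun x s => hC _ (mem_univ _)
  generalize TQG.partialDeriv j φ = χ at *
  have h := (hasDerivAt_integral_of_dominated_loc_of_deriv_le (μ := torusMeasure)
    (F := fun (s : ℝ) x => φ (x + a s)) (F' := fun (s : ℝ) x => χ (x + a s))
    (x₀ := (0 : ℝ)) (s := univ) (bound := fun _ => C) Filter.univ_mem
    (Filter.Eventually.of_forall hm) hinteg hm'
    (Filter.Eventually.of_forall fun x s _ => hb x s) (integrable_const C)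
    (Filter.Eventually.of_forall fun x s _ => hd x s)).2
  simp only [integral_translate] at h
  exact h.unique (hasDerivAt_const _ _)

/-- The element of `L²` given by a test function. -/
def IsTest.toL2 {φ : Torus → ℝ} (hφ : IsTest φ) : L2 ℝ := hφ.memLp.toLp

theorem IsTest.toL2_congr {φ χ : Torus → ℝ} (h : φ = χ) (hφ : IsTest φ) (hχ : IsTest χ) :
    hφ.toL2 = hχ.toL2 := by
  subst h; rfl

theorem IsTest.coeFn_toL2 {φ : Torus → ℝ} (hφ : IsTest φ) : hφ.toL2 =ᵐ[torusMeasure] φ :=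
  hφ.memLp.coeFn_toLp

theorem IsTest.integral_mul {φ : Torus → ℝ} (hφ : IsTest φ) (v : L2 ℝ) :
    ∫ x, hφ.toL2 x * v x ∂torusMeasure = ∫ x, φ x * v x ∂torusMeasure := by
  refine integral_congr_ae ?_
  filter_upwards [hφ.coeFn_toL2] with x hx
  rw [hx]

/-- Integration by parts: the derivative of φ times a trigonometric function has integral zero. -/
theorem IsTest.hat_partialDeriv {φ : Torus → ℝ} (hφ : IsTest φ) (j : Fin 2) (k : Freq) :
    hat (hφ.partialDeriv j).toL2 k = Complex.I * lam k j * hat hφ.toL2 k := by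
  refine eq_of_forall_re_mul fun c => ?_
  have ht := isTest_trig c (-k)
  have h0 := (hφ.mul ht).integral_partialDeriv j
  have e1 : ∫ x, TQG.partialDeriv j φ x * trig c (-k) x ∂torusMeasure =
      (c * hat (hφ.partialDeriv j).toL2 k).re := by
    rw [← integral_trig_mul_L2]
    refine integral_congr_ae ?_
    filter_upwards [(hφ.partialDeriv j).coeFn_toL2] with x hx
    rw [hx, mul_comm]
  have e2 : ∫ x, φ x * TQG.partialDeriv j (trig c (-k)) x ∂torusMeasure =
      -(c * (Complex.I * lam k j * hat hφ.toL2 k)).re := by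
    rw [partialDeriv_trig, ← Complex.neg_re]
    have : -(c * (Complex.I * lam k j * hat hφ.toL2 k)) =
        c * (Complex.I * lam (-k) j) * hat hφ.toL2 k := by
      rw [lam_neg]; push_cast; ring
    rw [this, ← integral_trig_mul_L2]
    refine integral_congr_ae ?_
    filter_upwards [hφ.coeFn_toL2] with x hx
    rw [hx, mul_comm]
  simp only [hφ.partialDeriv_mul ht] at h0
  rw [integral_add ((hφ.partialDeriv j).mul ht).integrable (hφ.mul (ht.partialDeriv j)).integrable,
    e1, e2] at h0
  linarith

theorem IsTest.hat_iterate {φ : Torus → ℝ} (j : Fin 2) (n : ℕ) (hφ : IsTest φ)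
    (hn : IsTest ((TQG.partialDeriv j)^[n] φ)) (k : Freq) :
    hat hn.toL2 k = (Complex.I * lam k j) ^ n * hat hφ.toL2 k := by
  induction n with
  | zero => simp only [pow_zero, one_mul]; rfl
  | succ n ih =>
    have hn' : IsTest ((TQG.partialDeriv j)^[n] φ) := by
      clear ih hn
      induction n with
      | zero => exact hφ
      | succ n ih => rw [Function.iterate_succ_apply']; exact ih.partialDeriv j
    have h1 := hn'.hat_partialDeriv j k
    rw [ih hn'] at h1
    have h2 : hat hn.toL2 k = hat (hn'.partialDeriv j).toL2 k := by
      rw [IsTest.toL2_congr (Function.iterate_succ_apply' _ _ _) hn (hn'.partialDeriv j)]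
    rw [h2, h1, pow_succ]
    ring

theorem IsTest.hat_classicalDeriv {φ : Torus → ℝ} (hφ : IsTest φ) (m n : ℕ) (k : Freq) :
    hat (hφ.classicalDeriv m n).toL2 k =
      (Complex.I * lam k 0) ^ m * (Complex.I * lam k 1) ^ n * hat hφ.toL2 k := by
  have h1 : IsTest ((TQG.partialDeriv 1)^[n] φ) := hφ.classicalDeriv 0 n
  have h2 := IsTest.hat_iterate 0 m h1 (hφ.classicalDeriv m n) k
  refine h2.trans ?_
  rw [IsTest.hat_iterate 1 n hφ h1 k, mul_assoc]

/-- Weak derivatives on the Fourier side. -/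
theorem isWeakDeriv_iff {m n : ℕ} {v w : L2 ℝ} :
    IsWeakDeriv m n v w ↔
      ∀ k, hat w k = (Complex.I * lam k 0) ^ m * (Complex.I * lam k 1) ^ n * hat v k := by
  have hsq : ∀ r : ℝ, ((-1 : ℝ) ^ (m + n)) * ((-1 : ℝ) ^ (m + n) * r) = r := fun r => by
    rw [← mul_assoc, ← mul_pow]; simp
  constructor
  -- Trigonometric test functions read off one coefficient at a time.
  · intro h k
    refine eq_of_forall_re_mul fun c => ?_
    have h1 := h _ (isTest_trig c (-k))
    simp only [smul_eq_mul] at h1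
    rw [classicalDeriv_trig, integral_trig_mul_L2, integral_trig_mul_L2] at h1
    rw [← hsq (c * hat w k).re, ← h1, ← Complex.re_ofReal_mul]
    congr 1
    simp only [lam_neg]
    push_cast
    rw [mul_neg, mul_neg, neg_pow (Complex.I * (lam k 0 : ℂ)), neg_pow (Complex.I * (lam k 1 : ℂ)),
      pow_add]
    have h3 : ((-1 : ℂ) ^ m) * (-1) ^ m = 1 := by rw [← mul_pow]; simp
    have h4 : ((-1 : ℂ) ^ n) * (-1) ^ n = 1 := by rw [← mul_pow]; simp
    linear_combination (c * (Complex.I * lam k 0) ^ m * (Complex.I * lam k 1) ^ n * hat v k) *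
      ((-1) ^ n * (-1) ^ n * h3 + h4)
  -- For a general test function both sides are expanded by Parseval's identity and agree term by
  -- term.
  · intro h φ hφ
    simp only [smul_eq_mul]
    rw [← hφ.integral_mul, ← (hφ.classicalDeriv m n).integral_mul]
    have h1 := hasSum_hat_mul (hφ.classicalDeriv m n).toL2 v
    have h2 := (hasSum_hat_mul hφ.toL2 w).mul_left ((-1 : ℂ) ^ (m + n))
    have e : (fun k => (starRingEnd ℂ) (hat (hφ.classicalDeriv m n).toL2 k) * hat v k) =
        fun k => (-1 : ℂ) ^ (m + n) * ((starRingEnd ℂ) (hat hφ.toL2 k) * hat w k) := by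
      funext k
      rw [h k, hφ.hat_classicalDeriv]
      simp only [map_mul, map_pow, Complex.conj_I, Complex.conj_ofReal]
      rw [neg_mul, neg_mul, neg_pow (Complex.I * (lam k 0 : ℂ)),
        neg_pow (Complex.I * (lam k 1 : ℂ)), pow_add]
      ring
    rw [e] at h1
    exact_mod_cast h1.unique h2

/-- The weak divergence of a square integrable field on the Fourier side. -/
theorem isWeakDiv_iff {F : Torus → Plane} {q : Fin 2 → L2 ℝ} {g : L2 ℝ}
    (hq : ∀ j, q j =ᵐ[torusMeasure] fun x => F x j) :
    IsWeakDiv F g ↔ ∀ k, hat g k = ∑ j, Complex.I * lam k j * hat (q j) k := by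
  have hrhs : ∀ φ : Torus → ℝ, IsTest φ →
      ∫ x, (F x 0 * partialDeriv 0 φ x + F x 1 * partialDeriv 1 φ x) ∂torusMeasure =
      ∫ x, partialDeriv 0 φ x * q 0 x ∂torusMeasure +
        ∫ x, partialDeriv 1 φ x * q 1 x ∂torusMeasure := by
    intro φ hφ
    have hadd := integral_add ((hφ.partialDeriv 0).integrable_smul (q 0))
      ((hφ.partialDeriv 1).integrable_smul (q 1))
    simp only [smul_eq_mul] at hadd
    rw [← hadd]
    refine integral_congr_ae ?_
    filter_upwards [hq 0, hq 1] with x h0 h1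
    rw [h0, h1]; ring
  have hlhs : ∀ φ : Torus → ℝ, ∫ x, g x * φ x ∂torusMeasure = ∫ x, φ x * g x ∂torusMeasure :=
    fun φ => integral_congr_ae (Filter.Eventually.of_forall fun x => mul_comm _ _)
  constructor
  · intro h k
    refine eq_of_forall_re_mul fun c => ?_
    have h1 := h _ (isTest_trig c (-k))
    rw [hlhs, hrhs _ (isTest_trig c (-k)), partialDeriv_trig, partialDeriv_trig,
      integral_trig_mul_L2, integral_trig_mul_L2, integral_trig_mul_L2] at h1
    rw [h1, ← Complex.add_re, ← Complex.neg_re, Fin.sum_univ_two]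
    congr 1
    simp only [lam_neg]
    push_cast
    ring
  · intro h φ hφ
    rw [hlhs, hrhs φ hφ, ← hφ.integral_mul, ← (hφ.partialDeriv 0).integral_mul,
      ← (hφ.partialDeriv 1).integral_mul]
    have h1 := hasSum_hat_mul hφ.toL2 g
    have h2 := ((hasSum_hat_mul (hφ.partialDeriv 0).toL2 (q 0)).add
      (hasSum_hat_mul (hφ.partialDeriv 1).toL2 (q 1))).neg
    have e : (fun k => (starRingEnd ℂ) (hat hφ.toL2 k) * hat g k) = fun k =>
        -((starRingEnd ℂ) (hat (hφ.partialDeriv 0).toL2 k) * hat (q 0) k +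
          (starRingEnd ℂ) (hat (hφ.partialDeriv 1).toL2 k) * hat (q 1) k) := by
      funext k
      rw [h k, hφ.hat_partialDeriv, hφ.hat_partialDeriv, Fin.sum_univ_two]
      simp only [map_mul, Complex.conj_I, Complex.conj_ofReal]
      ring
    rw [e] at h1
    exact_mod_cast h1.unique h2

/-! ### Sobolev spaces on the Fourier side -/

/-- The Fourier coefficients of a real Sobolev function. -/
def hatW {s : ℕ} (v : W s ℝ) : Freq → ℂ := hat v.toL2

/-- The symbol of the derivative `∂^β`. -/
def sym {s : ℕ} (β : MultiIndex s) (k : Freq) : ℂ :=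
  (Complex.I * lam k 0) ^ (β.1.1 : ℕ) * (Complex.I * lam k 1) ^ (β.1.2 : ℕ)

theorem norm_sym_sq {s : ℕ} (β : MultiIndex s) (k : Freq) : ‖sym β k‖ ^ 2 = monM β k ^ 2 := by
  rw [sym, monM, mon, norm_mul, norm_pow, norm_pow, norm_mul, norm_mul, Complex.norm_I, one_mul,
    one_mul, Complex.norm_real, Complex.norm_real, Real.norm_eq_abs, Real.norm_eq_abs, ← abs_pow,
    ← abs_pow, ← abs_mul, sq_abs]

theorem hat_entry {s : ℕ} (v : W s ℝ) (β : MultiIndex s) (k : Freq) :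
    hat (v.1 β) k = sym β k * hatW v k :=
  isWeakDeriv_iff.1 (v.2 β) k

theorem hat_D {s : ℕ} (m n : ℕ) (v : W s ℝ) (h : m + n ≤ s) (k : Freq) :
    hat (v.D m n h) k = (Complex.I * lam k 0) ^ m * (Complex.I * lam k 1) ^ n * hatW v k :=
  hat_entry v (MultiIndex.mk m n h) k

theorem hasSum_entry {s : ℕ} (v : W s ℝ) (β : MultiIndex s) :
    HasSum (fun k => monM β k ^ 2 * ‖hatW v k‖ ^ 2) (‖v.1 β‖ ^ 2) := by
  have h := hasSum_norm_hat_sq (v.1 β)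
  simpa only [hat_entry, norm_mul, mul_pow, norm_sym_sq] using h

theorem norm_entry {s : ℕ} (v : W s ℝ) (β : MultiIndex s) :
    ‖v.1 β‖ = √(∑' k, monM β k ^ 2 * ‖hatW v k‖ ^ 2) := by
  rw [(hasSum_entry v β).tsum_eq, Real.sqrt_sq (norm_nonneg _)]

theorem norm_W {s : ℕ} {E : Type} [NormedAddCommGroup E] [NormedSpace ℝ E] (v : W s E) :
    ‖v‖ = ∑ β, ‖v.1 β‖ := by
  rw [Submodule.coe_norm, PiLp.norm_eq_of_L1]

theorem norm_entry_le {s : ℕ} {E : Type} [NormedAddCommGroup E] [NormedSpace ℝ E] (v : W s E)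
    (β : MultiIndex s) : ‖v.1 β‖ ≤ ‖v‖ := by
  rw [norm_W]
  exact Finset.single_le_sum (f := fun β => ‖v.1 β‖) (fun _ _ => norm_nonneg _) (Finset.mem_univ β)

theorem normM_eq_normI (b : W 3 ℝ) (ω : W 2 ℝ) : normM b ω = normI (hatW b) (hatW ω) := by
  rw [normM, normI, Fintype.sum_sum_type, norm_W, norm_W]
  congr 1 <;> exact Finset.sum_congr rfl fun β _ => norm_entry _ β

theorem sobLe_hatW {s : ℕ} (hs : s ≤ 3) (v : W s ℝ) : SobLe s (hatW v) (9 * ‖v‖) := by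
  refine sobLe_of_monM hs (norm_nonneg _) fun β F => ?_
  simp only [mul_pow]
  exact (sum_le_hasSum F (fun _ _ => by positivity) (hasSum_entry v β)).trans
    (pow_le_pow_left₀ (norm_nonneg _) (norm_entry_le v β) 2)

theorem herm_hatW {s : ℕ} (v : W s ℝ) : Herm (hatW v) := herm_hat _

theorem hatW_sub {s : ℕ} (v w : W s ℝ) : hatW (v - w) = hatW v - hatW w := hat_sub _ _

theorem herm_sym {s : ℕ} (β : MultiIndex s) {x : Freq → ℂ} (hx : Herm x) :
    Herm fun k => sym β k * x k := fun k => by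
  simp only [sym, lam_neg, map_mul, map_pow, Complex.conj_I, Complex.conj_ofReal, hx k]
  push_cast
  simp only [mul_neg, neg_mul]

/-- A Sobolev function is determined by prescribing its coefficients. -/
theorem exists_hatW_eq {s : ℕ} {x : Freq → ℂ} {R : ℝ} (hx : Herm x) (h : SobLe s x R) :
    ∃ v : W s ℝ, hatW v = x := by
  have hex : ∀ β : MultiIndex s, ∃ w : L2 ℝ, hat w = fun k => sym β k * x k := fun β =>
    exists_hat_eq (herm_sym β hx) (by
      simpa only [norm_mul, mul_pow, norm_sym_sq] using summable_monM h β)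
  choose w hw using hex
  have h0 : hat (w (MultiIndex.mk 0 0 (Nat.zero_le s))) = x := by
    rw [hw]
    funext k
    simp [sym, MultiIndex.mk]
  refine ⟨⟨WithLp.toLp 1 w, fun β => isWeakDeriv_iff.2 fun k => ?_⟩, h0⟩
  change hat (w β) k = _ * hat (w (MultiIndex.mk 0 0 (Nat.zero_le s))) k
  rw [h0, hw β]
  rfl

/-! ### Vector fields by components and the velocity -/

/-- The component of a vector field. -/
def comp (j : Fin 2) : L2 Plane →L[ℝ] L2 ℝ :=
  (EuclideanSpace.proj j : Plane →L[ℝ] ℝ).compLpL 2 torusMeasure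

theorem coeFn_comp (j : Fin 2) (v : L2 Plane) : comp j v =ᵐ[torusMeasure] fun x => v x j :=
  (EuclideanSpace.proj j : Plane →L[ℝ] ℝ).coeFn_compLpL v

theorem norm_comp_le (j : Fin 2) (v : L2 Plane) : ‖comp j v‖ ≤ ‖v‖ := by
  refine Lp.norm_le_norm_of_ae_le ?_
  filter_upwards [coeFn_comp j v] with x hx
  rw [hx]
  exact PiLp.norm_apply_le (v x) j

/-- The embedding of scalar functions as fields with a single component. -/
def emb (j : Fin 2) : L2 ℝ →L[ℝ] L2 Plane :=
  (ContinuousLinearMap.toSpanSingleton ℝ (EuclideanSpace.single j (1 : ℝ) : Plane)).compLpL 2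
    torusMeasure

theorem comp_emb (i j : Fin 2) (v : L2 ℝ) : comp i (emb j v) = if i = j then v else 0 := by
  have h : comp i (emb j v) =ᵐ[torusMeasure] fun x => if i = j then v x else 0 := by
    filter_upwards [coeFn_comp i (emb j v), (ContinuousLinearMap.toSpanSingleton ℝ
      (EuclideanSpace.single j (1 : ℝ) : Plane)).coeFn_compLpL v] with x h1 h2
    rw [h1]
    change (emb j v x) = _ at h2
    rw [h2]
    simp
  refine Lp.ext (h.trans ?_)
  split_ifs with hij
  · exact Filter.EventuallyEq.rfl
  · exact (Lp.coeFn_zero ℝ 2 torusMeasure).symm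

theorem isWeakDeriv_comp {m n : ℕ} {v w : L2 Plane} :
    IsWeakDeriv m n v w ↔ ∀ j, IsWeakDeriv m n (comp j v) (comp j w) := by
  have key : ∀ (j : Fin 2) (φ : Torus → ℝ) (_ : IsTest φ) (v : L2 Plane),
      ∫ x, φ x • comp j v x ∂torusMeasure = (∫ x, φ x • v x ∂torusMeasure) j := by
    intro j φ hφ v
    have h := (EuclideanSpace.proj j : Plane →L[ℝ] ℝ).integral_comp_comm (hφ.integrable_smul v)
    refine Eq.trans (integral_congr_ae ?_) h
    filter_upwards [coeFn_comp j v] with x hx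
    rw [hx]
    simp
  constructor
  · intro h j φ hφ
    rw [key j _ (hφ.classicalDeriv m n), key j _ hφ, h φ hφ]
    simp
  · intro h φ hφ
    ext j
    rw [← key j _ (hφ.classicalDeriv m n), h j φ hφ, key j _ hφ]
    simp

/-- The Fourier coefficients of a vector field. -/
def hatV (u : L2 Plane) : Freq → Fin 2 → ℂ := fun k j => hat (comp j u) k

theorem hermV_hatV (u : L2 Plane) : HermV (hatV u) := fun k j => herm_hat (comp j u) k

/-- The component of a Sobolev field. -/
def compW {s : ℕ} (j : Fin 2) (u : W s Plane) : W s ℝ :=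
  ⟨WithLp.toLp 1 fun β => comp j (u.1 β), fun β => isWeakDeriv_comp.1 (u.2 β) j⟩

/-- Coefficients carry the sup norm over components; each component contributes at most ‖u‖², and 2
‖u‖² ≤ (2 ‖u‖)². -/
theorem sobLe_hatV (u : W 3 Plane) : SobLe 3 (hatV u.toL2) (9 * (2 * ‖u‖)) := by
  refine sobLe_of_monM le_rfl (by positivity) fun β F => ?_
  have hj : ∀ j, ∑ k ∈ F, monM β k ^ 2 * ‖hatV u.toL2 k j‖ ^ 2 ≤ ‖u‖ ^ 2 := fun j => by
    refine (sum_le_hasSum F (fun _ _ => by positivity) (hasSum_entry (compW j u) β)).trans ?_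
    exact pow_le_pow_left₀ (norm_nonneg _) ((norm_comp_le j (u.1 β)).trans (norm_entry_le u β)) 2
  have hk : ∀ k, (monM β k * ‖hatV u.toL2 k‖) ^ 2 ≤ monM β k ^ 2 * ‖hatV u.toL2 k 0‖ ^ 2 +
      monM β k ^ 2 * ‖hatV u.toL2 k 1‖ ^ 2 := fun k => by
    rw [mul_pow, ← mul_add]
    refine mul_le_mul_of_nonneg_left ?_ (sq_nonneg _)
    have hn : ‖hatV u.toL2 k‖ ≤ √(‖hatV u.toL2 k 0‖ ^ 2 + ‖hatV u.toL2 k 1‖ ^ 2) := by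
      refine (pi_norm_le_iff_of_nonneg (Real.sqrt_nonneg _)).2 fun j => Real.le_sqrt_of_sq_le ?_
      fin_cases j <;> simp
    have := pow_le_pow_left₀ (norm_nonneg _) hn 2
    rwa [Real.sq_sqrt (by positivity)] at this
  have := Finset.sum_le_sum fun k (_ : k ∈ F) => hk k
  rw [Finset.sum_add_distrib] at this
  nlinarith [hj 0, hj 1, sq_nonneg ‖u‖]

theorem exists_hatV_eq {x : Freq → Fin 2 → ℂ} {R : ℝ} (hx : HermV x) (h : SobLe 3 x R) :
    ∃ u : W 3 Plane, hatV u.toL2 = x := by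
  have hex : ∀ j, ∃ v : W 3 ℝ, hatW v = fun k => x k j := fun j =>
    exists_hatW_eq (R := R) (fun k => hx k j)
      (h.of_norm_le fun k => mul_le_mul_of_nonneg_left (norm_le_pi_norm (x k) j)
        (pow_nonneg (jb_nonneg k) 3))
  choose v hv using hex
  have hc : ∀ (β : MultiIndex 3) j, comp j (∑ i, emb i ((v i).1 β)) = (v j).1 β := fun β j => by
    rw [map_sum]
    simp [comp_emb]
  refine ⟨⟨WithLp.toLp 1 fun β => ∑ i, emb i ((v i).1 β), fun β =>
    isWeakDeriv_comp.2 fun j => ?_⟩, ?_⟩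
  · change IsWeakDeriv _ _ (comp j (∑ i, emb i ((v i).1 _))) (comp j (∑ i, emb i ((v i).1 β)))
    rw [hc, hc]
    exact (v j).2 β
  · funext k j
    change hat (comp j (∑ i, emb i ((v i).1 _))) k = _
    rw [hc]
    exact congrFun (hv j) k

theorem lam_sq_add (k : Freq) :
    ((jb k : ℝ) : ℂ) ^ 2 = 1 + ((lam k 0 : ℂ) ^ 2 + (lam k 1 : ℂ) ^ 2) := by
  have := jb_sq k
  rw [add_assoc] at this
  exact_mod_cast this

/-- The velocity is determined by the Biot–Savart multiplier. -/
theorem isVelocity_iff {f ω : W 2 ℝ} {u : W 3 Plane} :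
    IsVelocity f ω u ↔ hatV u.toL2 = bs (hatW ω - hatW f) := by
  have hjb : ∀ k, ((jb k : ℝ) : ℂ) ^ 2 ≠ 0 := fun k =>
    pow_ne_zero _ (by exact_mod_cast (jb_pos k).ne')
  -- The symbol of Δ - 1 is -⟨k⟩², which never vanishes: ψ is determined by ω - f, and division by
  -- it raises H² to H⁴ with the same bound.
  have hψ : ∀ ψ : W 4 ℝ, hat (ψ.D 2 0 + ψ.D 0 2 - ψ.toL2) =
      fun k => -((jb k : ℝ) : ℂ) ^ 2 * hatW ψ k := fun ψ => by
    funext k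
    rw [hat_sub, hat_add, Pi.sub_apply, Pi.add_apply, hat_D, hat_D, lam_sq_add]
    change _ - hatW ψ k = _
    linear_combination ((lam k 0 : ℂ) ^ 2 + (lam k 1 : ℂ) ^ 2) * hatW ψ k * Complex.I_sq
  have hu : ∀ (ψ : W 4 ℝ), (∀ᵐ x ∂torusMeasure, u.toL2 x 0 = -((ψ.D 0 1) x) ∧
      u.toL2 x 1 = (ψ.D 1 0) x) ↔ comp 0 u.toL2 = -ψ.D 0 1 ∧ comp 1 u.toL2 = ψ.D 1 0 := by
    intro ψ
    constructor
    · intro h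
      constructor
      · refine Lp.ext ?_
        filter_upwards [h, coeFn_comp 0 u.toL2, Lp.coeFn_neg (ψ.D 0 1)] with x h1 h2 h3
        rw [h2, h3, h1.1, Pi.neg_apply]
      · refine Lp.ext ?_
        filter_upwards [h, coeFn_comp 1 u.toL2] with x h1 h2
        rw [h2, h1.2]
    · rintro ⟨h0, h1⟩
      filter_upwards [coeFn_comp 0 u.toL2, coeFn_comp 1 u.toL2, Lp.coeFn_neg (ψ.D 0 1)]
        with x g0 g1 g2
      rw [← g0, ← g1, h0, h1, g2, Pi.neg_apply]
      exact ⟨rfl, rfl⟩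
  constructor
  · rintro ⟨ψ, h1, h2⟩
    obtain ⟨h3, h4⟩ := (hu ψ).1 h2
    have h5 : ∀ k, hatW ψ k = -((hatW ω - hatW f) k) / ((jb k : ℝ) : ℂ) ^ 2 := fun k => by
      have := congrFun (congrArg hat h1) k
      rw [hψ, hat_sub] at this
      rw [eq_div_iff (hjb k)]
      change _ = -((hat ω.toL2 - hat f.toL2) k)
      rw [← this]; ring
    funext k j
    fin_cases j
    · change hat (comp 0 u.toL2) k = _
      rw [h3, hat_neg, Pi.neg_apply, hat_D, h5]
      simp [bs]; ring
    · change hat (comp 1 u.toL2) k = _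
      rw [h4, hat_D, h5]
      simp [bs]; ring
  · intro h
    have hθ : SobLe 2 (hatW ω - hatW f) (9 * ‖ω‖ + 9 * ‖f‖) :=
      (sobLe_hatW (by norm_num) ω).sub (sobLe_hatW (by norm_num) f)
    have hH : Herm (hatW ω - hatW f) := (herm_hatW ω).sub (herm_hatW f)
    obtain ⟨ψ, hψx⟩ := exists_hatW_eq (s := 4)
      (x := fun k => -((hatW ω - hatW f) k) / ((jb k : ℝ) : ℂ) ^ 2) (R := 9 * ‖ω‖ + 9 * ‖f‖)
      (fun k => by simp [jb_neg, hH k])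
      (hθ.of_norm_le fun k => by
        have := jb_pos k
        rw [norm_div, norm_neg, norm_pow, Complex.norm_real, Real.norm_of_nonneg (jb_nonneg k)]
        refine le_of_eq ?_
        field_simp)
    refine ⟨ψ, hat_injective ?_, (hu ψ).2 ⟨hat_injective ?_, hat_injective ?_⟩⟩
    · rw [hψ, hψx, hat_sub]
      funext k
      rw [mul_div_assoc', div_eq_iff (hjb k)]
      change _ = (hatW ω - hatW f) k * _
      ring
    · funext k
      change hatV u.toL2 k 0 = _
      rw [h, hat_neg, Pi.neg_apply, hat_D, hψx]
      simp [bs]; ring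
    · funext k
      change hatV u.toL2 k 1 = _
      rw [h, hat_D, hψx]
      simp [bs]; ring

theorem divFree_hatV {u : W 3 Plane} (hu : IsDivFree u) : DivFree (hatV u.toL2) := by
  intro k
  have h := (isWeakDiv_iff (q := fun j => comp j u.toL2) (fun j => coeFn_comp j u.toL2)).1 hu k
  rw [hat_zero, Fin.sum_univ_two, Pi.zero_apply] at h
  have h2 : Complex.I * (lam k 0 * hat (comp 0 u.toL2) k + lam k 1 * hat (comp 1 u.toL2) k) = 0 := by
    rw [h]; ring
  rw [mul_eq_zero] at h2
  have h3 := h2.resolve_left Complex.I_ne_zero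
  simp only [dot, hatV]
  rw [← h3]; ring

theorem isData_hat {uh : W 3 Plane} (f : W 2 ℝ) (hu : IsDivFree uh) :
    IsData (hatV uh.toL2) (hatW f) (9 * (2 * ‖uh‖)) (9 * ‖f‖) :=
  ⟨divFree_hatV hu, hermV_hatV _, sobLe_hatV uh, herm_hatW f, sobLe_hatW (by norm_num) f⟩

/-- The weak divergence of a product `b u` with `u` divergence free. -/
theorem isWeakDiv_smul_iff {b : L2 ℝ} {u : L2 Plane} {B : ℝ} (hb : SobLe 2 (hat b) B)
    (hu : DivFree (hatV u)) {F : Torus → Plane}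
    (hF : ∀ᵐ x ∂torusMeasure, F x = b x • u x) {g : L2 ℝ} :
    IsWeakDiv F g ↔ hat g = adv (hatV u) (hat b) := by
  -- An H² function is bounded in dimension two, so the product b u is in L² and has Fourier
  -- coefficients of the usual kind.
  obtain ⟨C, hC⟩ := exists_bound_of_summable_hat (v := b)
    (summable_of_sum_le (fun _ => norm_nonneg _) fun F => by simpa using hb.sum_le (s := 0) F)
  have hmem : ∀ j, MemLp (fun x => comp j u x * b x) 2 torusMeasure := fun j => by
    refine MemLp.of_le_mul (c := C) (Lp.memLp (comp j u))
      ((Lp.aestronglyMeasurable _).mul (Lp.aestronglyMeasurable _)) ?_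
    filter_upwards [hC] with x hx
    rw [norm_mul, mul_comm]
    exact mul_le_mul_of_nonneg_right hx (norm_nonneg _)
  have hq : ∀ j, (hmem j).toLp =ᵐ[torusMeasure] fun x => F x j := fun j => by
    filter_upwards [(hmem j).coeFn_toLp, hF, coeFn_comp j u] with x h1 h2 h3
    rw [h1, h2, h3]
    simp [mul_comm]
  have hc : ∀ j k, HasSum (fun l => hat (comp j u) (k - l) * hat b l) (hat (hmem j).toLp k) := by
    intro j k
    refine (hasSum_hat_conv (comp j u) b k).congr_val ?_
    rw [hat_eq_integral]
    refine integral_congr_ae ?_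
    filter_upwards [(hmem j).coeFn_toLp] with x h1
    rw [h1]
  have hadv : ∀ k, ∑ j, Complex.I * lam k j * hat (hmem j).toLp k = adv (hatV u) (hat b) k := by
    intro k
    have h1 := hasSum_sum (s := Finset.univ) fun j (_ : j ∈ Finset.univ) =>
      (hc j k).mul_left (Complex.I * lam k j)
    rw [← h1.tsum_eq, adv]
    refine tsum_congr fun l => ?_
    -- The divergence carries the output frequency k; by divergence-freeness this is the same kernel
    -- as that of u · ∇b.
    rw [hu.ker_eq, Fin.sum_univ_two, dot]
    simp only [hatV]
    ring
  rw [isWeakDiv_iff hq]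
  simp only [hadv]
  exact funext_iff.symm

/-! ### Solutions of the system and their coefficients -/

/-- The Sobolev norm is a finite sum of L² norms of derivatives, so the Hilbert space criterion is
applied to each derivative separately. -/
theorem tendsto_W {ι : Type*} {l : Filter ι} {s : ℕ} {v : ι → W s ℝ} {w : W s ℝ}
    (hk : ∀ k, Filter.Tendsto (fun i => hatW (v i) k) l (nhds (hatW w k)))
    (hn : ∀ β : MultiIndex s, Filter.Tendsto (fun i => ∑' k, monM β k ^ 2 * ‖hatW (v i) k‖ ^ 2) l
      (nhds (∑' k, monM β k ^ 2 * ‖hatW w k‖ ^ 2))) :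
    Filter.Tendsto v l (nhds w) := by
  rw [tendsto_iff_norm_sub_tendsto_zero]
  simp only [norm_W, norm_entry, hatW_sub, Pi.sub_apply]
  have : Filter.Tendsto (fun i => ∑ β : MultiIndex s,
      √(∑' k, monM β k ^ 2 * ‖hatW (v i) k - hatW w k‖ ^ 2)) l
      (nhds (∑ _β : MultiIndex s, √0)) :=
    tendsto_finsetSum _ fun β _ => (tendsto_tsum_sub_sq
      (Filter.Eventually.of_forall fun i => (hasSum_entry (v i) β).summable)
      (hasSum_entry w β).summable hk (hn β)).sqrt
  simpa using this

/-- Solutions are strongly continuous. -/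
theorem ModeSol.continuousOn_W {uh : Freq → Fin 2 → ℂ} {f : Freq → ℂ} {U Φ T R : ℝ}
    (hd : IsData uh f U Φ) {b : ℝ → W 3 ℝ} {ω : ℝ → W 2 ℝ}
    (h : ModeSol univ uh f (fun t => hatW (b t)) (fun t => hatW (ω t)) T R) :
    ContinuousOn b (Icc 0 T) ∧ ContinuousOn ω (Icc 0 T) :=
  ⟨fun s hs => tendsto_W (fun k => h.continuousOn_b k s hs)
      fun β => h.continuousOn_energyI hd (Sum.inl β) s hs,
    fun s hs => tendsto_W (fun k => h.continuousOn_ω k s hs)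
      fun β => h.continuousOn_energyI hd (Sum.inr β) s hs⟩

theorem tendsto_L2_of_sobLe {ι : Type*} {l : Filter ι} [l.NeBot] {g : ι → L2 ℝ} {g' : L2 ℝ}
    {M : ℝ} (hg : ∀ᶠ i in l, SobLe 1 (hat (g i)) M)
    (hk : ∀ k, Filter.Tendsto (fun i => hat (g i) k) l (nhds (hat g' k))) :
    Filter.Tendsto g l (nhds g') := by
  rw [tendsto_iff_norm_sub_tendsto_zero]
  have h := (tendsto_tsum_sub_sq_of_sobLe hg hk).sqrt
  rw [Real.sqrt_zero] at h
  refine h.congr fun i => ?_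
  have h1 := (hasSum_norm_hat_sq (g i - g')).tsum_eq
  rw [hat_sub] at h1
  simp only [Pi.sub_apply] at h1
  rw [h1, Real.sqrt_sq (norm_nonneg _)]

/-- The curve in `L²` with the coefficients of `v · ∇g`. -/
theorem exists_adv_curve {v : ℝ → Freq → Fin 2 → ℂ} {g : ℝ → Freq → ℂ} {J : Set ℝ} {V G : ℝ}
    (hHv : ∀ t ∈ J, HermV (v t)) (hHg : ∀ t ∈ J, Herm (g t)) (hv : ∀ t ∈ J, SobLe 3 (v t) V)
    (hg : ∀ t ∈ J, SobLe 2 (g t) G) (hvc : ∀ k, ContinuousOn (fun t => v t k) J)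
    (hgc : ∀ k, ContinuousOn (fun t => g t k) J) :
    ∃ d : ℝ → L2 ℝ, (∀ t ∈ J, hat (d t) = adv (v t) (g t)) ∧ ContinuousOn d J := by
  -- The product keeps one derivative more than L² asks for; this uniform bound upgrades modewise
  -- continuity to continuity in L².
  have hS : ∀ t ∈ J, SobLe 1 (adv (v t) (g t)) (2 ^ 2 * (embConst * V * G)) := fun t ht =>
    SobLe.adv (hv t ht) (hg t ht)
  have hex : ∀ t, ∃ d : L2 ℝ, t ∈ J → hat d = adv (v t) (g t) := fun t => by
    by_cases ht : t ∈ J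
    · obtain ⟨d, hd⟩ := exists_hat_eq (Herm.adv (hHv t ht) (hHg t ht))
        (summable_of_sum_le (fun _ => by positivity) fun F => by
          simpa using ((hS t ht).of_le (Nat.zero_le 1)).2 F)
      exact ⟨d, fun _ => hd⟩
    · exact ⟨0, fun h => absurd h ht⟩
  choose d hd using hex
  refine ⟨d, hd, fun t ht => ?_⟩
  have : (nhdsWithin t J).NeBot := mem_closure_iff_nhdsWithin_neBot.1 (subset_closure ht)
  have hmem : ∀ᶠ s in nhdsWithin t J, s ∈ J := self_mem_nhdsWithin
  refine tendsto_L2_of_sobLe (M := 2 ^ 2 * (embConst * V * G))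
    (hmem.mono fun s hs => by rw [hd s hs]; exact hS s hs) fun k => ?_
  rw [hd t ht]
  refine (tendsto_adv (hmem.mono fun s hs => (hv s hs).of_le (Nat.zero_le 3))
    (hmem.mono fun s hs => hg s hs) (fun k => hvc k t ht) (fun k => hgc k t ht) k).congr' ?_
  exact hmem.mono fun s hs => congrFun (hd s hs).symm k

theorem hat_intervalIntegral {d : ℝ → L2 ℝ} {t : ℝ} (hd : IntervalIntegrable d volume 0 t)
    (k : Freq) : hat (∫ τ in (0 : ℝ)..t, d τ) k = ∫ τ in (0 : ℝ)..t, hat (d τ) k :=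
  ((hatL k).intervalIntegral_comp_comm hd).symm

/-! ### The system and its modewise form -/

section Bridge

variable {uh : W 3 Plane} {f : W 2 ℝ} {b₀ : W 3 ℝ} {ω₀ : W 2 ℝ} {b : ℝ → W 3 ℝ}
  {ω : ℝ → W 2 ℝ} {T R : ℝ}

theorem isWeakDiv_b_iff {t : ℝ} {u : W 3 Plane} (hu : IsVelocity f (ω t) u) {g : L2 ℝ} :
    IsWeakDiv (fun x => (b t).toL2 x • u.toL2 x) g ↔
      hat g = nlB (hatW f) (hatW (b t)) (hatW (ω t)) := by
  have hv := isVelocity_iff.1 hu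
  rw [isWeakDiv_smul_iff (b := (b t).toL2) (u := u.toL2)
    ((sobLe_hatW le_rfl (b t)).of_le (by norm_num)) (by rw [hv]; exact divFree_bs _)
    (Filter.Eventually.of_forall fun _ => rfl), hv]
  rfl

theorem isWeakDiv_ω_iff {t : ℝ} {u : W 3 Plane} (hu : IsVelocity f (ω t) u) {g : L2 ℝ} :
    IsWeakDiv (fun x => ((ω t).toL2 x - (b t).toL2 x) • u.toL2 x) g ↔
      hat g = adv (bs (hatW (ω t) - hatW f)) (hatW (ω t) - hatW (b t)) := by
  have hv := isVelocity_iff.1 hu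
  have hS : SobLe 2 (hat ((ω t).toL2 - (b t).toL2)) (9 * ‖ω t‖ + 9 * ‖b t‖) := by
    rw [hat_sub]
    exact (sobLe_hatW (by norm_num) (ω t)).sub ((sobLe_hatW le_rfl (b t)).of_le (by norm_num))
  rw [isWeakDiv_smul_iff (b := (ω t).toL2 - (b t).toL2) (u := u.toL2) hS
    (by rw [hv]; exact divFree_bs _) ?_, hv, hat_sub]
  · rfl
  · filter_upwards [Lp.coeFn_sub (ω t).toL2 (b t).toL2] with x hx
    rw [hx, Pi.sub_apply]

theorem isWeakDiv_uh_iff {t : ℝ} (hu : IsDivFree uh) {g : L2 ℝ} :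
    IsWeakDiv (fun x => (b t).toL2 x • uh.toL2 x) g ↔
      hat g = adv (hatV uh.toL2) (hatW (b t)) := by
  rw [isWeakDiv_smul_iff (b := (b t).toL2) (u := uh.toL2)
    ((sobLe_hatW le_rfl (b t)).of_le (by norm_num)) (divFree_hatV hu)
    (Filter.Eventually.of_forall fun _ => rfl)]
  rfl

/-- A modewise solution solves the system. -/
theorem ModeSol.solvesTQG (hu : IsDivFree uh) (hT : 0 < T)
    (h : ModeSol univ (hatV uh.toL2) (hatW f) (fun t => hatW (b t)) (fun t => hatW (ω t)) T R)
    (hb0 : hatW (b 0) = hatW b₀) (hω0 : hatW (ω 0) = hatW ω₀) :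
    SolvesTQG uh f b₀ ω₀ b ω T := by
  have hd := isData_hat f hu
  have hbsc : ∀ k, ContinuousOn (fun t => bs (hatW (ω t) - hatW f) k) (Icc 0 T) := fun k t ht =>
    tendsto_bs (fun k => (h.continuousOn_ω k t ht).sub_const _) k
  have hHbs : ∀ t ∈ Icc 0 T, HermV (bs (hatW (ω t) - hatW f)) := fun t _ =>
    ((herm_hatW _).sub (herm_hatW _)).bs
  have hSbs : ∀ t ∈ Icc 0 T, SobLe 3 (bs (hatW (ω t) - hatW f)) (R + 9 * ‖f‖) := fun t ht =>
    ((h.sobLe_ω t ht).sub hd.sobLe_f).bs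
  have hb2 : ∀ t ∈ Icc 0 T, SobLe 2 (hatW (b t)) R := fun t ht =>
    (h.sobLe_b t ht).of_le (by norm_num)
  obtain ⟨dB, hdB, hdBc⟩ := exists_adv_curve hHbs h.herm_b hSbs hb2 hbsc h.continuousOn_b
  obtain ⟨dW, hdW, hdWc⟩ := exists_adv_curve (g := fun t => hatW (ω t) - hatW (b t)) hHbs
    (fun t ht => (h.herm_ω t ht).sub (h.herm_b t ht)) hSbs
    (fun t ht => (h.sobLe_ω t ht).sub (hb2 t ht)) hbsc
    (fun k => (h.continuousOn_ω k).sub (h.continuousOn_b k))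
  obtain ⟨dH, hdH, hdHc⟩ := exists_adv_curve (v := fun _ => hatV uh.toL2)
    (fun _ _ => hd.hermV) h.herm_b (fun _ _ => hd.sobLe_uh) hb2 (fun _ => continuousOn_const)
    h.continuousOn_b
  have hex : ∀ t, ∃ u : W 3 Plane, t ∈ Icc 0 T → IsVelocity f (ω t) u := fun t => by
    by_cases ht : t ∈ Icc 0 T
    · obtain ⟨u, hu⟩ := exists_hatV_eq (hHbs t ht) (hSbs t ht)
      exact ⟨u, fun _ => isVelocity_iff.2 hu⟩
    · exact ⟨0, fun h => absurd h ht⟩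
  choose u hv using hex
  have hii : ∀ {d : ℝ → L2 ℝ}, ContinuousOn d (Icc 0 T) → ∀ t ∈ Icc 0 T,
      IntervalIntegrable d volume 0 t := fun hc t ht =>
    (hc.mono (Icc_subset_Icc_right ht.2)).intervalIntegrable_of_Icc ht.1
  have hTm : T ∈ Icc 0 T := ⟨hT.le, le_rfl⟩
  refine ⟨u, dB, dW, dH, hv, fun t ht => (isWeakDiv_b_iff (hv t ht)).2 (hdB t ht),
    fun t ht => (isWeakDiv_ω_iff (hv t ht)).2 (hdW t ht),
    fun t ht => (isWeakDiv_uh_iff hu).2 (hdH t ht), hii hdBc T hTm, hii hdWc T hTm,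
    hii hdHc T hTm, fun t ht => hat_injective (funext fun k => ?_),
    fun t ht => hat_injective (funext fun k => ?_)⟩
  · have h1 := integral_of_hasDerivWithinAt (y := fun t => hatW (b t) k)
      (continuousOn_nlB hd h.sobLe_b h.sobLe_ω h.continuousOn_b h.continuousOn_ω k).neg
      (fun t ht => h.deriv_b t ht k (mem_univ k)) ht
    rw [hat_sub, Pi.sub_apply, hat_intervalIntegral (hii hdBc t ht)]
    change hatW (b t) k = hatW b₀ k - _
    refine h1.trans ?_
    simp only [Pi.neg_apply]
    rw [intervalIntegral.integral_neg, ← sub_eq_add_neg, ← hb0]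
    congr 1
    refine intervalIntegral.integral_congr fun s hs => ?_
    rw [uIcc_of_le ht.1] at hs
    exact congrFun (hdB s (Icc_subset_Icc_right ht.2 hs)).symm k
  · have h1 := integral_of_hasDerivWithinAt (y := fun t => hatW (ω t) k)
      (continuousOn_nlW hd h.sobLe_b h.sobLe_ω h.continuousOn_b h.continuousOn_ω k).neg
      (fun t ht => h.deriv_ω t ht k (mem_univ k)) ht
    rw [hat_sub, Pi.sub_apply, hat_intervalIntegral ((hii hdWc t ht).add (hii hdHc t ht))]
    change hatW (ω t) k = hatW ω₀ k - _
    refine h1.trans ?_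
    simp only [Pi.neg_apply]
    rw [intervalIntegral.integral_neg, ← sub_eq_add_neg, ← hω0]
    congr 1
    refine intervalIntegral.integral_congr fun s hs => ?_
    rw [uIcc_of_le ht.1] at hs
    have hs' := Icc_subset_Icc_right ht.2 hs
    change _ = hat (dW s + dH s) k
    rw [hat_add, hdW s hs', hdH s hs']
    rfl

/-- The coefficients of a bounded solution form a modewise solution. -/
theorem SolvesTQG.modeSol (hu : IsDivFree uh) (h : SolvesTQG uh f b₀ ω₀ b ω T)
    (hb : ∀ t ∈ Icc 0 T, ‖b t‖ ≤ R) (hω : ∀ t ∈ Icc 0 T, ‖ω t‖ ≤ R) :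
    ModeSol univ (hatV uh.toL2) (hatW f) (fun t => hatW (b t)) (fun t => hatW (ω t)) T
      (9 * R) := by
  obtain ⟨u, dB, dW, dH, hv, hdB, hdW, hdH, iB, iW, iH, eB, eW⟩ := h
  have hd := isData_hat f hu
  have hSb : ∀ t ∈ Icc 0 T, SobLe 3 (hatW (b t)) (9 * R) := fun t ht =>
    (sobLe_hatW le_rfl (b t)).mono (mul_le_mul_of_nonneg_left (hb t ht) (by norm_num))
  have hSω : ∀ t ∈ Icc 0 T, SobLe 2 (hatW (ω t)) (9 * R) := fun t ht =>
    (sobLe_hatW (by norm_num) (ω t)).mono (mul_le_mul_of_nonneg_left (hω t ht) (by norm_num))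
  have hsub : ∀ t ∈ Icc 0 T, uIcc 0 t ⊆ uIcc 0 T := fun t ht => by
    rw [uIcc_of_le ht.1, uIcc_of_le (ht.1.trans ht.2)]
    exact Icc_subset_Icc_right ht.2
  have hnlB : ∀ t ∈ Icc 0 T, ∀ k, hat (dB t) k = nlB (hatW f) (hatW (b t)) (hatW (ω t)) k :=
    fun t ht k => congrFun ((isWeakDiv_b_iff (hv t ht)).1 (hdB t ht)) k
  have hnlW : ∀ t ∈ Icc 0 T, ∀ k, hat (dW t + dH t) k =
      nlW (hatV uh.toL2) (hatW f) (hatW (b t)) (hatW (ω t)) k := fun t ht k => by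
    rw [hat_add, (isWeakDiv_ω_iff (hv t ht)).1 (hdW t ht), (isWeakDiv_uh_iff hu).1 (hdH t ht)]
    rfl
  have hIb : ∀ k, ∀ t ∈ Icc 0 T,
      hatW (b t) k = hatW b₀ k + ∫ s in (0 : ℝ)..t, -hat (dB s) k := fun k t ht => by
    rw [intervalIntegral.integral_neg, ← hat_intervalIntegral (iB.mono_set (hsub t ht)),
      ← sub_eq_add_neg]
    change hat (b t).toL2 k = _
    rw [eB t ht, hat_sub]
    rfl
  have hIω : ∀ k, ∀ t ∈ Icc 0 T,
      hatW (ω t) k = hatW ω₀ k + ∫ s in (0 : ℝ)..t, -hat (dW s + dH s) k := fun k t ht => by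
    rw [intervalIntegral.integral_neg,
      ← hat_intervalIntegral ((iW.add iH).mono_set (hsub t ht)), ← sub_eq_add_neg]
    change hat (ω t).toL2 k = _
    rw [eW t ht, hat_sub]
    rfl
  -- The divergences are merely integrable in time. The equation first makes each mode continuous,
  -- as a primitive; the nonlinearity is then continuous by the uniform bounds, and the modes are
  -- differentiable at every time.
  have hprim : ∀ {d : ℝ → L2 ℝ} (k : Freq), 0 ≤ T → IntervalIntegrable d volume 0 T →
      ContinuousOn (fun t => ∫ s in (0 : ℝ)..t, -hat (d s) k) (Icc 0 T) := by
    intro d k hT hi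
    have h1 : IntervalIntegrable (fun s => -hat (d s) k) volume 0 T := by
      have : IntervalIntegrable (fun s => hatL k (d s)) volume 0 T :=
        ⟨(hatL k).integrable_comp hi.1, (hatL k).integrable_comp hi.2⟩
      exact this.neg
    have h2 := intervalIntegral.continuousOn_primitive_interval' h1 left_mem_uIcc
    rwa [uIcc_of_le hT] at h2
  have hcb : ∀ k, ContinuousOn (fun t => hatW (b t) k) (Icc 0 T) := fun k => by
    intro t ht
    exact ((continuousOn_const.add (hprim k (ht.1.trans ht.2) iB)).congr (hIb k)) t ht
  have hcω : ∀ k, ContinuousOn (fun t => hatW (ω t) k) (Icc 0 T) := fun k => by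
    intro t ht
    exact ((continuousOn_const.add (hprim k (ht.1.trans ht.2) (iW.add iH))).congr (hIω k)) t ht
  refine ⟨fun t _ => herm_hatW _, fun t _ => herm_hatW _, fun t _ k hk => absurd (mem_univ k) hk,
    fun t _ k hk => absurd (mem_univ k) hk, hSb, hSω, fun t ht k _ => ?_, fun t ht k _ => ?_⟩
  · refine hasDerivWithinAt_of_integral (y₀ := hatW b₀ k)
      (q := fun t => -nlB (hatW f) (hatW (b t)) (hatW (ω t)) k)
      (continuousOn_nlB hd hSb hSω hcb hcω k).neg (fun t ht => (hIb k t ht).trans ?_) ht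
    congr 1
    refine intervalIntegral.integral_congr fun s hs => ?_
    rw [uIcc_of_le ht.1] at hs
    exact congrArg Neg.neg (hnlB s (Icc_subset_Icc_right ht.2 hs) k)
  · refine hasDerivWithinAt_of_integral (y₀ := hatW ω₀ k)
      (q := fun t => -nlW (hatV uh.toL2) (hatW f) (hatW (b t)) (hatW (ω t)) k)
      (continuousOn_nlW hd hSb hSω hcb hcω k).neg (fun t ht => (hIω k t ht).trans ?_) ht
    congr 1
    refine intervalIntegral.integral_congr fun s hs => ?_
    rw [uIcc_of_le ht.1] at hs
    exact congrArg Neg.neg (hnlW s (Icc_subset_Icc_right ht.2 hs) k)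

theorem ModeSol.congr {S : Set Freq} {uh : Freq → Fin 2 → ℂ} {f : Freq → ℂ}
    {b ω b' ω' : ℝ → Freq → ℂ} (h : ModeSol S uh f b ω T R) (hb : ∀ t ∈ Icc 0 T, b' t = b t)
    (hω : ∀ t ∈ Icc 0 T, ω' t = ω t) : ModeSol S uh f b' ω' T R where
  herm_b t ht := hb t ht ▸ h.herm_b t ht
  herm_ω t ht := hω t ht ▸ h.herm_ω t ht
  supp_b t ht := hb t ht ▸ h.supp_b t ht
  supp_ω t ht := hω t ht ▸ h.supp_ω t ht
  sobLe_b t ht := hb t ht ▸ h.sobLe_b t ht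
  sobLe_ω t ht := hω t ht ▸ h.sobLe_ω t ht
  deriv_b t ht k hk := by
    rw [hb t ht, hω t ht]
    exact (h.deriv_b t ht k hk).congr (fun s hs => by rw [hb s hs]) (by rw [hb t ht])
  deriv_ω t ht k hk := by
    rw [hb t ht, hω t ht]
    exact (h.deriv_ω t ht k hk).congr (fun s hs => by rw [hω s hs]) (by rw [hω t ht])

end Bridge

/-! ### The constant and the two halves of the theorem -/

/-- The constant of the theorem. -/
def growthConst (r s : ℝ) : ℝ := (riccati (9 * (2 * |r|)) (9 * |s|) + 1) / 2

/-- The absolute values make `riccati_nonneg` available for all real arguments, and the added 1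
makes the inequality strict. -/
theorem growthConst_pos (r s : ℝ) : 0 < growthConst r s := by
  have := riccati_nonneg (U := 9 * (2 * |r|)) (Φ := 9 * |s|) (by positivity) (by positivity)
  unfold growthConst
  linarith

/-- The right-hand side plus one equals A / (1 - 2cAt), so the bound is the inequality A⁻¹ - 2ct ≤
(1 + N²)⁻¹ with both sides inverted. -/
theorem sq_le_of_inv_sub_le {A ρ c t N N₀ : ℝ} (hA : A = 1 + N₀ ^ 2) (hρ : ρ ≤ 2 * c)
    (ht : 0 ≤ t) (hD : 0 < 1 - 2 * c * A * t) (h : A⁻¹ - ρ * t ≤ (1 + N ^ 2)⁻¹) :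
    N ^ 2 ≤ (N₀ ^ 2 + 2 * c * A * t) / (1 - 2 * c * A * t) := by
  have hA0 : 0 < A := by rw [hA]; positivity
  have h1 : A⁻¹ - 2 * c * t ≤ (1 + N ^ 2)⁻¹ := by
    nlinarith [mul_le_mul_of_nonneg_right hρ ht]
  have h2 : A⁻¹ - 2 * c * t = (1 - 2 * c * A * t) / A := by field_simp
  rw [h2, div_le_iff₀ hA0, inv_mul_eq_div, le_div_iff₀ (by positivity)] at h1
  rw [le_div_iff₀ hD]
  nlinarith

theorem aprioriDenominator_pos {c N t T : ℝ} (hc : 0 < c) (hT : T < 1 / (2 * c * (1 + N ^ 2)))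
    (ht : t ≤ T) : 0 < 1 - 2 * c * (1 + N ^ 2) * t := by
  rw [lt_div_iff₀ (by positivity)] at hT
  have : (2 * c * (1 + N ^ 2)) * t ≤ (2 * c * (1 + N ^ 2)) * T :=
    mul_le_mul_of_nonneg_left ht (by positivity)
  linarith

theorem aprioriBound_mono {c N t T : ℝ} (hc : 0 < c) (h0 : 0 ≤ t) (ht : t ≤ T)
    (hD : 0 < 1 - 2 * c * (1 + N ^ 2) * T) :
    (N ^ 2 + 2 * c * (1 + N ^ 2) * t) / (1 - 2 * c * (1 + N ^ 2) * t) ≤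
      (N ^ 2 + 2 * c * (1 + N ^ 2) * T) / (1 - 2 * c * (1 + N ^ 2) * T) := by
  have : 2 * c * (1 + N ^ 2) * t ≤ 2 * c * (1 + N ^ 2) * T :=
    mul_le_mul_of_nonneg_left ht (by positivity)
  have h2 : 0 ≤ 2 * c * (1 + N ^ 2) * t := by positivity
  have h3 : 0 ≤ N ^ 2 + 2 * c * (1 + N ^ 2) * T := by nlinarith [sq_nonneg N]
  gcongr

section Main

variable {uh : W 3 Plane} {f : W 2 ℝ} {b₀ : W 3 ℝ} {ω₀ : W 2 ℝ} {T : ℝ}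

theorem IsLocalStrongSolution.weaklyContinuous {b : ℝ → W 3 ℝ} {ω : ℝ → W 2 ℝ}
    (h : IsLocalStrongSolution uh f b₀ ω₀ b ω T) :
    IsWeaklyContinuousSolution uh f b₀ ω₀ b ω T :=
  ⟨h.pos, (toWeakSpaceCLM ℝ (W 3 ℝ)).continuous.comp_continuousOn h.continuous_b,
    (toWeakSpaceCLM ℝ (W 2 ℝ)).continuous.comp_continuousOn h.continuous_ω, h.solves⟩

/-- Local existence of strong solutions. -/
theorem exists_isLocalStrongSolution (hu : IsDivFree uh) (hT : 0 < T)
    (hT' : T < 1 / (2 * growthConst ‖uh‖ ‖f‖ * (1 + normM b₀ ω₀ ^ 2))) :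
    ∃ (b : ℝ → W 3 ℝ) (ω : ℝ → W 2 ℝ), AprioriBound (growthConst ‖uh‖ ‖f‖) b₀ ω₀ b ω T ∧
      IsLocalStrongSolution uh f b₀ ω₀ b ω T := by
  have hd := isData_hat f hu
  have hc := growthConst_pos ‖uh‖ ‖f‖
  have hric : riccati (9 * (2 * ‖uh‖)) (9 * ‖f‖) ≤ 2 * growthConst ‖uh‖ ‖f‖ := by
    rw [growthConst, abs_norm, abs_norm]
    linarith
  have hD := aprioriDenominator_pos hc hT' le_rfl
  have hN := normM_eq_normI b₀ ω₀
  -- The restriction on T says exactly that 2cT is below (1 + N₀²)⁻¹, and 2c dominates the Riccati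
  -- rate.
  have hgap : 0 < gap (9 * (2 * ‖uh‖)) (9 * ‖f‖) (hatW b₀) (hatW ω₀) T := by
    have hA : 0 < 1 + normM b₀ ω₀ ^ 2 := by positivity
    have h1 : 2 * growthConst ‖uh‖ ‖f‖ * T < (1 + normM b₀ ω₀ ^ 2)⁻¹ := by
      rw [← one_div, lt_div_iff₀ hA]
      linarith
    rw [gap, ← hN, sub_pos]
    exact (mul_le_mul_of_nonneg_right hric hT.le).trans_lt h1
  obtain ⟨x, w, hmode, hx0, hw0, hbound, -, -⟩ := exists_modeSol hd (herm_hatW b₀) (herm_hatW ω₀)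
    (sobLe_hatW le_rfl b₀) (sobLe_hatW (by norm_num) ω₀) hT.le hgap
  have hexb : ∀ t, ∃ v : W 3 ℝ, t ∈ Icc 0 T → hatW v = x t := fun t => by
    by_cases ht : t ∈ Icc 0 T
    · obtain ⟨v, hv⟩ := exists_hatW_eq (hmode.herm_b t ht) (hmode.sobLe_b t ht)
      exact ⟨v, fun _ => hv⟩
    · exact ⟨0, fun h => absurd h ht⟩
  have hexω : ∀ t, ∃ v : W 2 ℝ, t ∈ Icc 0 T → hatW v = w t := fun t => by
    by_cases ht : t ∈ Icc 0 T
    · obtain ⟨v, hv⟩ := exists_hatW_eq (hmode.herm_ω t ht) (hmode.sobLe_ω t ht)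
      exact ⟨v, fun _ => hv⟩
    · exact ⟨0, fun h => absurd h ht⟩
  choose b hb using hexb
  choose ω hω using hexω
  have hsol := hmode.congr (b' := fun t => hatW (b t)) (ω' := fun t => hatW (ω t)) hb hω
  have h0 : (0 : ℝ) ∈ Icc 0 T := ⟨le_rfl, hT.le⟩
  have hcont := hsol.continuousOn_W hd
  refine ⟨b, ω, fun t ht => ?_, hT, hcont.1, hcont.2,
    hsol.solvesTQG hu hT ((hb 0 h0).trans hx0) ((hω 0 h0).trans hw0)⟩
  have ht' := Ioo_subset_Icc_self ht
  have h1 := hbound t ht'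
  rw [gap, ← hN, ← hb t ht', ← hω t ht', ← normM_eq_normI] at h1
  exact sq_le_of_inv_sub_le rfl hric ht.1.le (aprioriDenominator_pos hc hT' ht.2.le) h1

/-- Bounded weakly continuous solutions are strong solutions. -/
theorem IsWeaklyContinuousSolution.isLocalStrongSolution {c : ℝ} (hc : 0 < c)
    (hu : IsDivFree uh) (hT' : T < 1 / (2 * c * (1 + normM b₀ ω₀ ^ 2))) {b : ℝ → W 3 ℝ}
    {ω : ℝ → W 2 ℝ} (h : IsWeaklyContinuousSolution uh f b₀ ω₀ b ω T)
    (ha : AprioriBound c b₀ ω₀ b ω T) : IsLocalStrongSolution uh f b₀ ω₀ b ω T := by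
  have hD := aprioriDenominator_pos hc hT' le_rfl
  set K := (normM b₀ ω₀ ^ 2 + 2 * c * (1 + normM b₀ ω₀ ^ 2) * T) /
    (1 - 2 * c * (1 + normM b₀ ω₀ ^ 2) * T) with hK
  -- The a priori bound speaks only of the open interval, where it is increasing in t and so at most
  -- K; the two endpoints are covered by adding the norms of the solution there.
  have hbd : ∀ t ∈ Icc 0 T,
      normM (b t) (ω t) ≤ √K + normM (b 0) (ω 0) + normM (b T) (ω T) := by
    intro t ht
    have hn : ∀ t, 0 ≤ normM (b t) (ω t) := fun t => add_nonneg (norm_nonneg _) (norm_nonneg _)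
    have hsq := Real.sqrt_nonneg K
    rcases eq_or_lt_of_le ht.1 with h0 | h0
    · rw [← h0]; linarith [hn T]
    rcases eq_or_lt_of_le ht.2 with h1 | h1
    · rw [h1]; linarith [hn 0]
    have h2 := Real.le_sqrt_of_sq_le
      ((ha t ⟨h0, h1⟩).trans (aprioriBound_mono hc ht.1 ht.2 hD))
    linarith [hn 0, hn T]
  have hmode := h.solves.modeSol hu
    (fun t ht => (le_add_of_nonneg_right (norm_nonneg (ω t))).trans (hbd t ht))
    (fun t ht => (le_add_of_nonneg_left (norm_nonneg (b t))).trans (hbd t ht))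
  have hcont := hmode.continuousOn_W (isData_hat f hu)
  exact ⟨h.pos, hcont.1, hcont.2, h.solves⟩

end Main

end TQG

end

theorem mainTheorem2 :
    ∃ c : ℝ → ℝ → ℝ, (∀ r s : ℝ, 0 < c r s) ∧
      ∀ (uh : TQG.W 3 TQG.Plane) (f : TQG.W 2 ℝ)
        (b₀ : TQG.W 3 ℝ) (ω₀ : TQG.W 2 ℝ), TQG.IsDivFree uh →
      ∀ T : ℝ, 0 < T → T < 1 / (2 * c ‖uh‖ ‖f‖ * (1 + TQG.normM b₀ ω₀ ^ 2)) →
        (∃ (b : ℝ → TQG.W 3 ℝ) (ω : ℝ → TQG.W 2 ℝ),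
          TQG.IsWeaklyContinuousSolution uh f b₀ ω₀ b ω T ∧
          TQG.AprioriBound (c ‖uh‖ ‖f‖) b₀ ω₀ b ω T ∧
          TQG.IsLocalStrongSolution uh f b₀ ω₀ b ω T) ∧
        (∀ (b : ℝ → TQG.W 3 ℝ) (ω : ℝ → TQG.W 2 ℝ),
          TQG.IsWeaklyContinuousSolution uh f b₀ ω₀ b ω T →
          TQG.AprioriBound (c ‖uh‖ ‖f‖) b₀ ω₀ b ω T →
          TQG.IsLocalStrongSolution uh f b₀ ω₀ b ω T) := by
  refine ⟨TQG.growthConst, TQG.growthConst_pos, fun uh f b₀ ω₀ hu T hT hT' => ⟨?_, ?_⟩⟩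
  · obtain ⟨b, ω, ha, hs⟩ := TQG.exists_isLocalStrongSolution hu hT hT'
    exact ⟨b, ω, hs.weaklyContinuous, ha, hs⟩
  · exact fun b ω h ha => h.isLocalStrongSolution (TQG.growthConst_pos _ _) hu hT' ha
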